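/- **SMI categories.** A *symmetric bimonoidal intermuting (SMI) category* is a category $\mathcal C$ with two symmetric monoidal structures $(\vee,\bot)$ and $(\wedge,\top)$, with associativity isomorphisms $\check b^{\to}_{A,B,C}:A\vee(B\vee C)\to(A\vee B)\vee C$, $\hat b^{\to}_{A,B,C}:A\wedge(B\wedge C)\to(A\wedge B)\wedge C$, symmetries $\check c,\hat c$, right identity isomorphisms $\check\delta^{\to}_A:A\vee\bot\to A$, $\hat\delta^{\to}_A:A\wedge\top\to A$ and left identity isomorphisms $\check\sigma^{\to}_A:\bot\vee A\to A$, $\hat\sigma^{\to}_A:\top\wedge A\to A$ (the superscript $^{\leftarrow}$ denotes inverses), together with a natural transformation $$c^k_{A,B,C,D}:(A\wedge B)\vee(C\wedge D)\to(A\vee C)\wedge(B\vee D),$$ isomorphisms $\hat w^{\leftarrow}_\bot:\bot\to\bot\wedge\bot$ and $\check w^{\to}_\top:\top\vee\top\to\top$ (with inverses $\hat w^{\to}_\bot$, $\check w^{\leftarrow}_\top$) and an arrow $\kappa:\bot\to\top$, such that 1. $(c^k_{A,B,D,E}\wedge 1)\circ c^k_{A\wedge B,C,D\wedge E,F}\circ(\hat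 b^{\to}\vee\hat b^{\to})=\hat b^{\to}\circ(1\wedge c^k_{B,C,E,F})\circ c^k_{A,B\wedge C,D,E\wedge F}$; 2. $c^k_{A\vee B,D\vee E,C,F}\circ(c^k_{A,D,B,E}\vee 1)\circ\check b^{\to}=(\check b^{\to}\wedge\check b^{\to})\circ c^k_{A,D,B\vee C,E\vee F}\circ(1\vee c^k_{B,E,C,F})$; 3. $c^k_{B,A,D,C}\circ(\hat c_{A,B}\vee\hat c_{C,D})=\hat c_{A\vee C,B\vee D}\circ c^k_{A,B,C,D}$; 4. $c^k_{B,D,A,C}\circ\check c_{A\wedge C,B\wedge D}=(\check c_{A,B}\wedge\check c_{C,D})\circ c^k_{A,C,B,D}$; 5. $c^k_{A,B,\bot,\bot}=(\check\delta^{\leftarrow}_A\wedge\check\delta^{\leftarrow}_B)\circ\check\delta^{\to}_{A\wedge B}\circ(1\vee\hat w^{\to}_\bot)$; 6. $c^k_{A,\top,B,\top}=(1\wedge\check w^{\leftarrow}_\top)\circ\hat\delta^{\leftarrow}_{A\vee B}\circ(\hat\delta^{\to}_A\vee\hat\delta^{\to}_B)$; 7. $\check b^{\to}_{\top,\top,\top}=(\check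 w^{\leftarrow}_\top\vee 1)\circ(1\vee\check w^{\to}_\top)$; 8. $\hat b^{\to}_{\bot,\bot,\bot}=(\hat w^{\leftarrow}_\bot\wedge 1)\circ(1\wedge\hat w^{\to}_\bot)$; 9. $1_\top\vee\kappa=\check w^{\leftarrow}_\top\circ\check\delta^{\to}_\top$; 10. $1_\bot\wedge\kappa=\hat\delta^{\leftarrow}_\bot\circ\hat w^{\to}_\bot$; 11. $c^k_{\top,\bot,\bot,\top}=(\check\delta^{\leftarrow}_\top\wedge\check\sigma^{\leftarrow}_\top)\circ\hat\delta^{\leftarrow}_\top\circ\kappa\circ\check\delta^{\to}_\bot\circ(\hat\sigma^{\to}_\bot\vee\hat\delta^{\to}_\bot)$; 12. $\check c_{\top,\top}=\check w^{\leftarrow}_\top\circ\check w^{\to}_\top$; 13. $\hat c_{\bot,\bot}=\hat w^{\leftarrow}_\bot\circ\hat w^{\to}_\bot$. **The construction.** Let $\Delta^+$ be the category of the ordinals $[k]=\{0,\dots,k\}$, $k\ge 0$, and order-preserving maps; the object $[k]$ is denoted by $k$. For a strict monoidal category $(\mathcal D,\otimes,I)$ and an arrow $f:k\to l$ of $(\Delta^+)^{op}$,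 given by an order-preserving $\varphi:[l]\to[k]$, let $\overline W\mathcal D(f):\mathcal D^k\to\mathcal D^l$ be the functor whose $j$-th coordinate at $(A_1,\dots,A_k)$ is the tensor product, in increasing order of $i$, of the $A_i$ with $\varphi(j-1)<i\le\varphi(j)$ (it is $I$ when there is no such $i$). Let $\mathcal C$ be an SMI category that is strict monoidal with respect to both $\vee,\bot$ and $\wedge,\top$, and let $n,m\ge 0$. The *$(n,m)$-reduced bar construction* $\overline W\mathcal C_{n,m}$ sends an object $(k_1,\dots,k_{n+m})$ of $((\Delta^+)^{op})^{n+m}$ to $\mathcal C^{k_1\cdots k_{n+m}}$, whose coordinates are indexed by tuples $(i_1,\dots,i_{n+m})$ with $1\le i_s\le k_s$. It sends an arrow $f=(f_1,\dots,f_{n+m})$, $f_i:k_i\to l_i$, to the composite $f^*$, in the order $i=1,2,\dots,n+m$ (the functor for $i=1$ is applied first), of the functors $[\overline W\mathcal D_i(f_i)]^{l_1\cdots l_{i-1}}$, where $\mathcal D_i=\mathcal C^{k_{i+1}\cdots k_{n+m}}$ with the componentwise monoidal structure given by $\vee,\bot$ if $i\le n$ and by $\wedge,\top$ if $i>n$.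 **Theorem.** For all $n,m\ge 0$ and every such $\mathcal C$, $\overline W\mathcal C_{n,m}$ is a lax functor from $((\Delta^+)^{op})^{n+m}$ to $\mathit{Cat}$: it preserves identity arrows, and for every composable pair $f:\vec k\to\vec l$, $g:\vec l\to\vec{\jmath}$ there is a natural transformation $\omega_{g,f}:g^*\circ f^*\to(g\circ f)^*$ such that $\omega_{1,f}$ and $\omega_{f,1}$ are identities and, for all composable $f,g,h$, $$\omega_{h\circ g,f}\circ\omega_{h,g}(f^*)=\omega_{h,g\circ f}\circ h^*(\omega_{g,f}).$$ Moreover, the $\omega_{g,f}$ may be chosen canonically: for each pair $f,g$ and each coordinate of $\mathcal C^{j_1\cdots j_{n+m}}$ there is an arrow term, built by composition, $\vee$ and $\wedge$ from identities, $\check b^{\to},\check b^{\leftarrow},\hat b^{\to},\hat b^{\leftarrow}$, $\check\delta^{\to},\check\delta^{\leftarrow},\hat\delta^{\to},\hat\delta^{\leftarrow}$, $\check\sigma^{\to},\check\sigma^{\leftarrow},\hat\sigma^{\to},\hat\sigma^{\leftarrow}$ (all of which are identities in $\mathcal C$), the symmetries $\check c,\hat c$, and $c^k$, $\check w^{\to}_\top$,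 $\hat w^{\leftarrow}_\bot$, $\kappa$, over letters $p_{i_1\dots i_{n+m}}$ $(1\le i_s\le k_s)$, which does not depend on $\mathcal C$ and such that for every $\vec A\in\mathcal C^{k_1\cdots k_{n+m}}$ that coordinate of $\omega_{g,f}(\vec A)$ is obtained from the term by substituting $A_{i_1\dots i_{n+m}}$ for $p_{i_1\dots i_{n+m}}$. If $n+m\le 1$, all $\omega_{g,f}$ can be taken to be identities, so that $\overline W\mathcal C_{n,m}$ is an ordinary functor. -/

import Mathlib

open CategoryTheory

universe v u

namespace SMI

/-! ### Symmetric bimonoidal intermuting categories -/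

/-- Two symmetric monoidal structures `(∨, ⊥)` and `(∧, ⊤)` on the same category. -/
class BiSymmetric (C : Type u) [Category.{v} C] where
  /-- the monoidal structure given by `∨` and `⊥` -/
  veeMon : MonoidalCategory C
  /-- its symmetry -/
  veeSymm : @SymmetricCategory C _ veeMon
  /-- the monoidal structure given by `∧` and `⊤` -/
  wedgeMon : MonoidalCategory C
  /-- its symmetry -/
  wedgeSymm : @SymmetricCategory C _ wedgeMon

section Operations

variable {C : Type u} [Category.{v} C] [BiSymmetric C]

/-- `A ∨ B` -/
abbrev vee (A B : C) : C := (BiSymmetric.veeMon (C := C)).tensorObj A B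

/-- `A ∧ B` -/
abbrev wedge (A B : C) : C := (BiSymmetric.wedgeMon (C := C)).tensorObj A B

/-- `f ∨ g` -/
abbrev veeHom {A B A' B' : C} (f : A ⟶ A') (g : B ⟶ B') : vee A B ⟶ vee A' B' :=
  (BiSymmetric.veeMon (C := C)).tensorHom f g

/-- `f ∧ g` -/
abbrev wedgeHom {A B A' B' : C} (f : A ⟶ A') (g : B ⟶ B') : wedge A B ⟶ wedge A' B' :=
  (BiSymmetric.wedgeMon (C := C)).tensorHom f g

/-- the unit `⊥` of `∨` -/
abbrev bot : C := (BiSymmetric.veeMon (C := C)).tensorUnit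

/-- the unit `⊤` of `∧` -/
abbrev top : C := (BiSymmetric.wedgeMon (C := C)).tensorUnit

scoped infixr:65 " ∨ₒ " => SMI.vee
scoped infixr:70 " ∧ₒ " => SMI.wedge
scoped infixr:65 " ∨ₕ " => SMI.veeHom
scoped infixr:70 " ∧ₕ " => SMI.wedgeHom

/-- associativity `A ∨ (B ∨ C) ≅ (A ∨ B) ∨ C` -/
abbrev veeB (A B D : C) : A ∨ₒ (B ∨ₒ D) ≅ (A ∨ₒ B) ∨ₒ D :=
  ((BiSymmetric.veeMon (C := C)).associator A B D).symm

/-- right identity `A ∨ ⊥ ≅ A` -/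
abbrev veeDelta (A : C) : A ∨ₒ bot ≅ A := (BiSymmetric.veeMon (C := C)).rightUnitor A

/-- left identity `⊥ ∨ A ≅ A` -/
abbrev veeSigma (A : C) : bot ∨ₒ A ≅ A := (BiSymmetric.veeMon (C := C)).leftUnitor A

/-- symmetry `A ∨ B ≅ B ∨ A` -/
abbrev veeC (A B : C) : A ∨ₒ B ≅ B ∨ₒ A :=
  letI := BiSymmetric.veeMon (C := C)
  letI := BiSymmetric.veeSymm (C := C)
  BraidedCategory.braiding A B

/-- associativity `A ∧ (B ∧ C) ≅ (A ∧ B) ∧ C` -/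
abbrev wedgeB (A B D : C) : A ∧ₒ (B ∧ₒ D) ≅ (A ∧ₒ B) ∧ₒ D :=
  ((BiSymmetric.wedgeMon (C := C)).associator A B D).symm

/-- right identity `A ∧ ⊤ ≅ A` -/
abbrev wedgeDelta (A : C) : A ∧ₒ top ≅ A := (BiSymmetric.wedgeMon (C := C)).rightUnitor A

/-- left identity `⊤ ∧ A ≅ A` -/
abbrev wedgeSigma (A : C) : top ∧ₒ A ≅ A := (BiSymmetric.wedgeMon (C := C)).leftUnitor A

/-- symmetry `A ∧ B ≅ B ∧ A` -/
abbrev wedgeC (A B : C) : A ∧ₒ B ≅ B ∧ₒ A :=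
  letI := BiSymmetric.wedgeMon (C := C)
  letI := BiSymmetric.wedgeSymm (C := C)
  BraidedCategory.braiding A B

end Operations

/-- A symmetric bimonoidal intermuting (SMI) category. -/
class SMICategory (C : Type u) [Category.{v} C] extends BiSymmetric C where
  /-- intermutation -/
  ck : ∀ A B D E : C, (A ∧ₒ B) ∨ₒ (D ∧ₒ E) ⟶ (A ∨ₒ D) ∧ₒ (B ∨ₒ E)
  /-- the isomorphism `⊥ ⟶ ⊥ ∧ ⊥` -/
  wBot : (bot : C) ≅ (bot : C) ∧ₒ bot
  /-- the isomorphism `⊤ ∨ ⊤ ⟶ ⊤` -/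
  wTop : (top : C) ∨ₒ top ≅ (top : C)
  /-- the arrow `⊥ ⟶ ⊤` -/
  kappa : (bot : C) ⟶ (top : C)
  ck_natural : ∀ {A A' B B' D D' E E' : C} (f : A ⟶ A') (g : B ⟶ B') (h : D ⟶ D') (i : E ⟶ E'),
    ((f ∧ₕ g) ∨ₕ (h ∧ₕ i)) ≫ ck A' B' D' E' = ck A B D E ≫ ((f ∨ₕ h) ∧ₕ (g ∨ₕ i))
  eq1 : ∀ A B D A' B' D' : C,
    ((wedgeB A B D).hom ∨ₕ (wedgeB A' B' D').hom) ≫ ck (A ∧ₒ B) D (A' ∧ₒ B') D' ≫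
        (ck A B A' B' ∧ₕ 𝟙 (D ∨ₒ D')) =
      ck A (B ∧ₒ D) A' (B' ∧ₒ D') ≫ (𝟙 (A ∨ₒ A') ∧ₕ ck B D B' D') ≫
        (wedgeB (A ∨ₒ A') (B ∨ₒ B') (D ∨ₒ D')).hom
  eq2 : ∀ A B D A' B' D' : C,
    (veeB (A ∧ₒ A') (B ∧ₒ B') (D ∧ₒ D')).hom ≫ (ck A A' B B' ∨ₕ 𝟙 (D ∧ₒ D')) ≫
        ck (A ∨ₒ B) (A' ∨ₒ B') D D' =
      (𝟙 (A ∧ₒ A') ∨ₕ ck B B' D D') ≫ ck A A' (B ∨ₒ D) (B' ∨ₒ D') ≫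
        ((veeB A B D).hom ∧ₕ (veeB A' B' D').hom)
  eq3 : ∀ A B D E : C,
    ((wedgeC A B).hom ∨ₕ (wedgeC D E).hom) ≫ ck B A E D =
      ck A B D E ≫ (wedgeC (A ∨ₒ D) (B ∨ₒ E)).hom
  eq4 : ∀ A B D E : C,
    (veeC (A ∧ₒ D) (B ∧ₒ E)).hom ≫ ck B E A D =
      ck A D B E ≫ ((veeC A B).hom ∧ₕ (veeC D E).hom)
  eq5 : ∀ A B : C,
    ck A B bot bot =
      (𝟙 (A ∧ₒ B) ∨ₕ wBot.inv) ≫ (veeDelta (A ∧ₒ B)).hom ≫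
        ((veeDelta A).inv ∧ₕ (veeDelta B).inv)
  eq6 : ∀ A B : C,
    ck A top B top =
      ((wedgeDelta A).hom ∨ₕ (wedgeDelta B).hom) ≫ (wedgeDelta (A ∨ₒ B)).inv ≫
        (𝟙 (A ∨ₒ B) ∧ₕ wTop.inv)
  eq7 : (veeB (top : C) top top).hom = (𝟙 (top : C) ∨ₕ wTop.hom) ≫ (wTop.inv ∨ₕ 𝟙 (top : C))
  eq8 : (wedgeB (bot : C) bot bot).hom = (𝟙 (bot : C) ∧ₕ wBot.inv) ≫ (wBot.hom ∧ₕ 𝟙 (bot : C))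
  eq9 : (𝟙 (top : C) ∨ₕ kappa) = (veeDelta (top : C)).hom ≫ wTop.inv
  eq10 : (𝟙 (bot : C) ∧ₕ kappa) = wBot.inv ≫ (wedgeDelta (bot : C)).inv
  eq11 : ck (top : C) bot bot top =
    ((wedgeSigma (bot : C)).hom ∨ₕ (wedgeDelta (bot : C)).hom) ≫ (veeDelta (bot : C)).hom ≫
      kappa ≫ (wedgeDelta (top : C)).inv ≫
        ((veeDelta (top : C)).inv ∧ₕ (veeSigma (top : C)).inv)
  eq12 : (veeC (top : C) top).hom = wTop.hom ≫ wTop.inv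
  eq13 : (wedgeC (bot : C) bot).hom = wBot.inv ≫ wBot.hom

/-- A monoidal category is strict when its associativity and identity isomorphisms are
identities. -/
structure IsStrict {C : Type u} [Category.{v} C] (M : MonoidalCategory C) : Prop where
  assoc_obj : ∀ X Y Z : C,
    M.tensorObj (M.tensorObj X Y) Z = M.tensorObj X (M.tensorObj Y Z)
  leftUnit_obj : ∀ X : C, M.tensorObj M.tensorUnit X = X
  rightUnit_obj : ∀ X : C, M.tensorObj X M.tensorUnit = X
  assoc_hom : ∀ X Y Z : C, (M.associator X Y Z).hom = eqToHom (assoc_obj X Y Z)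
  leftUnit_hom : ∀ X : C, (M.leftUnitor X).hom = eqToHom (leftUnit_obj X)
  rightUnit_hom : ∀ X : C, (M.rightUnitor X).hom = eqToHom (rightUnit_obj X)

/-- An SMI category that is strict monoidal with respect to both `∨, ⊥` and `∧, ⊤`. -/
class StrictSMICategory (C : Type u) [Category.{v} C] extends SMICategory C where
  vee_strict : IsStrict (BiSymmetric.veeMon (C := C))
  wedge_strict : IsStrict (BiSymmetric.wedgeMon (C := C))

/-! ### Formulae and canonical arrow terms -/

/-- Propositional formulae over the letters `P`. -/
inductive Formula (P : Type) : Type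
  | letter (p : P) : Formula P
  | bot : Formula P
  | top : Formula P
  | vee (X Y : Formula P) : Formula P
  | wedge (X Y : Formula P) : Formula P

/-- Arrow terms built from identities, the associativity, symmetry and identity isomorphisms of both
monoidal structures, intermutation `ck`, `wTop : ⊤ ∨ ⊤ ⟶ ⊤`, `wBot : ⊥ ⟶ ⊥ ∧ ⊥` and
`kappa : ⊥ ⟶ ⊤` by composition, `∨` and `∧`. (The inverses of `wTop` and `wBot` are not used.) -/
inductive ArrowTerm {P : Type} : Formula P → Formula P → Type
  | id (X : Formula P) : ArrowTerm X X
  | comp {X Y Z : Formula P} (s : ArrowTerm X Y) (t : ArrowTerm Y Z) : ArrowTerm X Z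
  | vee {X Y X' Y' : Formula P} (s : ArrowTerm X X') (t : ArrowTerm Y Y') :
      ArrowTerm (X.vee Y) (X'.vee Y')
  | wedge {X Y X' Y' : Formula P} (s : ArrowTerm X X') (t : ArrowTerm Y Y') :
      ArrowTerm (X.wedge Y) (X'.wedge Y')
  | veeB (X Y Z : Formula P) : ArrowTerm (X.vee (Y.vee Z)) ((X.vee Y).vee Z)
  | veeBInv (X Y Z : Formula P) : ArrowTerm ((X.vee Y).vee Z) (X.vee (Y.vee Z))
  | veeDelta (X : Formula P) : ArrowTerm (X.vee .bot) X
  | veeDeltaInv (X : Formula P) : ArrowTerm X (X.vee .bot)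
  | veeSigma (X : Formula P) : ArrowTerm (Formula.bot.vee X) X
  | veeSigmaInv (X : Formula P) : ArrowTerm X (Formula.bot.vee X)
  | veeC (X Y : Formula P) : ArrowTerm (X.vee Y) (Y.vee X)
  | wedgeB (X Y Z : Formula P) : ArrowTerm (X.wedge (Y.wedge Z)) ((X.wedge Y).wedge Z)
  | wedgeBInv (X Y Z : Formula P) : ArrowTerm ((X.wedge Y).wedge Z) (X.wedge (Y.wedge Z))
  | wedgeDelta (X : Formula P) : ArrowTerm (X.wedge .top) X
  | wedgeDeltaInv (X : Formula P) : ArrowTerm X (X.wedge .top)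
  | wedgeSigma (X : Formula P) : ArrowTerm (Formula.top.wedge X) X
  | wedgeSigmaInv (X : Formula P) : ArrowTerm X (Formula.top.wedge X)
  | wedgeC (X Y : Formula P) : ArrowTerm (X.wedge Y) (Y.wedge X)
  | ck (X Y Z U : Formula P) :
      ArrowTerm ((X.wedge Y).vee (Z.wedge U)) ((X.vee Z).wedge (Y.vee U))
  | wTop : ArrowTerm (Formula.top.vee .top) .top
  | wBot : ArrowTerm .bot (Formula.bot.wedge .bot)
  | kappa : ArrowTerm .bot .top

section Interpretation

variable {P : Type} {C : Type u} [Category.{v} C] [SMICategory C]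

/-- The object of `C` obtained from a formula by replacing each letter `p` by `A p`. -/
def Formula.eval (A : P → C) : Formula P → C
  | .letter p => A p
  | .bot => SMI.bot
  | .top => SMI.top
  | .vee X Y => X.eval A ∨ₒ Y.eval A
  | .wedge X Y => X.eval A ∧ₒ Y.eval A

/-- The arrow of `C` obtained from an arrow term by replacing each letter `p` by `A p`. -/
def ArrowTerm.eval (A : P → C) : {X Y : Formula P} → ArrowTerm X Y → (X.eval A ⟶ Y.eval A)
  | _, _, .id X => 𝟙 (X.eval A)
  | _, _, .comp s t => s.eval A ≫ t.eval A
  | _, _, .vee s t => s.eval A ∨ₕ t.eval A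
  | _, _, .wedge s t => s.eval A ∧ₕ t.eval A
  | _, _, .veeB X Y Z => (SMI.veeB (X.eval A) (Y.eval A) (Z.eval A)).hom
  | _, _, .veeBInv X Y Z => (SMI.veeB (X.eval A) (Y.eval A) (Z.eval A)).inv
  | _, _, .veeDelta X => (SMI.veeDelta (X.eval A)).hom
  | _, _, .veeDeltaInv X => (SMI.veeDelta (X.eval A)).inv
  | _, _, .veeSigma X => (SMI.veeSigma (X.eval A)).hom
  | _, _, .veeSigmaInv X => (SMI.veeSigma (X.eval A)).inv
  | _, _, .veeC X Y => (SMI.veeC (X.eval A) (Y.eval A)).hom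
  | _, _, .wedgeB X Y Z => (SMI.wedgeB (X.eval A) (Y.eval A) (Z.eval A)).hom
  | _, _, .wedgeBInv X Y Z => (SMI.wedgeB (X.eval A) (Y.eval A) (Z.eval A)).inv
  | _, _, .wedgeDelta X => (SMI.wedgeDelta (X.eval A)).hom
  | _, _, .wedgeDeltaInv X => (SMI.wedgeDelta (X.eval A)).inv
  | _, _, .wedgeSigma X => (SMI.wedgeSigma (X.eval A)).hom
  | _, _, .wedgeSigmaInv X => (SMI.wedgeSigma (X.eval A)).inv
  | _, _, .wedgeC X Y => (SMI.wedgeC (X.eval A) (Y.eval A)).hom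
  | _, _, .ck X Y Z U => SMICategory.ck (X.eval A) (Y.eval A) (Z.eval A) (U.eval A)
  | _, _, .wTop => SMICategory.wTop.hom
  | _, _, .wBot => SMICategory.wBot.hom
  | _, _, .kappa => SMICategory.kappa

end Interpretation

/-- An arrow term over the letters `P`, together with its source and target. -/
structure CanonicalArrow (P : Type) where
  /-- the source -/
  source : Formula P
  /-- the target -/
  target : Formula P
  /-- the arrow term -/
  term : ArrowTerm source target

/-! ### The reduced bar construction based on one monoidal category

`SimplexCategory` is the topologist's simplicial category; `k.unop.len` is the natural number (the
geometric dimension) that names the object `k` of `SimplexCategoryᵒᵖ`. -/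

/-- The order-preserving map `{0, …, k + 1} → {0, …, l + 1}`, preserving the first and the last
element, that presents graphically an arrow `f : k ⟶ l` of `SimplexCategoryᵒᵖ`: it is the
complement of the graph of the monotone map `φ = f.unop : {0, …, l} → {0, …, k}`, and sends `y` to
the number of `x` with `φ x < y`. -/
def dual {k l : SimplexCategoryᵒᵖ} (f : k ⟶ l) (y : ℕ) : ℕ :=
  (Finset.univ.filter
    fun x : Fin (l.unop.len + 1) => (f.unop.toOrderHom x : ℕ) < y).card

/-- The positions among `1, …, k` that `dual f` sends to the position `j` among `1, …, l`, in
increasing order. (A position `i` is the element `i - 1` of `Fin k`.) -/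
def fibre {k l : SimplexCategoryᵒᵖ} (f : k ⟶ l) (j : Fin l.unop.len) : List (Fin k.unop.len) :=
  (List.finRange k.unop.len).filter fun i => dual f (i + 1) = j + 1

/-- The functor `(A_i) ↦ A_{i₁} ⊗ (A_{i₂} ⊗ ⋯ )` for a list of indices; the empty list gives the
unit. -/
def tensorList {ι : Type} (D : Type u) [Category.{v} D] [MonoidalCategory D] :
    List ι → ((ι → D) ⥤ D)
  | [] => (Functor.const (ι → D)).obj (MonoidalCategoryStruct.tensorUnit D)
  | i :: L =>
      Functor.prod' (Pi.eval (fun _ => D) i) (tensorList D L) ⋙ MonoidalCategory.tensor D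

/-- The reduced bar construction based on `D`, on an arrow `f : k ⟶ l` of `SimplexCategoryᵒᵖ`: the
`j`-th coordinate of the functor `D ^ k ⥤ D ^ l` is the tensor product, in order, of the coordinates
in the fibre of `f` over `j`. -/
def bar (D : Type u) [Category.{v} D] [MonoidalCategory D] {k l : SimplexCategoryᵒᵖ} (f : k ⟶ l) :
    (Fin k.unop.len → D) ⥤ (Fin l.unop.len → D) :=
  Functor.pi' fun j => tensorList D (fibre f j)

/-! ### The iterated reduced bar construction -/

/-- The tuples `(i₁, …, i_N)` indexing the `k₁ ⋯ k_N` coordinates of an object of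
`C ^ (k₁ ⋯ k_N)`. -/
abbrev MultiIndex {N : ℕ} (k : Fin N → SimplexCategoryᵒᵖ) : Type :=
  ∀ i : Fin N, Fin (k i).unop.len

section Iterated

variable (C : Type u) [Category.{v} C]

/-- The isomorphism from `C ^ (k₁ k₂ ⋯ k_N)` to `(C ^ (k₂ ⋯ k_N)) ^ k₁`. -/
def curryPower {N : ℕ} (k : Fin (N + 1) → SimplexCategoryᵒᵖ) :
    (MultiIndex k → C) ⥤ (Fin (k 0).unop.len → MultiIndex (fun i : Fin N => k i.succ) → C) where
  obj A a β := A (Fin.cons (α := fun i => Fin (k i).unop.len) a β)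
  map h a β := h (Fin.cons (α := fun i => Fin (k i).unop.len) a β)

/-- The isomorphism from `(C ^ (k₂ ⋯ k_N)) ^ k₁` to `C ^ (k₁ k₂ ⋯ k_N)`. -/
def uncurryPower {N : ℕ} (k : Fin (N + 1) → SimplexCategoryᵒᵖ) :
    (Fin (k 0).unop.len → MultiIndex (fun i : Fin N => k i.succ) → C) ⥤ (MultiIndex k → C) where
  obj A α := A (α 0) fun i => α i.succ
  map h α := h (α 0) fun i => α i.succ

/-- The reduced bar construction iterated along the monoidal structures `T 0, …, T (N - 1)` on `C`.
The functor of `(f₁, …, f_N)` is first the functor of `f₁` in the reduced bar construction based on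
`D = C ^ (k₂ ⋯ k_N)` with the componentwise monoidal structure given by the first tensor, then the
`l₁`-th power of the functor of `(f₂, …, f_N)`. Unfolding, it is the composite for
`i = 1, …, N` of the `l₁ ⋯ l_{i-1}`-th powers of the functors of `f_i` in the reduced bar
constructions based on `C ^ (k_{i+1} ⋯ k_N)` with the `i`-th tensor. -/
def iteratedBar : {N : ℕ} → (T : Fin N → MonoidalCategory C) → {k l : Fin N → SimplexCategoryᵒᵖ} →
    (k ⟶ l) → ((MultiIndex k → C) ⥤ (MultiIndex l → C))
  | 0, _, _, _, _ => Pi.comap (fun _ => C) fun _ i => i.elim0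
  | _ + 1, T, k, l, f =>
      letI := T 0
      curryPower C k ⋙ bar (MultiIndex (fun i => k (Fin.succ i)) → C) (f 0) ⋙
        Functor.pi (fun _ => iteratedBar (fun i => T i.succ) (k := fun i => k i.succ)
          (l := fun i => l i.succ) (fun i => f i.succ)) ⋙
        uncurryPower C l

/-- The list of tensors used in the `(n, m)`-reduced bar construction: `∨` for the first `n`
coordinates, `∧` for the last `m`. -/
@[reducible] def tensors [BiSymmetric C] (n m : ℕ) (i : Fin (n + m)) : MonoidalCategory C :=
  if (i : ℕ) < n then BiSymmetric.veeMon else BiSymmetric.wedgeMon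

/-- The functor `f^*` that the `(n, m)`-reduced bar construction based on `C` assigns to an arrow
`f` of `(SimplexCategoryᵒᵖ) ^ (n + m)`. -/
def pull [BiSymmetric C] (n m : ℕ) {k l : Fin (n + m) → SimplexCategoryᵒᵖ} (f : k ⟶ l) :
    (MultiIndex k → C) ⥤ (MultiIndex l → C) :=
  iteratedBar C (tensors C n m) f

/-- The `(n, m)`-reduced bar construction based on `C`: its objects and its arrows. (The category
`(SimplexCategoryᵒᵖ) ^ (n + m)` is regarded as a bicategory whose only 2-cells are identities.) -/
def reducedBar [BiSymmetric C] (n m : ℕ) :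
    PrelaxFunctor (LocallyDiscrete (Fin (n + m) → SimplexCategoryᵒᵖ)) Cat.{v, u} where
  obj k := Cat.of (MultiIndex k.as → C)
  map f := (pull C n m f.as).toCatHom
  map₂ η := eqToHom (by rw [LocallyDiscrete.eq_of_hom η])
  map₂_id _ := rfl
  map₂_comp _ _ := (eqToHom_trans _ _).symm

end Iterated

/-! ### The comparison cells of a lax functor extending given data on objects and arrows -/

section Lax

universe w₁ w₂ v₁ v₂ u₁ u₂

variable {B : Type u₁} [Bicategory.{w₁, v₁} B] {K : Type u₂} [Bicategory.{w₂, v₂} K]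

/-- The 2-cell `𝟙 ⟶ R (𝟙 a)` of a lax functor `F` whose action on objects, arrows and 2-cells is
`R`. -/
def laxId {R : PrelaxFunctor B K} (F : LaxFunctor B K) (hF : F.toPrelaxFunctor = R) (a : B) :
    𝟙 (R.obj a) ⟶ R.map (𝟙 a) :=
  hF ▸ F.mapId a

/-- The 2-cell `R g ∘ R f ⟶ R (g ∘ f)` of a lax functor `F` whose action on objects, arrows and
2-cells is `R`. -/
def laxComp {R : PrelaxFunctor B K} (F : LaxFunctor B K) (hF : F.toPrelaxFunctor = R) {a b c : B}
    (f : a ⟶ b) (g : b ⟶ c) : R.map f ≫ R.map g ⟶ R.map (f ≫ g) :=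
  hF ▸ F.mapComp f g

end Lax

end SMI

/-!
Let `∨` precede `∧`. The arrows `c^k`, `w_⊤`, `w_⊥` and `κ` say that the functors `∧` and `⊤` are
lax monoidal for `∨`, and a symmetry says the same of a monoidal structure and itself. So the
products of lists formed with one structure are lax monoidal for every structure that does not come
after it, and by induction the functors `(f₂, …, f_N)^*` are lax monoidal for the structure of the
first coordinate. The composite `g^* ∘ f^*` differs from `(g ∘ f)^*` in that `(f₂, …, f_N)^*` is
applied to the factors of the products that `g₁` forms, rather than to the products. The comparison
`ω_{g,f}` passes these products through `(f₂, …, f_N)^*` by its lax monoidal structure, and then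
applies the comparison of the tails.

Coherence needs, besides induction, that the comparison of the tails is a monoidal transformation.
This is proved by the same induction: it requires that `(f₂, …, f_N)^*` be lax monoidal for two
interchanging structures compatibly, which is where the hexagonal equations of `c^k` enter.

Every arrow in the construction is the value of an arrow term, up to equalities of objects that hold
in all strict SMI categories. To compose such terms, formulae with equal values must be joined by
terms whose values are identities. This is tested in the indiscrete category whose objects are the
formulae modulo being joined in that way, since it is a strict SMI category.
-/

namespace SMI

/-! ### Interchange of two monoidal structures -/

/-- The tensor product of objects for the monoidal structure `S`. -/
abbrev tensorObj {D : Type u} [Category.{v} D] (S : MonoidalCategory D) (A B : D) : D :=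
  S.tensorObj A B

scoped notation:70 A:71 " ⊗[" S "] " B:70 => SMI.tensorObj S A B

/-- The tensor product of arrows for the monoidal structure `S`. -/
abbrev tensorHom {D : Type u} [Category.{v} D] (S : MonoidalCategory D) {A A' B B' : D}
    (f : A ⟶ A') (g : B ⟶ B') : A ⊗[S] B ⟶ A' ⊗[S] B' :=
  S.tensorHom f g

scoped notation:70 f:71 " ⊗ₘ[" S "] " g:70 => SMI.tensorHom S f g

section TensorHom

variable {D : Type u} [Category.{v} D] (S : MonoidalCategory D)

@[simp]
theorem tensorHom_comp {A A' A'' B B' B'' : D} (f : A ⟶ A') (f' : A' ⟶ A'') (g : B ⟶ B')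
    (g' : B' ⟶ B'') : (f ⊗ₘ[S] g) ≫ (f' ⊗ₘ[S] g') = (f ≫ f') ⊗ₘ[S] (g ≫ g') :=
  S.tensorHom_comp_tensorHom f g f' g'

@[simp]
theorem tensorHom_comp_assoc {A A' A'' B B' B'' X : D} (f : A ⟶ A') (f' : A' ⟶ A'')
    (g : B ⟶ B') (g' : B' ⟶ B'') (k : A'' ⊗[S] B'' ⟶ X) :
    (f ⊗ₘ[S] g) ≫ (f' ⊗ₘ[S] g') ≫ k = ((f ≫ f') ⊗ₘ[S] (g ≫ g')) ≫ k := by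
  rw [← Category.assoc, tensorHom_comp]

@[simp]
theorem tensorHom_id_id (A B : D) : 𝟙 A ⊗ₘ[S] 𝟙 B = 𝟙 (A ⊗[S] B) :=
  S.id_tensorHom_id A B

theorem comp_tensorHom_id {A A' A'' : D} (B : D) (f : A ⟶ A') (g : A' ⟶ A'') :
    (f ≫ g) ⊗ₘ[S] 𝟙 B = (f ⊗ₘ[S] 𝟙 B) ≫ (g ⊗ₘ[S] 𝟙 B) := by simp

theorem id_tensorHom_comp {A A' A'' : D} (B : D) (f : A ⟶ A') (g : A' ⟶ A'') :
    𝟙 B ⊗ₘ[S] (f ≫ g) = (𝟙 B ⊗ₘ[S] f) ≫ (𝟙 B ⊗ₘ[S] g) := by simp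

theorem id_tensorHom_leftUnitor {A A' : D} (f : A ⟶ A') :
    (𝟙 S.tensorUnit ⊗ₘ[S] f) ≫ (S.leftUnitor A').hom = (S.leftUnitor A).hom ≫ f := by
  simp

theorem tensorHom_id_rightUnitor {A A' : D} (f : A ⟶ A') :
    (f ⊗ₘ[S] 𝟙 S.tensorUnit) ≫ (S.rightUnitor A').hom = (S.rightUnitor A).hom ≫ f := by
  simp

/-- The componentwise monoidal structure on a power of a category. -/
abbrev piMonoidal (K : Type) : MonoidalCategory (K → D) :=
  @Pi.monoidalCategory K (fun _ => D) _ (fun _ => S)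

end TensorHom

section Interchange

variable {D : Type u} [Category.{v} D]

/-- An interchange of `T` over `S`, that is, a duoidal structure: the tensor product and the unit
of `T`, its associativity and its identity isomorphisms are lax monoidal with respect to `S`. The
transformation `ζ` is the middle four interchange; `Δ`, `μ` and `ι` compare the two units. -/
structure Interchange (S T : MonoidalCategory D) where
  ζ : ∀ A B A' B', (A ⊗[T] B) ⊗[S] (A' ⊗[T] B') ⟶ (A ⊗[S] A') ⊗[T] (B ⊗[S] B')
  Δ : S.tensorUnit ⟶ S.tensorUnit ⊗[T] S.tensorUnit
  μ : T.tensorUnit ⊗[S] T.tensorUnit ⟶ T.tensorUnit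
  ι : S.tensorUnit ⟶ T.tensorUnit
  ζ_natural : ∀ {A A' B B' E E' G G' : D} (f : A ⟶ A') (g : B ⟶ B') (f' : E ⟶ E') (g' : G ⟶ G'),
    ((f ⊗ₘ[T] g) ⊗ₘ[S] (f' ⊗ₘ[T] g')) ≫ ζ _ _ _ _ =
      ζ _ _ _ _ ≫ ((f ⊗ₘ[S] f') ⊗ₘ[T] (g ⊗ₘ[S] g'))
  ζ_associativity : ∀ A B A' B' A'' B'',
    (ζ A B A' B' ⊗ₘ[S] 𝟙 (A'' ⊗[T] B'')) ≫ ζ _ _ _ _ ≫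
        ((S.associator A A' A'').hom ⊗ₘ[T] (S.associator B B' B'').hom) =
      (S.associator (A ⊗[T] B) (A' ⊗[T] B') (A'' ⊗[T] B'')).hom ≫
        (𝟙 (A ⊗[T] B) ⊗ₘ[S] ζ A' B' A'' B'') ≫ ζ _ _ _ _
  ζ_left_unitality : ∀ A B, (Δ ⊗ₘ[S] 𝟙 (A ⊗[T] B)) ≫ ζ _ _ _ _ ≫
    ((S.leftUnitor A).hom ⊗ₘ[T] (S.leftUnitor B).hom) = (S.leftUnitor (A ⊗[T] B)).hom
  ζ_right_unitality : ∀ A B, (𝟙 (A ⊗[T] B) ⊗ₘ[S] Δ) ≫ ζ _ _ _ _ ≫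
    ((S.rightUnitor A).hom ⊗ₘ[T] (S.rightUnitor B).hom) = (S.rightUnitor (A ⊗[T] B)).hom
  μ_associativity : (μ ⊗ₘ[S] 𝟙 T.tensorUnit) ≫ μ =
    (S.associator _ _ _).hom ≫ (𝟙 T.tensorUnit ⊗ₘ[S] μ) ≫ μ
  μ_left_unitality : (ι ⊗ₘ[S] 𝟙 T.tensorUnit) ≫ μ = (S.leftUnitor _).hom
  μ_right_unitality : (𝟙 T.tensorUnit ⊗ₘ[S] ι) ≫ μ = (S.rightUnitor _).hom
  ζ_associator : ∀ A B E A' B' E',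
    ((T.associator A B E).hom ⊗ₘ[S] (T.associator A' B' E').hom) ≫ ζ _ _ _ _ ≫
        (𝟙 (A ⊗[S] A') ⊗ₘ[T] ζ B E B' E') =
      ζ _ _ _ _ ≫ (ζ A B A' B' ⊗ₘ[T] 𝟙 (E ⊗[S] E')) ≫ (T.associator _ _ _).hom
  Δ_associator : Δ ≫ (Δ ⊗ₘ[T] 𝟙 S.tensorUnit) ≫ (T.associator _ _ _).hom =
    Δ ≫ (𝟙 S.tensorUnit ⊗ₘ[T] Δ)
  ζ_leftUnitor : ∀ A B, ζ T.tensorUnit A T.tensorUnit B ≫ (μ ⊗ₘ[T] 𝟙 (A ⊗[S] B)) ≫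
    (T.leftUnitor _).hom = (T.leftUnitor A).hom ⊗ₘ[S] (T.leftUnitor B).hom
  Δ_leftUnitor : Δ ≫ (ι ⊗ₘ[T] 𝟙 S.tensorUnit) ≫ (T.leftUnitor _).hom = 𝟙 _
  ζ_rightUnitor : ∀ A B, ζ A T.tensorUnit B T.tensorUnit ≫ (𝟙 (A ⊗[S] B) ⊗ₘ[T] μ) ≫
    (T.rightUnitor _).hom = (T.rightUnitor A).hom ⊗ₘ[S] (T.rightUnitor B).hom
  Δ_rightUnitor : Δ ≫ (𝟙 S.tensorUnit ⊗ₘ[T] ι) ≫ (T.rightUnitor _).hom = 𝟙 _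

theorem Interchange.tensorHom_id_ζ {S T : MonoidalCategory D} (a : Interchange S T)
    {A B A' B' : D} (f : A ⟶ A') (g : B ⟶ B') (X Y : D) :
    ((f ⊗ₘ[T] g) ⊗ₘ[S] 𝟙 (X ⊗[T] Y)) ≫ a.ζ A' B' X Y =
      a.ζ A B X Y ≫ ((f ⊗ₘ[S] 𝟙 X) ⊗ₘ[T] (g ⊗ₘ[S] 𝟙 Y)) := by
  rw [← a.ζ_natural, tensorHom_id_id]

theorem Interchange.id_tensorHom_ζ {S T : MonoidalCategory D} (a : Interchange S T)
    {A B A' B' : D} (f : A ⟶ A') (g : B ⟶ B') (X Y : D) :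
    (𝟙 (X ⊗[T] Y) ⊗ₘ[S] (f ⊗ₘ[T] g)) ≫ a.ζ X Y A' B' =
      a.ζ X Y A B ≫ ((𝟙 X ⊗ₘ[S] f) ⊗ₘ[T] (𝟙 Y ⊗ₘ[S] g)) := by
  rw [← a.ζ_natural, tensorHom_id_id]

/-- The hexagonal compatibility of the three interchanges between `R`, `S` and `T`: those with `T`
make its tensor product and its unit into functors that are lax for `R` and `S` together, in the
sense of `IsDoubleLax` below. -/
structure Interchange.Compatible {R S T : MonoidalCategory D} (a : Interchange R S)
    (b : Interchange R T) (c : Interchange S T) : Prop where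
  ζ_ζ : ∀ A B E G A' B' E' G',
    a.ζ (A ⊗[T] B) (E ⊗[T] G) (A' ⊗[T] B') (E' ⊗[T] G') ≫
        (b.ζ A B A' B' ⊗ₘ[S] b.ζ E G E' G') ≫ c.ζ _ _ _ _ =
      (c.ζ A B E G ⊗ₘ[R] c.ζ A' B' E' G') ≫ b.ζ _ _ _ _ ≫
        (a.ζ A E A' E' ⊗ₘ[T] a.ζ B G B' G')
  Δ_ζ : a.Δ ≫ (b.Δ ⊗ₘ[S] b.Δ) ≫ c.ζ _ _ _ _ = b.Δ ≫ (a.Δ ⊗ₘ[T] a.Δ)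
  μ_Δ : a.μ ≫ c.Δ = (c.Δ ⊗ₘ[R] c.Δ) ≫ b.ζ _ _ _ _ ≫ (a.μ ⊗ₘ[T] a.μ)
  ι_Δ : a.ι ≫ c.Δ = b.Δ ≫ (a.ι ⊗ₘ[T] a.ι)
  ζ_μ : a.ζ T.tensorUnit T.tensorUnit T.tensorUnit T.tensorUnit ≫ (b.μ ⊗ₘ[S] b.μ) ≫ c.μ =
    (c.μ ⊗ₘ[R] c.μ) ≫ b.μ
  Δ_μ : a.Δ ≫ (b.ι ⊗ₘ[S] b.ι) ≫ c.μ = b.ι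
  μ_ι : a.μ ≫ c.ι = (c.ι ⊗ₘ[R] c.ι) ≫ b.μ
  ι_ι : a.ι ≫ c.ι = b.ι

/-- The componentwise interchange on a power of a category. -/
def Interchange.pi (K : Type) {S T : MonoidalCategory D} (a : Interchange S T) :
    Interchange (piMonoidal S K) (piMonoidal T K) where
  ζ A B A' B' i := a.ζ (A i) (B i) (A' i) (B' i)
  Δ _ := a.Δ
  μ _ := a.μ
  ι _ := a.ι
  ζ_natural f g f' g' := funext fun i => a.ζ_natural (f i) (g i) (f' i) (g' i)
  ζ_associativity A B A' B' A'' B'' :=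
    funext fun i => a.ζ_associativity (A i) (B i) (A' i) (B' i) (A'' i) (B'' i)
  ζ_left_unitality A B := funext fun i => a.ζ_left_unitality (A i) (B i)
  ζ_right_unitality A B := funext fun i => a.ζ_right_unitality (A i) (B i)
  μ_associativity := funext fun _ => a.μ_associativity
  μ_left_unitality := funext fun _ => a.μ_left_unitality
  μ_right_unitality := funext fun _ => a.μ_right_unitality
  ζ_associator A B E A' B' E' :=
    funext fun i => a.ζ_associator (A i) (B i) (E i) (A' i) (B' i) (E' i)
  Δ_associator := funext fun _ => a.Δ_associator
  ζ_leftUnitor A B := funext fun i => a.ζ_leftUnitor (A i) (B i)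
  Δ_leftUnitor := funext fun _ => a.Δ_leftUnitor
  ζ_rightUnitor A B := funext fun i => a.ζ_rightUnitor (A i) (B i)
  Δ_rightUnitor := funext fun _ => a.Δ_rightUnitor

theorem Interchange.Compatible.pi (K : Type) {R S T : MonoidalCategory D} {a : Interchange R S}
    {b : Interchange R T} {c : Interchange S T} (h : a.Compatible b c) :
    (a.pi K).Compatible (b.pi K) (c.pi K) where
  ζ_ζ A B E G A' B' E' G' :=
    funext fun i => h.ζ_ζ (A i) (B i) (E i) (G i) (A' i) (B' i) (E' i) (G' i)
  Δ_ζ := funext fun _ => h.Δ_ζ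
  μ_Δ := funext fun _ => h.μ_Δ
  ι_Δ := funext fun _ => h.ι_Δ
  ζ_μ := funext fun _ => h.ζ_μ
  Δ_μ := funext fun _ => h.Δ_μ
  μ_ι := funext fun _ => h.μ_ι
  ι_ι := funext fun _ => h.ι_ι

end Interchange

/-! ### Lax monoidal structures for two interchanging tensor products -/

section LaxMonoidal

variable {D : Type u} [Category.{v} D] {E : Type u} [Category.{v} E]
  {G : Type u} [Category.{v} G]

/-- A lax monoidal structure on the functor `F` for the monoidal structures `S` and `S'`, which are
explicit because several of them coexist on the same category. -/
abbrev LaxStructure (S : MonoidalCategory D) (S' : MonoidalCategory E) (F : D ⥤ E) :=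
  @Functor.LaxMonoidal D _ S E _ S' F

namespace LaxStructure

section Accessors

variable {S : MonoidalCategory D} {S' : MonoidalCategory E} {F : D ⥤ E} (l : LaxStructure S S' F)

/-- The comparison of the units. -/
abbrev ε : S'.tensorUnit ⟶ F.obj S.tensorUnit := @Functor.LaxMonoidal.ε _ _ S _ _ S' F l

/-- The comparison of the tensor products. -/
abbrev μ (A B : D) : F.obj A ⊗[S'] F.obj B ⟶ F.obj (A ⊗[S] B) :=
  @Functor.LaxMonoidal.μ _ _ S _ _ S' F l A B

theorem μ_natural {A A' B B' : D} (f : A ⟶ A') (g : B ⟶ B') :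
    (F.map f ⊗ₘ[S'] F.map g) ≫ l.μ A' B' = l.μ A B ≫ F.map (f ⊗ₘ[S] g) :=
  @Functor.LaxMonoidal.μ_natural _ _ S _ _ S' F l _ _ _ _ f g

theorem associativity (A B X : D) :
    (l.μ A B ⊗ₘ[S'] 𝟙 (F.obj X)) ≫ l.μ (A ⊗[S] B) X ≫ F.map (S.associator A B X).hom =
      (S'.associator _ _ _).hom ≫ (𝟙 (F.obj A) ⊗ₘ[S'] l.μ B X) ≫ l.μ A (B ⊗[S] X) := by simp

theorem left_unitality (A : D) :
    (l.ε ⊗ₘ[S'] 𝟙 (F.obj A)) ≫ l.μ _ A ≫ F.map (S.leftUnitor A).hom =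
      (S'.leftUnitor _).hom := by simp

theorem right_unitality (A : D) :
    (𝟙 (F.obj A) ⊗ₘ[S'] l.ε) ≫ l.μ A _ ≫ F.map (S.rightUnitor A).hom =
      (S'.rightUnitor _).hom := by simp

end Accessors

/-- The lax monoidal structure with given comparisons, the laws being stated with tensor products
of arrows instead of whiskerings. -/
@[reducible] def ofTensorHom {S : MonoidalCategory D} {S' : MonoidalCategory E} {F : D ⥤ E}
    (ε : S'.tensorUnit ⟶ F.obj S.tensorUnit)
    (μ : ∀ A B, F.obj A ⊗[S'] F.obj B ⟶ F.obj (A ⊗[S] B))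
    (μ_natural : ∀ {A A' B B' : D} (f : A ⟶ A') (g : B ⟶ B'),
      (F.map f ⊗ₘ[S'] F.map g) ≫ μ A' B' = μ A B ≫ F.map (f ⊗ₘ[S] g))
    (associativity : ∀ A B X,
      (μ A B ⊗ₘ[S'] 𝟙 (F.obj X)) ≫ μ (A ⊗[S] B) X ≫ F.map (S.associator A B X).hom =
        (S'.associator _ _ _).hom ≫ (𝟙 (F.obj A) ⊗ₘ[S'] μ B X) ≫ μ A (B ⊗[S] X))
    (left_unitality : ∀ A, (ε ⊗ₘ[S'] 𝟙 (F.obj A)) ≫ μ _ A ≫ F.map (S.leftUnitor A).hom =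
      (S'.leftUnitor _).hom)
    (right_unitality : ∀ A, (𝟙 (F.obj A) ⊗ₘ[S'] ε) ≫ μ A _ ≫ F.map (S.rightUnitor A).hom =
      (S'.rightUnitor _).hom) : LaxStructure S S' F :=
  @Functor.LaxMonoidal.ofTensorHom _ _ S _ _ S' F ε μ μ_natural associativity
    (fun A => (left_unitality A).symm) (fun A => (right_unitality A).symm)

/-- The lax monoidal structure on the identity functor. -/
@[reducible] def id (S : MonoidalCategory D) : LaxStructure S S (𝟭 D) :=
  @Functor.LaxMonoidal.id D _ S

/-- The lax monoidal structure on a composite. -/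
@[reducible] def comp {S : MonoidalCategory D} {S' : MonoidalCategory E} {S'' : MonoidalCategory G}
    {F : D ⥤ E} {H : E ⥤ G} (l : LaxStructure S S' F) (m : LaxStructure S' S'' H) :
    LaxStructure S S'' (F ⋙ H) :=
  @Functor.LaxMonoidal.comp _ _ S _ _ S' _ _ S'' F H l m

/-- The lax monoidal structure on a power of a functor. -/
@[reducible] def pi (K : Type) {S : MonoidalCategory D} {S' : MonoidalCategory E} {F : D ⥤ E}
    (l : LaxStructure S S' F) :
    LaxStructure (piMonoidal S K) (piMonoidal S' K) (Functor.pi fun _ : K => F) :=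
  ofTensorHom (fun _ => l.ε) (fun A B i => l.μ (A i) (B i))
    (fun f g => funext fun i => l.μ_natural (f i) (g i))
    (fun A B X => funext fun i => l.associativity (A i) (B i) (X i))
    (fun A => funext fun i => l.left_unitality (A i))
    (fun A => funext fun i => l.right_unitality (A i))

/-- The lax monoidal structure on a functor into a power. -/
@[reducible] def pi' {K : Type} {S : MonoidalCategory D} {S' : MonoidalCategory E}
    {F : K → D ⥤ E} (l : ∀ i, LaxStructure S S' (F i)) :
    LaxStructure S (piMonoidal S' K) (Functor.pi' F) :=
  ofTensorHom (fun i => (l i).ε) (fun A B i => (l i).μ A B)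
    (fun f g => funext fun i => (l i).μ_natural f g)
    (fun A B X => funext fun i => (l i).associativity A B X)
    (fun A => funext fun i => (l i).left_unitality A)
    (fun A => funext fun i => (l i).right_unitality A)

/-- The lax monoidal structure on a projection of a power. -/
@[reducible] def eval {K : Type} (S : MonoidalCategory D) (i : K) :
    LaxStructure (piMonoidal S K) S (Pi.eval (fun _ => D) i) :=
  letI := S
  Functor.Monoidal.toLaxMonoidal (F := Pi.eval (fun _ => D) i)

/-- The lax monoidal structure that an interchange provides on the functor constant at the unit of
the second monoidal structure. -/
@[reducible] def const (S : MonoidalCategory D) {S' T : MonoidalCategory E}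
    (a : Interchange S' T) : LaxStructure S S' ((Functor.const D).obj T.tensorUnit) :=
  ofTensorHom a.ι (fun _ _ => a.μ)
    (fun _ _ => by
      change (𝟙 T.tensorUnit ⊗ₘ[S'] 𝟙 T.tensorUnit) ≫ a.μ = a.μ ≫ 𝟙 _
      simp)
    (fun _ _ _ => by simpa using a.μ_associativity) (fun _ => by simpa using a.μ_left_unitality)
    (fun _ => by simpa using a.μ_right_unitality)

/-- The lax monoidal structure that an interchange provides on the tensor product, for the second
monoidal structure, of two lax monoidal functors. -/
@[reducible] def tensor {S : MonoidalCategory D} {S' T : MonoidalCategory E}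
    (a : Interchange S' T) {F H : D ⥤ E} (l : LaxStructure S S' F) (m : LaxStructure S S' H) :
    LaxStructure S S' (F.prod' H ⋙ @MonoidalCategory.tensor E _ T) :=
  ofTensorHom (a.Δ ≫ (l.ε ⊗ₘ[T] m.ε)) (fun A B => a.ζ _ _ _ _ ≫ (l.μ A B ⊗ₘ[T] m.μ A B))
    (fun {A A' B B'} f g => by
      change ((F.map f ⊗ₘ[T] H.map f) ⊗ₘ[S'] (F.map g ⊗ₘ[T] H.map g)) ≫
          a.ζ _ _ _ _ ≫ (l.μ _ _ ⊗ₘ[T] m.μ _ _) =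
        (a.ζ _ _ _ _ ≫ (l.μ _ _ ⊗ₘ[T] m.μ _ _)) ≫ (F.map (f ⊗ₘ[S] g) ⊗ₘ[T] H.map (f ⊗ₘ[S] g))
      rw [reassoc_of% a.ζ_natural, Category.assoc, tensorHom_comp, tensorHom_comp, l.μ_natural,
        m.μ_natural])
    (fun A B X => by
      change ((a.ζ _ _ _ _ ≫ (l.μ A B ⊗ₘ[T] m.μ A B)) ⊗ₘ[S'] 𝟙 (F.obj X ⊗[T] H.obj X)) ≫
          (a.ζ _ _ _ _ ≫ (l.μ _ _ ⊗ₘ[T] m.μ _ _)) ≫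
            (F.map (S.associator A B X).hom ⊗ₘ[T] H.map (S.associator A B X).hom) =
        (S'.associator (F.obj A ⊗[T] H.obj A) (F.obj B ⊗[T] H.obj B)
            (F.obj X ⊗[T] H.obj X)).hom ≫
          (𝟙 (F.obj A ⊗[T] H.obj A) ⊗ₘ[S'] (a.ζ _ _ _ _ ≫ (l.μ B X ⊗ₘ[T] m.μ B X))) ≫
            a.ζ _ _ _ _ ≫ (l.μ _ _ ⊗ₘ[T] m.μ _ _)
      rw [comp_tensorHom_id, id_tensorHom_comp]
      simp only [Category.assoc]
      rw [reassoc_of% a.tensorHom_id_ζ, reassoc_of% a.id_tensorHom_ζ, tensorHom_comp,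
        tensorHom_comp, tensorHom_comp, l.associativity, m.associativity, ← tensorHom_comp,
        reassoc_of% a.ζ_associativity])
    (fun A => by
      change ((a.Δ ≫ (l.ε ⊗ₘ[T] m.ε)) ⊗ₘ[S'] 𝟙 (F.obj A ⊗[T] H.obj A)) ≫
          (a.ζ _ _ _ _ ≫ (l.μ _ _ ⊗ₘ[T] m.μ _ _)) ≫
            (F.map (S.leftUnitor A).hom ⊗ₘ[T] H.map (S.leftUnitor A).hom) =
        (S'.leftUnitor (F.obj A ⊗[T] H.obj A)).hom
      rw [comp_tensorHom_id, Category.assoc, Category.assoc, reassoc_of% a.tensorHom_id_ζ,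
        tensorHom_comp, tensorHom_comp, l.left_unitality, m.left_unitality, a.ζ_left_unitality])
    (fun A => by
      change (𝟙 (F.obj A ⊗[T] H.obj A) ⊗ₘ[S'] (a.Δ ≫ (l.ε ⊗ₘ[T] m.ε))) ≫
          (a.ζ _ _ _ _ ≫ (l.μ _ _ ⊗ₘ[T] m.μ _ _)) ≫
            (F.map (S.rightUnitor A).hom ⊗ₘ[T] H.map (S.rightUnitor A).hom) =
        (S'.rightUnitor (F.obj A ⊗[T] H.obj A)).hom
      rw [id_tensorHom_comp, Category.assoc, Category.assoc, reassoc_of% a.id_tensorHom_ζ,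
        tensorHom_comp, tensorHom_comp, l.right_unitality, m.right_unitality,
        a.ζ_right_unitality])

end LaxStructure

/-- The compatibility of two lax monoidal structures on `F` with interchanges of the monoidal
structures: `F` is a double lax monoidal functor between duoidal categories. -/
structure IsDoubleLax {R S : MonoidalCategory D} {R' S' : MonoidalCategory E}
    (a : Interchange R S) (a' : Interchange R' S') {F : D ⥤ E} (r : LaxStructure R R' F)
    (s : LaxStructure S S' F) : Prop where
  μ_μ : ∀ A B A' B', a'.ζ (F.obj A) (F.obj B) (F.obj A') (F.obj B') ≫
      (r.μ A A' ⊗ₘ[S'] r.μ B B') ≫ s.μ _ _ =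
    (s.μ A B ⊗ₘ[R'] s.μ A' B') ≫ r.μ _ _ ≫ F.map (a.ζ A B A' B')
  ε_μ : a'.Δ ≫ (r.ε ⊗ₘ[S'] r.ε) ≫ s.μ _ _ = r.ε ≫ F.map a.Δ
  μ_ε : a'.μ ≫ s.ε = (s.ε ⊗ₘ[R'] s.ε) ≫ r.μ _ _ ≫ F.map a.μ
  ε_ε : a'.ι ≫ s.ε = r.ε ≫ F.map a.ι

namespace IsDoubleLax

variable {R S : MonoidalCategory D} {R' S' : MonoidalCategory E} {R'' S'' : MonoidalCategory G}
  {a : Interchange R S} {a' : Interchange R' S'} {a'' : Interchange R'' S''}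

theorem comp {F : D ⥤ E} {H : E ⥤ G} {r : LaxStructure R R' F} {s : LaxStructure S S' F}
    {r' : LaxStructure R' R'' H} {s' : LaxStructure S' S'' H} (h : IsDoubleLax a a' r s)
    (h' : IsDoubleLax a' a'' r' s') : IsDoubleLax a a'' (r.comp r') (s.comp s') where
  μ_μ A B A' B' := by
    change a''.ζ (H.obj (F.obj A)) (H.obj (F.obj B)) (H.obj (F.obj A')) (H.obj (F.obj B')) ≫
        ((r'.μ _ _ ≫ H.map (r.μ A A')) ⊗ₘ[S''] (r'.μ _ _ ≫ H.map (r.μ B B'))) ≫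
          s'.μ _ _ ≫ H.map (s.μ _ _) =
      ((s'.μ _ _ ≫ H.map (s.μ A B)) ⊗ₘ[R''] (s'.μ _ _ ≫ H.map (s.μ A' B'))) ≫
        (r'.μ _ _ ≫ H.map (r.μ _ _)) ≫ H.map (F.map (a.ζ A B A' B'))
    rw [← tensorHom_comp, ← tensorHom_comp, Category.assoc, reassoc_of% s'.μ_natural,
      reassoc_of% h'.μ_μ, Category.assoc, Category.assoc, reassoc_of% r'.μ_natural]
    simp only [← H.map_comp]
    rw [h.μ_μ]
  ε_μ := by
    change a''.Δ ≫ ((r'.ε ≫ H.map r.ε) ⊗ₘ[S''] (r'.ε ≫ H.map r.ε)) ≫ s'.μ _ _ ≫ H.map (s.μ _ _) =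
      (r'.ε ≫ H.map r.ε) ≫ H.map (F.map a.Δ)
    rw [← tensorHom_comp, Category.assoc, reassoc_of% s'.μ_natural, reassoc_of% h'.ε_μ,
      Category.assoc]
    simp only [← H.map_comp]
    rw [h.ε_μ]
  μ_ε := by
    change a''.μ ≫ s'.ε ≫ H.map s.ε = ((s'.ε ≫ H.map s.ε) ⊗ₘ[R''] (s'.ε ≫ H.map s.ε)) ≫
      (r'.μ _ _ ≫ H.map (r.μ _ _)) ≫ H.map (F.map a.μ)
    rw [← tensorHom_comp, Category.assoc, Category.assoc, reassoc_of% r'.μ_natural,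
      reassoc_of% h'.μ_ε]
    simp only [← H.map_comp]
    rw [h.μ_ε]
  ε_ε := by
    change a''.ι ≫ s'.ε ≫ H.map s.ε = (r'.ε ≫ H.map r.ε) ≫ H.map (F.map a.ι)
    rw [reassoc_of% h'.ε_ε, Category.assoc]
    simp only [← H.map_comp]
    rw [h.ε_ε]

theorem pi (K : Type) {F : D ⥤ E} {r : LaxStructure R R' F} {s : LaxStructure S S' F}
    (h : IsDoubleLax a a' r s) : IsDoubleLax (a.pi K) (a'.pi K) (r.pi K) (s.pi K) where
  μ_μ A B A' B' := funext fun i => h.μ_μ (A i) (B i) (A' i) (B' i)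
  ε_μ := funext fun _ => h.ε_μ
  μ_ε := funext fun _ => h.μ_ε
  ε_ε := funext fun _ => h.ε_ε

theorem pi' {K : Type} {F : K → D ⥤ E} {r : ∀ i, LaxStructure R R' (F i)}
    {s : ∀ i, LaxStructure S S' (F i)} (h : ∀ i, IsDoubleLax a a' (r i) (s i)) :
    IsDoubleLax a (a'.pi K) (.pi' r) (.pi' s) where
  μ_μ A B A' B' := funext fun i => (h i).μ_μ A B A' B'
  ε_μ := funext fun i => (h i).ε_μ
  μ_ε := funext fun i => (h i).μ_ε
  ε_ε := funext fun i => (h i).ε_ε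

theorem eval {K : Type} (a : Interchange R S) (i : K) :
    IsDoubleLax (a.pi K) a (.eval R i) (.eval S i) where
  μ_μ A B A' B' := by
    change a.ζ _ _ _ _ ≫ (𝟙 (A i ⊗[R] A' i) ⊗ₘ[S] 𝟙 (B i ⊗[R] B' i)) ≫ 𝟙 _ =
      (𝟙 (A i ⊗[S] B i) ⊗ₘ[R] 𝟙 (A' i ⊗[S] B' i)) ≫ 𝟙 _ ≫ a.ζ (A i) (B i) (A' i) (B' i)
    simp
  ε_μ := by
    change a.Δ ≫ (𝟙 R.tensorUnit ⊗ₘ[S] 𝟙 R.tensorUnit) ≫ 𝟙 _ = 𝟙 _ ≫ a.Δ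
    simp
  μ_ε := by
    change a.μ ≫ 𝟙 _ = (𝟙 S.tensorUnit ⊗ₘ[R] 𝟙 S.tensorUnit) ≫ 𝟙 _ ≫ a.μ
    simp
  ε_ε := by
    change a.ι ≫ 𝟙 _ = 𝟙 _ ≫ a.ι
    simp

variable {T' : MonoidalCategory E} {b : Interchange R' T'} {c : Interchange S' T'}

theorem const (a : Interchange R S) (h : a'.Compatible b c) :
    IsDoubleLax a a' (.const R b) (.const S c) where
  μ_μ _ _ _ _ := by
    change a'.ζ _ _ _ _ ≫ (b.μ ⊗ₘ[S'] b.μ) ≫ c.μ = (c.μ ⊗ₘ[R'] c.μ) ≫ b.μ ≫ 𝟙 _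
    rw [Category.comp_id, h.ζ_μ]
  ε_μ := h.Δ_μ.trans (Category.comp_id _).symm
  μ_ε := by
    change a'.μ ≫ c.ι = (c.ι ⊗ₘ[R'] c.ι) ≫ b.μ ≫ 𝟙 _
    rw [Category.comp_id, h.μ_ι]
  ε_ε := h.ι_ι.trans (Category.comp_id _).symm

theorem tensor (h : a'.Compatible b c) {F H : D ⥤ E} {r : LaxStructure R R' F}
    {s : LaxStructure S S' F} {r' : LaxStructure R R' H} {s' : LaxStructure S S' H}
    (d : IsDoubleLax a a' r s) (d' : IsDoubleLax a a' r' s') :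
    IsDoubleLax a a' (.tensor b r r') (.tensor c s s') where
  μ_μ A B A' B' := by
    change a'.ζ (F.obj A ⊗[T'] H.obj A) (F.obj B ⊗[T'] H.obj B)
          (F.obj A' ⊗[T'] H.obj A') (F.obj B' ⊗[T'] H.obj B') ≫
        ((b.ζ _ _ _ _ ≫ (r.μ A A' ⊗ₘ[T'] r'.μ A A')) ⊗ₘ[S']
          (b.ζ _ _ _ _ ≫ (r.μ B B' ⊗ₘ[T'] r'.μ B B'))) ≫
            c.ζ _ _ _ _ ≫ (s.μ _ _ ⊗ₘ[T'] s'.μ _ _) =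
      ((c.ζ _ _ _ _ ≫ (s.μ A B ⊗ₘ[T'] s'.μ A B)) ⊗ₘ[R']
          (c.ζ _ _ _ _ ≫ (s.μ A' B' ⊗ₘ[T'] s'.μ A' B'))) ≫
        (b.ζ _ _ _ _ ≫ (r.μ _ _ ⊗ₘ[T'] r'.μ _ _)) ≫
          (F.map (a.ζ A B A' B') ⊗ₘ[T'] H.map (a.ζ A B A' B'))
    rw [← tensorHom_comp, ← tensorHom_comp, Category.assoc, Category.assoc, Category.assoc,
      reassoc_of% c.ζ_natural, reassoc_of% h.ζ_ζ, reassoc_of% b.ζ_natural]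
    simp only [tensorHom_comp]
    rw [d.μ_μ, d'.μ_μ]
  ε_μ := by
    change a'.Δ ≫ ((b.Δ ≫ (r.ε ⊗ₘ[T'] r'.ε)) ⊗ₘ[S'] (b.Δ ≫ (r.ε ⊗ₘ[T'] r'.ε))) ≫
        c.ζ _ _ _ _ ≫ (s.μ _ _ ⊗ₘ[T'] s'.μ _ _) =
      (b.Δ ≫ (r.ε ⊗ₘ[T'] r'.ε)) ≫ (F.map a.Δ ⊗ₘ[T'] H.map a.Δ)
    rw [← tensorHom_comp, Category.assoc, reassoc_of% c.ζ_natural, reassoc_of% h.Δ_ζ,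
      Category.assoc]
    simp only [tensorHom_comp]
    rw [d.ε_μ, d'.ε_μ]
  μ_ε := by
    change a'.μ ≫ c.Δ ≫ (s.ε ⊗ₘ[T'] s'.ε) =
      ((c.Δ ≫ (s.ε ⊗ₘ[T'] s'.ε)) ⊗ₘ[R'] (c.Δ ≫ (s.ε ⊗ₘ[T'] s'.ε))) ≫
        (b.ζ _ _ _ _ ≫ (r.μ _ _ ⊗ₘ[T'] r'.μ _ _)) ≫ (F.map a.μ ⊗ₘ[T'] H.map a.μ)
    rw [← tensorHom_comp, Category.assoc, Category.assoc, reassoc_of% b.ζ_natural,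
      reassoc_of% h.μ_Δ]
    simp only [tensorHom_comp]
    rw [d.μ_ε, d'.μ_ε]
  ε_ε := by
    change a'.ι ≫ c.Δ ≫ (s.ε ⊗ₘ[T'] s'.ε) =
      (b.Δ ≫ (r.ε ⊗ₘ[T'] r'.ε)) ≫ (F.map a.ι ⊗ₘ[T'] H.map a.ι)
    rw [reassoc_of% h.ι_Δ, Category.assoc]
    simp only [tensorHom_comp]
    rw [d.ε_ε, d'.ε_ε]

end IsDoubleLax

end LaxMonoidal

/-! ### Monoidal transformations -/

section IsMonoidalTrans

variable {D : Type u} [Category.{v} D] {E : Type u} [Category.{v} E]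
  {G : Type u} [Category.{v} G] {H : Type u} [Category.{v} H]

@[ext]
theorem LaxStructure.ext {S : MonoidalCategory D} {S' : MonoidalCategory E} {F : D ⥤ E}
    {l m : LaxStructure S S' F} (hε : l.ε = m.ε) (hμ : ∀ A B, l.μ A B = m.μ A B) : l = m := by
  obtain ⟨ε, μ⟩ := l
  obtain ⟨ε', μ'⟩ := m
  obtain rfl : ε = ε' := hε
  obtain rfl : μ = μ' := funext₂ hμ
  rfl

theorem LaxStructure.comp_assoc {S : MonoidalCategory D} {S' : MonoidalCategory E}
    {S'' : MonoidalCategory G} {S₃ : MonoidalCategory H} {F : D ⥤ E} {F' : E ⥤ G} {F'' : G ⥤ H}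
    (l : LaxStructure S S' F) (m : LaxStructure S' S'' F') (n : LaxStructure S'' S₃ F'') :
    (l.comp m).comp n = l.comp (m.comp n) := by
  refine LaxStructure.ext ?_ fun A B => ?_
  · change (n.ε ≫ F''.map (m.ε ≫ F'.map l.ε)) = (n.ε ≫ F''.map m.ε) ≫ F''.map (F'.map l.ε)
    simp
  · change n.μ _ _ ≫ F''.map (m.μ _ _ ≫ F'.map (l.μ A B)) =
      (n.μ _ _ ≫ F''.map (m.μ _ _)) ≫ F''.map (F'.map (l.μ A B))
    simp

/-- Monoidality of a natural transformation for explicit lax monoidal structures. -/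
abbrev IsMonoidalTrans {S : MonoidalCategory D} {S' : MonoidalCategory E} {F F' : D ⥤ E}
    (l : LaxStructure S S' F) (l' : LaxStructure S S' F') (τ : F ⟶ F') : Prop :=
  @NatTrans.IsMonoidal D _ S E _ S' F F' τ l l'

namespace IsMonoidalTrans

variable {S : MonoidalCategory D} {S' : MonoidalCategory E} {S'' : MonoidalCategory G}
  {F F' F'' : D ⥤ E} {l : LaxStructure S S' F} {l' : LaxStructure S S' F'}
  {l'' : LaxStructure S S' F''} {τ : F ⟶ F'} {τ' : F' ⟶ F''}

theorem of_ε_μ (hε : l.ε ≫ τ.app _ = l'.ε)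
    (hμ : ∀ A B, l.μ A B ≫ τ.app (A ⊗[S] B) = (τ.app A ⊗ₘ[S'] τ.app B) ≫ l'.μ A B) :
    IsMonoidalTrans l l' τ :=
  @NatTrans.IsMonoidal.mk D _ S E _ S' F F' τ l l' hε hμ

theorem ε_app (h : IsMonoidalTrans l l' τ) : l.ε ≫ τ.app _ = l'.ε := h.unit

theorem μ_app (h : IsMonoidalTrans l l' τ) (A B : D) :
    l.μ A B ≫ τ.app (A ⊗[S] B) = (τ.app A ⊗ₘ[S'] τ.app B) ≫ l'.μ A B := h.tensor A B

theorem comp (h : IsMonoidalTrans l l' τ) (h' : IsMonoidalTrans l' l'' τ') :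
    IsMonoidalTrans l l'' (τ ≫ τ') :=
  @NatTrans.IsMonoidal.comp D _ S E _ S' F F' F'' τ l l' l'' τ' h h'

theorem whiskerRight (h : IsMonoidalTrans l l' τ) {K : E ⥤ G} (m : LaxStructure S' S'' K) :
    IsMonoidalTrans (l.comp m) (l'.comp m) (Functor.whiskerRight τ K) :=
  @NatTrans.IsMonoidal.whiskerRight D _ S E _ S' G _ S'' F F' τ l l' K m h

theorem whiskerLeft {K : G ⥤ D} (m : LaxStructure S'' S K) (h : IsMonoidalTrans l l' τ) :
    IsMonoidalTrans (m.comp l) (m.comp l') (Functor.whiskerLeft K τ) :=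
  @NatTrans.IsMonoidal.whiskerLeft G _ S'' D _ S E _ S' K m F F' l l' τ h

theorem pi' {K : Type} {F F' : K → D ⥤ E} {l : ∀ i, LaxStructure S S' (F i)}
    {l' : ∀ i, LaxStructure S S' (F' i)} {τ : ∀ i, F i ⟶ F' i}
    (h : ∀ i, IsMonoidalTrans (l i) (l' i) (τ i)) :
    IsMonoidalTrans (LaxStructure.pi' l) (LaxStructure.pi' l') (NatTrans.pi' τ) :=
  .of_ε_μ (funext fun i => (h i).ε_app) fun A B => funext fun i => (h i).μ_app A B

end IsMonoidalTrans

end IsMonoidalTrans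

/-! ### Tensor products of lists -/

section ListTensor

variable {D : Type u} [Category.{v} D] {ι κ : Type}

/-- The functor `tensorList` for an explicit monoidal structure. -/
abbrev listTensor (S : MonoidalCategory D) (L : List ι) : (ι → D) ⥤ D := @tensorList ι D _ S L

/-- The functor whose coordinates are the tensor products of the coordinates in given lists; it
is `bar` when these lists are the fibres of an order-preserving map. -/
abbrev listBar (S : MonoidalCategory D) (ℓ : κ → List ι) : (ι → D) ⥤ (κ → D) :=
  Functor.pi' fun j => listTensor S (ℓ j)

/-- The lax monoidal structure that an interchange provides on the tensor product of a list. -/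
@[reducible] def LaxStructure.listTensor {R S : MonoidalCategory D} (a : Interchange R S) :
    ∀ L : List ι, LaxStructure (piMonoidal R ι) R (listTensor S L)
  | [] => LaxStructure.const (piMonoidal R ι) a
  | i :: L => LaxStructure.tensor a (LaxStructure.eval R i) (LaxStructure.listTensor a L)

theorem IsDoubleLax.listTensor {R S T : MonoidalCategory D} {a : Interchange R S}
    {b : Interchange R T} {c : Interchange S T} (h : Interchange.Compatible a b c) :
    ∀ L : List ι,
      IsDoubleLax (a.pi ι) a (LaxStructure.listTensor b L) (LaxStructure.listTensor c L)
  | [] => IsDoubleLax.const (a.pi ι) h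
  | i :: L => IsDoubleLax.tensor h (IsDoubleLax.eval a i) (IsDoubleLax.listTensor h L)

/-- The lax monoidal structure that an interchange provides on `listBar`. -/
@[reducible] def LaxStructure.listBar {R S : MonoidalCategory D} (a : Interchange R S)
    (ℓ : κ → List ι) : LaxStructure (piMonoidal R ι) (piMonoidal R κ) (listBar S ℓ) :=
  LaxStructure.pi' fun j => LaxStructure.listTensor a (ℓ j)

theorem IsDoubleLax.listBar {R S T : MonoidalCategory D} {a : Interchange R S}
    {b : Interchange R T} {c : Interchange S T} (h : Interchange.Compatible a b c)
    (ℓ : κ → List ι) :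
    IsDoubleLax (a.pi ι) (a.pi κ) (LaxStructure.listBar b ℓ) (LaxStructure.listBar c ℓ) :=
  IsDoubleLax.pi' fun j => IsDoubleLax.listTensor h (ℓ j)

/-- The reassociation from the tensor product of two lists to that of their concatenation. -/
def appendHom (S : MonoidalCategory D) : ∀ L L' : List ι,
    (listTensor S L).prod' (listTensor S L') ⋙ @MonoidalCategory.tensor D _ S ⟶
      listTensor S (L ++ L')
  | [], L' =>
    { app := fun A => (S.leftUnitor ((listTensor S L').obj A)).hom
      naturality := fun _ _ _ => id_tensorHom_leftUnitor S _ }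
  | i :: L, L' =>
    { app := fun A =>
        (S.associator (A i) ((listTensor S L).obj A) ((listTensor S L').obj A)).hom ≫
          (𝟙 (A i) ⊗ₘ[S] (appendHom S L L').app A)
      naturality := fun A B f => by
        have ih : ((listTensor S L).map f ⊗ₘ[S] (listTensor S L').map f) ≫
            (appendHom S L L').app B = (appendHom S L L').app A ≫ (listTensor S (L ++ L')).map f :=
          (appendHom S L L').naturality f
        change ((f i ⊗ₘ[S] (listTensor S L).map f) ⊗ₘ[S] (listTensor S L').map f) ≫
            (S.associator _ _ _).hom ≫ (𝟙 _ ⊗ₘ[S] _) =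
          ((S.associator _ _ _).hom ≫ (𝟙 _ ⊗ₘ[S] _)) ≫ (f i ⊗ₘ[S] (listTensor S (L ++ L')).map f)
        rw [reassoc_of% S.associator_naturality, tensorHom_comp, ih, Category.assoc,
          tensorHom_comp, Category.comp_id, Category.id_comp] }

theorem appendHom_natural (S : MonoidalCategory D) {A B : ι → D} (f : A ⟶ B) (L L' : List ι) :
    ((listTensor S L).map f ⊗ₘ[S] (listTensor S L').map f) ≫ (appendHom S L L').app B =
      (appendHom S L L').app A ≫ (listTensor S (L ++ L')).map f :=
  (appendHom S L L').naturality f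

/-- The reassociation from an iterated tensor product to the tensor product of the concatenated
lists. -/
def flatMapHom (S : MonoidalCategory D) (ℓ : κ → List ι) : ∀ K : List κ,
    listBar S ℓ ⋙ listTensor S K ⟶ listTensor S (K.flatMap ℓ)
  | [] => { app := fun _ => 𝟙 S.tensorUnit }
  | j :: K =>
    { app := fun A => (𝟙 ((listTensor S (ℓ j)).obj A) ⊗ₘ[S] (flatMapHom S ℓ K).app A) ≫
        (appendHom S (ℓ j) (K.flatMap ℓ)).app A
      naturality := fun A B f => by
        have ih : (listTensor S K).map ((listBar S ℓ).map f) ≫ (flatMapHom S ℓ K).app B =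
            (flatMapHom S ℓ K).app A ≫ (listTensor S (K.flatMap ℓ)).map f :=
          (flatMapHom S ℓ K).naturality f
        change ((listTensor S (ℓ j)).map f ⊗ₘ[S] (listTensor S K).map ((listBar S ℓ).map f)) ≫
            (𝟙 _ ⊗ₘ[S] _) ≫ _ =
          ((𝟙 _ ⊗ₘ[S] _) ≫ _) ≫ (listTensor S (ℓ j ++ K.flatMap ℓ)).map f
        rw [tensorHom_comp_assoc, ih, Category.assoc, ← appendHom_natural, tensorHom_comp_assoc,
          Category.comp_id, Category.id_comp] }

section Monoidality

variable {R S : MonoidalCategory D} (a : Interchange R S)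

theorem isMonoidalTrans_appendHom_nil (L' : List ι) :
    IsMonoidalTrans (LaxStructure.tensor a (LaxStructure.listTensor a [])
      (LaxStructure.listTensor a L')) (LaxStructure.listTensor a L') (appendHom S [] L') := by
  let r := LaxStructure.listTensor a L'
  refine .of_ε_μ ?_ fun A B => ?_
  · change (a.Δ ≫ (a.ι ⊗ₘ[S] r.ε)) ≫ (S.leftUnitor _).hom = r.ε
    rw [← Category.id_comp r.ε, ← Category.comp_id a.ι, ← tensorHom_comp, Category.assoc,
      Category.assoc, id_tensorHom_leftUnitor, reassoc_of% a.Δ_leftUnitor, Category.id_comp]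
  · change (a.ζ _ _ _ _ ≫ (a.μ ⊗ₘ[S] r.μ A B)) ≫ (S.leftUnitor _).hom =
      ((S.leftUnitor _).hom ⊗ₘ[R] (S.leftUnitor _).hom) ≫ r.μ A B
    rw [← Category.id_comp (r.μ A B), ← Category.comp_id a.μ, ← tensorHom_comp, Category.assoc,
      Category.assoc, id_tensorHom_leftUnitor, reassoc_of% a.ζ_leftUnitor, Category.id_comp]

theorem isMonoidalTrans_appendHom_cons (i : ι) {L L' : List ι}
    (h : IsMonoidalTrans (LaxStructure.tensor a (LaxStructure.listTensor a L)
      (LaxStructure.listTensor a L')) (LaxStructure.listTensor a (L ++ L')) (appendHom S L L')) :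
    IsMonoidalTrans (LaxStructure.tensor a (LaxStructure.listTensor a (i :: L))
      (LaxStructure.listTensor a L')) (LaxStructure.listTensor a (i :: (L ++ L')))
      (appendHom S (i :: L) L') := by
  let r := LaxStructure.listTensor a L
  let r' := LaxStructure.listTensor a L'
  let r'' := LaxStructure.listTensor a (L ++ L')
  refine .of_ε_μ ?_ fun A B => ?_
  · have h' : (a.Δ ≫ (r.ε ⊗ₘ[S] r'.ε)) ≫ (appendHom S L L').app _ = r''.ε := h.ε_app
    change (a.Δ ≫ ((a.Δ ≫ (𝟙 R.tensorUnit ⊗ₘ[S] r.ε)) ⊗ₘ[S] r'.ε)) ≫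
        (S.associator _ _ _).hom ≫ (𝟙 _ ⊗ₘ[S] (appendHom S L L').app _) =
      a.Δ ≫ (𝟙 R.tensorUnit ⊗ₘ[S] r''.ε)
    rw [← h', ← Category.id_comp r'.ε, ← tensorHom_comp, Category.id_comp,
      Category.assoc, Category.assoc, reassoc_of% S.associator_naturality,
      reassoc_of% a.Δ_associator]
    simp
  · have h' : (a.ζ _ _ _ _ ≫ (r.μ A B ⊗ₘ[S] r'.μ A B)) ≫ (appendHom S L L').app _ =
      ((appendHom S L L').app A ⊗ₘ[R] (appendHom S L L').app B) ≫ r''.μ A B := h.μ_app A B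
    change (a.ζ _ _ _ _ ≫ ((a.ζ _ _ _ _ ≫ (𝟙 (A i ⊗[R] B i) ⊗ₘ[S] r.μ A B)) ⊗ₘ[S] r'.μ A B)) ≫
        (S.associator _ _ _).hom ≫ (𝟙 _ ⊗ₘ[S] (appendHom S L L').app _) =
      (((S.associator (A i) ((listTensor S L).obj A) ((listTensor S L').obj A)).hom ≫
          (𝟙 (A i) ⊗ₘ[S] (appendHom S L L').app A)) ⊗ₘ[R]
        ((S.associator (B i) ((listTensor S L).obj B) ((listTensor S L').obj B)).hom ≫
          (𝟙 (B i) ⊗ₘ[S] (appendHom S L L').app B))) ≫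
        a.ζ _ ((listTensor S (L ++ L')).obj A) _ ((listTensor S (L ++ L')).obj B) ≫
          (𝟙 (A i ⊗[R] B i) ⊗ₘ[S] r''.μ A B)
    rw [← tensorHom_comp R, Category.assoc, Category.assoc, reassoc_of% a.ζ_natural,
      tensorHom_comp, tensorHom_id_id, Category.id_comp, ← h', Category.assoc, id_tensorHom_comp,
      reassoc_of% a.ζ_associator, ← Category.id_comp (r'.μ A B), ← tensorHom_comp,
      Category.id_comp, Category.assoc, reassoc_of% S.associator_naturality]
    simp only [tensorHom_comp, Category.comp_id]

theorem isMonoidalTrans_appendHom (L L' : List ι) :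
    IsMonoidalTrans (LaxStructure.tensor a (LaxStructure.listTensor a L)
      (LaxStructure.listTensor a L')) (LaxStructure.listTensor a (L ++ L')) (appendHom S L L') := by
  induction L with
  | nil => exact isMonoidalTrans_appendHom_nil a L'
  | cons i L ih => exact isMonoidalTrans_appendHom_cons a i ih

theorem isMonoidalTrans_flatMapHom_cons (ℓ : κ → List ι) (j : κ) {K : List κ}
    (h : IsMonoidalTrans ((LaxStructure.listBar a ℓ).comp (LaxStructure.listTensor a K))
      (LaxStructure.listTensor a (K.flatMap ℓ)) (flatMapHom S ℓ K)) :
    IsMonoidalTrans ((LaxStructure.listBar a ℓ).comp (LaxStructure.listTensor a (j :: K)))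
      (LaxStructure.listTensor a (ℓ j ++ K.flatMap ℓ)) (flatMapHom S ℓ (j :: K)) := by
  let r := LaxStructure.listTensor a (ℓ j)
  let s := LaxStructure.listTensor a K
  let s' := LaxStructure.listTensor a (K.flatMap ℓ)
  let t := LaxStructure.listTensor a (ℓ j ++ K.flatMap ℓ)
  let b := LaxStructure.listBar a ℓ
  have h_append := isMonoidalTrans_appendHom a (ℓ j) (K.flatMap ℓ)
  refine .of_ε_μ ?_ fun A B => ?_
  · have h₁ : (s.ε ≫ (listTensor S K).map b.ε) ≫ (flatMapHom S ℓ K).app _ = s'.ε := h.ε_app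
    have h₂ : (a.Δ ≫ (r.ε ⊗ₘ[S] s'.ε)) ≫ (appendHom S _ _).app _ = t.ε := h_append.ε_app
    change ((a.Δ ≫ (𝟙 _ ⊗ₘ[S] s.ε)) ≫ (r.ε ⊗ₘ[S] (listTensor S K).map b.ε)) ≫
      (𝟙 _ ⊗ₘ[S] (flatMapHom S ℓ K).app _) ≫ (appendHom S _ _).app _ = t.ε
    rw [← h₂, ← h₁]
    simp only [tensorHom_comp, tensorHom_comp_assoc, Category.assoc, Category.id_comp,
      Category.comp_id]
  · have h₁ : (s.μ _ _ ≫ (listTensor S K).map (b.μ A B)) ≫ (flatMapHom S ℓ K).app _ =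
      ((flatMapHom S ℓ K).app A ⊗ₘ[R] (flatMapHom S ℓ K).app B) ≫ s'.μ A B := h.μ_app A B
    have h₂ : (a.ζ _ _ _ _ ≫ (r.μ A B ⊗ₘ[S] s'.μ A B)) ≫ (appendHom S _ _).app _ =
      ((appendHom S _ _).app A ⊗ₘ[R] (appendHom S _ _).app B) ≫ t.μ A B := h_append.μ_app A B
    change ((a.ζ _ _ _ _ ≫ (𝟙 _ ⊗ₘ[S] s.μ _ _)) ≫
          (r.μ A B ⊗ₘ[S] (listTensor S K).map (b.μ A B))) ≫
        (𝟙 _ ⊗ₘ[S] (flatMapHom S ℓ K).app _) ≫ (appendHom S _ _).app _ =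
      (((𝟙 ((listTensor S (ℓ j)).obj A) ⊗ₘ[S] (flatMapHom S ℓ K).app A) ≫
          (appendHom S _ _).app A) ⊗ₘ[R]
        ((𝟙 ((listTensor S (ℓ j)).obj B) ⊗ₘ[S] (flatMapHom S ℓ K).app B) ≫
          (appendHom S _ _).app B)) ≫ t.μ A B
    rw [← tensorHom_comp R, Category.assoc (_ ⊗ₘ[R] _), ← h₂]
    simp only [Category.assoc]
    rw [reassoc_of% a.ζ_natural]
    simp only [tensorHom_comp_assoc, Category.assoc, Category.id_comp, Category.comp_id,
      tensorHom_id_id, ← h₁]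
    rfl

theorem isMonoidalTrans_flatMapHom (ℓ : κ → List ι) (K : List κ) :
    IsMonoidalTrans ((LaxStructure.listBar a ℓ).comp (LaxStructure.listTensor a K))
      (LaxStructure.listTensor a (K.flatMap ℓ)) (flatMapHom S ℓ K) := by
  induction K with
  | nil =>
    refine .of_ε_μ ?_ fun A B => ?_
    · change (a.ι ≫ 𝟙 _) ≫ 𝟙 _ = a.ι
      simp
    · change (a.μ ≫ 𝟙 _) ≫ 𝟙 _ = (𝟙 _ ⊗ₘ[R] 𝟙 _) ≫ a.μ
      simp
  | cons j K ih => exact isMonoidalTrans_flatMapHom_cons a ℓ j ih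

end Monoidality

end ListTensor

/-! ### Lax monoidal functors and tensor products of lists -/

section ListComparison

variable {D : Type u} [Category.{v} D] {E : Type u} [Category.{v} E] {G : Type u} [Category.{v} G]
  {ι κ : Type}

/-- A power of a functor. -/
abbrev powFunctor (ι : Type) (F : D ⥤ E) : (ι → D) ⥤ (ι → E) := Functor.pi fun _ => F

namespace LaxStructure

variable {S : MonoidalCategory D} {S' : MonoidalCategory E} {S'' : MonoidalCategory G} {F : D ⥤ E}
  {H : E ⥤ G}

/-- The comparison of the tensor product of the images of a list under a lax monoidal functor with
the image of its tensor product. -/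
def listμ (l : LaxStructure S S' F) : ∀ L : List ι,
    powFunctor ι F ⋙ SMI.listTensor S' L ⟶ SMI.listTensor S L ⋙ F
  | [] =>
    { app := fun _ => l.ε
      naturality := fun _ _ _ => by
        change 𝟙 _ ≫ l.ε = l.ε ≫ F.map (𝟙 _)
        simp }
  | i :: L =>
    { app := fun A =>
        (𝟙 (F.obj (A i)) ⊗ₘ[S'] (l.listμ L).app A) ≫ l.μ (A i) ((SMI.listTensor S L).obj A)
      naturality := fun A B f => by
        have ih : (SMI.listTensor S' L).map ((powFunctor ι F).map f) ≫ (l.listμ L).app B =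
          (l.listμ L).app A ≫ F.map ((SMI.listTensor S L).map f) := (l.listμ L).naturality f
        change (F.map (f i) ⊗ₘ[S'] (SMI.listTensor S' L).map ((powFunctor ι F).map f)) ≫
            (𝟙 (F.obj (B i)) ⊗ₘ[S'] (l.listμ L).app B) ≫ l.μ (B i) _ =
          ((𝟙 (F.obj (A i)) ⊗ₘ[S'] (l.listμ L).app A) ≫ l.μ (A i) _) ≫
            F.map (f i ⊗ₘ[S] (SMI.listTensor S L).map f)
        rw [tensorHom_comp_assoc, ih, Category.assoc, ← l.μ_natural, tensorHom_comp_assoc,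
          Category.comp_id, Category.id_comp] }

/-- The comparison of `listBar` of the images under a lax monoidal functor with the images of
`listBar`. -/
def barμ (l : LaxStructure S S' F) (ℓ : κ → List ι) :
    powFunctor ι F ⋙ SMI.listBar S' ℓ ⟶ SMI.listBar S ℓ ⋙ powFunctor κ F where
  app A j := (l.listμ (ℓ j)).app A
  naturality _ _ f := funext fun j => (l.listμ (ℓ j)).naturality f

theorem listμ_natural (l : LaxStructure S S' F) {A B : ι → D} (f : A ⟶ B) (L : List ι) :
    (SMI.listTensor S' L).map ((powFunctor ι F).map f) ≫ (l.listμ L).app B =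
      (l.listμ L).app A ≫ F.map ((SMI.listTensor S L).map f) :=
  (l.listμ L).naturality f

theorem listμ_id (S : MonoidalCategory D) (A : ι → D) (L : List ι) :
    ((LaxStructure.id S).listμ L).app A = 𝟙 ((SMI.listTensor S L).obj A) := by
  induction L with
  | nil => rfl
  | cons i L ih =>
    change (𝟙 (A i) ⊗ₘ[S] ((LaxStructure.id S).listμ L).app A) ≫ 𝟙 _ =
      𝟙 (A i ⊗[S] (SMI.listTensor S L).obj A)
    rw [ih]
    exact (Category.comp_id _).trans (tensorHom_id_id S _ _)

theorem listμ_comp (l : LaxStructure S S' F) (m : LaxStructure S' S'' H) (A : ι → D)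
    (L : List ι) : ((l.comp m).listμ L).app A =
      (m.listμ L).app ((powFunctor ι F).obj A) ≫ H.map ((l.listμ L).app A) := by
  induction L with
  | nil => rfl
  | cons i L ih =>
    refine (congrArg (fun z => (𝟙 _ ⊗ₘ[S''] z) ≫ m.μ _ _ ≫ H.map (l.μ _ _)) ih).trans ?_
    change (𝟙 _ ⊗ₘ[S''] ((m.listμ L).app ((powFunctor ι F).obj A) ≫ H.map ((l.listμ L).app A))) ≫
        m.μ _ _ ≫ H.map (l.μ _ _) =
      ((𝟙 _ ⊗ₘ[S''] (m.listμ L).app _) ≫ m.μ _ _) ≫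
        H.map ((𝟙 (F.obj (A i)) ⊗ₘ[S'] (l.listμ L).app A) ≫ l.μ _ _)
    rw [id_tensorHom_comp, H.map_comp, Category.assoc, Category.assoc, ← reassoc_of% m.μ_natural,
      H.map_id]

theorem listμ_append (l : LaxStructure S S' F) (A : ι → D) (L L' : List ι) :
    ((l.listμ L).app A ⊗ₘ[S'] (l.listμ L').app A) ≫ l.μ _ _ ≫ F.map ((appendHom S L L').app A) =
      (appendHom S' L L').app ((powFunctor ι F).obj A) ≫ (l.listμ (L ++ L')).app A := by
  let A' := (powFunctor ι F).obj A
  let g : (SMI.listTensor S' L').obj A' ⟶ F.obj ((SMI.listTensor S L').obj A) :=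
    (l.listμ L').app A
  induction L with
  | nil =>
    have h : (l.ε ⊗ₘ[S'] g) = (𝟙 _ ⊗ₘ[S'] g) ≫ (l.ε ⊗ₘ[S'] 𝟙 _) := by
      rw [tensorHom_comp, Category.id_comp, Category.comp_id]
    change (l.ε ⊗ₘ[S'] g) ≫ l.μ _ _ ≫ F.map (S.leftUnitor _).hom = (S'.leftUnitor _).hom ≫ g
    rw [h, Category.assoc, l.left_unitality, id_tensorHom_leftUnitor]
  | cons i L ih =>
    let f : (SMI.listTensor S' L).obj A' ⟶ F.obj ((SMI.listTensor S L).obj A) := (l.listμ L).app A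
    let k : (SMI.listTensor S L).obj A ⊗[S] (SMI.listTensor S L').obj A ⟶
      (SMI.listTensor S (L ++ L')).obj A := (appendHom S L L').app A
    let k' : (SMI.listTensor S' L).obj A' ⊗[S'] (SMI.listTensor S' L').obj A' ⟶
      (SMI.listTensor S' (L ++ L')).obj A' := (appendHom S' L L').app A'
    have ih : (f ⊗ₘ[S'] g) ≫ l.μ _ _ ≫ F.map k = k' ≫ (l.listμ (L ++ L')).app A := ih
    change (((𝟙 _ ⊗ₘ[S'] f) ≫ l.μ _ _) ⊗ₘ[S'] g) ≫ l.μ _ _ ≫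
        F.map ((S.associator (A i) _ _).hom ≫ (𝟙 _ ⊗ₘ[S] k)) =
      ((S'.associator _ _ _).hom ≫ (𝟙 _ ⊗ₘ[S'] k')) ≫
        (𝟙 (F.obj (A i)) ⊗ₘ[S'] (l.listμ (L ++ L')).app A) ≫ l.μ _ _
    rw [Category.assoc, tensorHom_comp_assoc, ← ih, ← Category.comp_id g, ← tensorHom_comp,
      F.map_comp, Category.assoc, reassoc_of% l.associativity, ← l.μ_natural, Category.comp_id,
      reassoc_of% S'.associator_naturality]
    simp

theorem listμ_flatMap (l : LaxStructure S S' F) (ℓ : κ → List ι) (A : ι → D) (K : List κ) :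
    (SMI.listTensor S' K).map ((l.barμ ℓ).app A) ≫ (l.listμ K).app ((SMI.listBar S ℓ).obj A) ≫
        F.map ((flatMapHom S ℓ K).app A) =
      (flatMapHom S' ℓ K).app ((powFunctor ι F).obj A) ≫ (l.listμ (K.flatMap ℓ)).app A := by
  induction K with
  | nil =>
    change 𝟙 _ ≫ l.ε ≫ F.map (𝟙 _) = 𝟙 _ ≫ l.ε
    simp
  | cons j K ih =>
    let p : (SMI.listTensor S (ℓ j)).obj A ⊗[S] (SMI.listTensor S (K.flatMap ℓ)).obj A ⟶
      (SMI.listTensor S (ℓ j ++ K.flatMap ℓ)).obj A := (appendHom S (ℓ j) (K.flatMap ℓ)).app A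
    let q : (SMI.listTensor S' K).obj ((powFunctor κ F).obj ((SMI.listBar S ℓ).obj A)) ⟶
      F.obj ((SMI.listTensor S K).obj ((SMI.listBar S ℓ).obj A)) := (l.listμ K).app _
    let f : (SMI.listTensor S' (ℓ j)).obj ((powFunctor ι F).obj A) ⟶
      F.obj ((SMI.listTensor S (ℓ j)).obj A) := (l.listμ (ℓ j)).app A
    have append : (f ⊗ₘ[S'] (l.listμ (K.flatMap ℓ)).app A) ≫ l.μ _ _ ≫ F.map p =
      (appendHom S' (ℓ j) (K.flatMap ℓ)).app _ ≫ (l.listμ (ℓ j ++ K.flatMap ℓ)).app A :=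
      l.listμ_append A (ℓ j) (K.flatMap ℓ)
    have ih : (SMI.listTensor S' K).map ((l.barμ ℓ).app A) ≫ q ≫ F.map ((flatMapHom S ℓ K).app A) =
      (flatMapHom S' ℓ K).app _ ≫ (l.listμ (K.flatMap ℓ)).app A := ih
    change (f ⊗ₘ[S'] (SMI.listTensor S' K).map ((l.barμ ℓ).app A)) ≫
        ((𝟙 _ ⊗ₘ[S'] q) ≫ l.μ _ _) ≫ F.map ((𝟙 _ ⊗ₘ[S] (flatMapHom S ℓ K).app A) ≫ p) =
      ((𝟙 _ ⊗ₘ[S'] (flatMapHom S' ℓ K).app _) ≫ (appendHom S' (ℓ j) (K.flatMap ℓ)).app _) ≫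
        (l.listμ (ℓ j ++ K.flatMap ℓ)).app A
    rw [Category.assoc _ _ ((l.listμ (ℓ j ++ K.flatMap ℓ)).app A), ← append, F.map_comp,
      Category.assoc, ← reassoc_of% l.μ_natural]
    simp only [tensorHom_comp_assoc, F.map_id, Category.comp_id, Category.id_comp, ih]

end LaxStructure

theorem IsMonoidalTrans.listμ_app {S : MonoidalCategory D} {S' : MonoidalCategory E} {F F' : D ⥤ E}
    {l : LaxStructure S S' F} {l' : LaxStructure S S' F'} {τ : F ⟶ F'} (h : IsMonoidalTrans l l' τ)
    (A : ι → D) (L : List ι) : (l.listμ L).app A ≫ τ.app ((listTensor S L).obj A) =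
      (listTensor S' L).map
        (fun i => τ.app (A i) : (powFunctor ι F).obj A ⟶ (powFunctor ι F').obj A) ≫
        (l'.listμ L).app A := by
  induction L with
  | nil => exact h.ε_app.trans (Category.id_comp _).symm
  | cons i L ih =>
    change ((𝟙 _ ⊗ₘ[S'] (l.listμ L).app A) ≫ l.μ _ _) ≫ τ.app _ =
      (τ.app (A i) ⊗ₘ[S'] (listTensor S' L).map _) ≫ (𝟙 _ ⊗ₘ[S'] (l'.listμ L).app A) ≫ l'.μ _ _
    rw [Category.assoc, h.μ_app, tensorHom_comp_assoc, tensorHom_comp_assoc, ih, Category.comp_id,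
      Category.id_comp]
    rfl

section Double

variable {R S : MonoidalCategory D} {R' S' : MonoidalCategory E} {a : Interchange R S}
  {a' : Interchange R' S'} {F : D ⥤ E} {r : LaxStructure R R' F} {s : LaxStructure S S' F}

theorem isMonoidalTrans_listμ_cons (h : IsDoubleLax a a' r s) (i : ι) {L : List ι}
    (hL : IsMonoidalTrans ((r.pi ι).comp (LaxStructure.listTensor a' L))
      ((LaxStructure.listTensor a L).comp r) (s.listμ L)) :
    IsMonoidalTrans ((r.pi ι).comp (LaxStructure.listTensor a' (i :: L)))
      ((LaxStructure.listTensor a (i :: L)).comp r) (s.listμ (i :: L)) := by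
  let t := LaxStructure.listTensor a L
  let t' := LaxStructure.listTensor a' L
  refine .of_ε_μ ?_ fun A B => ?_
  · have h' : (t'.ε ≫ (listTensor S' L).map (r.pi ι).ε) ≫ (s.listμ L).app _ =
      r.ε ≫ F.map t.ε := hL.ε_app
    change ((a'.Δ ≫ (𝟙 _ ⊗ₘ[S'] t'.ε)) ≫ (r.ε ⊗ₘ[S'] (listTensor S' L).map (r.pi ι).ε)) ≫
      (𝟙 _ ⊗ₘ[S'] (s.listμ L).app _) ≫ s.μ _ _ = r.ε ≫ F.map (a.Δ ≫ (𝟙 _ ⊗ₘ[S] t.ε))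
    rw [F.map_comp, ← reassoc_of% h.ε_μ, ← s.μ_natural]
    simp only [tensorHom_comp_assoc, Category.comp_id, Category.id_comp, Category.assoc, ← h',
      F.map_id]
  · let f (A : ι → D) : (listTensor S' L).obj ((powFunctor ι F).obj A) ⟶
      F.obj ((listTensor S L).obj A) := (s.listμ L).app A
    let k : (listTensor S' L).obj ((powFunctor ι F).obj A) ⊗[R']
          (listTensor S' L).obj ((powFunctor ι F).obj B) ⟶
        (listTensor S' L).obj ((powFunctor ι F).obj (A ⊗[piMonoidal R ι] B)) :=
      t'.μ _ _ ≫ (listTensor S' L).map ((r.pi ι).μ A B)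
    have h' : k ≫ f (A ⊗[piMonoidal R ι] B) = (f A ⊗ₘ[R'] f B) ≫ r.μ _ _ ≫ F.map (t.μ A B) :=
      hL.μ_app A B
    have hk : (r.μ (A i) (B i) ⊗ₘ[S'] k) =
        (𝟙 _ ⊗ₘ[S'] t'.μ ((powFunctor ι F).obj A) ((powFunctor ι F).obj B)) ≫
          (r.μ (A i) (B i) ⊗ₘ[S'] (listTensor S' L).map ((r.pi ι).μ A B)) := by
      rw [tensorHom_comp, Category.id_comp]
    change ((a'.ζ _ _ _ _ ≫ (𝟙 _ ⊗ₘ[S'] t'.μ ((powFunctor ι F).obj A) ((powFunctor ι F).obj B))) ≫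
          (r.μ _ _ ⊗ₘ[S'] (listTensor S' L).map ((r.pi ι).μ A B))) ≫
        (𝟙 _ ⊗ₘ[S'] f (A ⊗[piMonoidal R ι] B)) ≫ s.μ _ _ =
      (((𝟙 (F.obj (A i)) ⊗ₘ[S'] f A) ≫ s.μ _ _) ⊗ₘ[R']
          ((𝟙 (F.obj (B i)) ⊗ₘ[S'] f B) ≫ s.μ _ _)) ≫
        r.μ _ _ ≫ F.map (a.ζ _ _ _ _ ≫ (𝟙 _ ⊗ₘ[S] t.μ A B))
    rw [← tensorHom_comp R', F.map_comp, Category.assoc _ _ (r.μ _ _ ≫ _), ← reassoc_of% h.μ_μ,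
      ← s.μ_natural, reassoc_of% a'.ζ_natural, Category.assoc (a'.ζ _ _ _ _), ← hk]
    simp only [tensorHom_comp_assoc, Category.comp_id, Category.id_comp, Category.assoc, F.map_id,
      tensorHom_id_id, h']

theorem isMonoidalTrans_listμ (h : IsDoubleLax a a' r s) (L : List ι) :
    IsMonoidalTrans ((r.pi ι).comp (LaxStructure.listTensor a' L))
      ((LaxStructure.listTensor a L).comp r) (s.listμ L) := by
  induction L with
  | nil =>
    refine .of_ε_μ ?_ fun A B => ?_
    · change (a'.ι ≫ 𝟙 _) ≫ s.ε = r.ε ≫ F.map a.ι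
      rw [Category.comp_id, h.ε_ε]
    · change (a'.μ ≫ 𝟙 _) ≫ s.ε = (s.ε ⊗ₘ[R'] s.ε) ≫ r.μ _ _ ≫ F.map a.μ
      rw [Category.comp_id, h.μ_ε]
  | cons i L ih => exact isMonoidalTrans_listμ_cons h i ih

end Double

end ListComparison

/-! ### Arrows that are identities up to equalities of objects -/

section IsEqToHom

variable {D : Type u} [Category.{v} D] {E : Type u} [Category.{v} E]

/-- An arrow that is an identity up to an equality between its source and its target. -/
def IsEqToHom {A B : D} (f : A ⟶ B) : Prop := ∃ h : A = B, f = eqToHom h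

namespace IsEqToHom

theorem id (A : D) : IsEqToHom (𝟙 A) := ⟨rfl, rfl⟩

theorem eqToHom {A B : D} (h : A = B) : IsEqToHom (eqToHom h) := ⟨h, rfl⟩

theorem comp {A B X : D} {f : A ⟶ B} {g : B ⟶ X} (hf : IsEqToHom f) (hg : IsEqToHom g) :
    IsEqToHom (f ≫ g) := by
  obtain ⟨rfl, rfl⟩ := hf
  obtain ⟨rfl, rfl⟩ := hg
  exact ⟨rfl, by simp⟩

theorem of_comp {A B X : D} {f : A ⟶ B} {g : B ⟶ X} (h : IsEqToHom (f ≫ g)) (hg : IsEqToHom g) :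
    IsEqToHom f := by
  obtain ⟨rfl, rfl⟩ := hg
  simpa using h

theorem inv {A B : D} {e : A ≅ B} (h : IsEqToHom e.hom) : IsEqToHom e.inv := by
  obtain ⟨h, he⟩ := h
  exact ⟨h.symm, (Iso.inv_ext (f := eqToIso h) (by rw [eqToIso.hom, ← he, e.hom_inv_id])).symm⟩

theorem map {A B : D} {f : A ⟶ B} (h : IsEqToHom f) (F : D ⥤ E) : IsEqToHom (F.map f) := by
  obtain ⟨rfl, rfl⟩ := h
  exact ⟨rfl, by simp⟩

theorem tensorHom {S : MonoidalCategory D} {A A' B B' : D} {f : A ⟶ A'} {g : B ⟶ B'}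
    (hf : IsEqToHom f) (hg : IsEqToHom g) : IsEqToHom (f ⊗ₘ[S] g) := by
  obtain ⟨rfl, rfl⟩ := hf
  obtain ⟨rfl, rfl⟩ := hg
  exact ⟨rfl, tensorHom_id_id S A B⟩

theorem ext {A B : D} {f g : A ⟶ B} (hf : IsEqToHom f) (hg : IsEqToHom g) : f = g := by
  obtain ⟨rfl, rfl⟩ := hf
  obtain ⟨_, rfl⟩ := hg
  rfl

theorem pi {K : Type} {A B : K → D} {f : A ⟶ B} (h : ∀ i, IsEqToHom (f i)) : IsEqToHom f := by
  obtain rfl : A = B := funext fun i => (h i).1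
  exact ⟨rfl, funext fun i => (h i).ext (IsEqToHom.id (A i))⟩

theorem apply {K : Type} {A B : K → D} {f : A ⟶ B} (h : IsEqToHom f) (i : K) :
    IsEqToHom (f i) := by
  obtain ⟨rfl, rfl⟩ := h
  exact ⟨rfl, rfl⟩

end IsEqToHom

theorem IsStrict.isEqToHom_associator {S : MonoidalCategory D} (h : IsStrict S) (A B X : D) :
    IsEqToHom (S.associator A B X).hom := ⟨_, h.assoc_hom A B X⟩

theorem IsStrict.isEqToHom_leftUnitor {S : MonoidalCategory D} (h : IsStrict S) (A : D) :
    IsEqToHom (S.leftUnitor A).hom := ⟨_, h.leftUnit_hom A⟩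

theorem IsStrict.isEqToHom_rightUnitor {S : MonoidalCategory D} (h : IsStrict S) (A : D) :
    IsEqToHom (S.rightUnitor A).hom := ⟨_, h.rightUnit_hom A⟩

theorem IsStrict.pi {S : MonoidalCategory D} (h : IsStrict S) (K : Type) :
    IsStrict (piMonoidal S K) where
  assoc_obj X Y Z := funext fun i => h.assoc_obj (X i) (Y i) (Z i)
  leftUnit_obj X := funext fun i => h.leftUnit_obj (X i)
  rightUnit_obj X := funext fun i => h.rightUnit_obj (X i)
  assoc_hom X Y Z := IsEqToHom.ext (IsEqToHom.pi
    (f := ((piMonoidal S K).associator X Y Z).hom) fun i =>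
      h.isEqToHom_associator (X i) (Y i) (Z i)) (IsEqToHom.eqToHom _)
  leftUnit_hom X := IsEqToHom.ext (IsEqToHom.pi
    (f := ((piMonoidal S K).leftUnitor X).hom) fun i => h.isEqToHom_leftUnitor (X i))
    (IsEqToHom.eqToHom _)
  rightUnit_hom X := IsEqToHom.ext (IsEqToHom.pi
    (f := ((piMonoidal S K).rightUnitor X).hom) fun i => h.isEqToHom_rightUnitor (X i))
    (IsEqToHom.eqToHom _)

variable {ι κ : Type} {S : MonoidalCategory D}

theorem IsStrict.isEqToHom_appendHom (h : IsStrict S) (A : ι → D) (L L' : List ι) :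
    IsEqToHom ((appendHom S L L').app A) := by
  induction L with
  | nil => exact h.isEqToHom_leftUnitor _
  | cons i L ih => exact (h.isEqToHom_associator _ _ _).comp ((IsEqToHom.id _).tensorHom ih)

theorem IsStrict.isEqToHom_flatMapHom (h : IsStrict S) (ℓ : κ → List ι) (A : ι → D)
    (K : List κ) : IsEqToHom ((flatMapHom S ℓ K).app A) := by
  induction K with
  | nil => exact IsEqToHom.id _
  | cons j K ih => exact ((IsEqToHom.id _).tensorHom ih).comp (h.isEqToHom_appendHom A _ _)

end IsEqToHom

/-! ### One level of the iterated bar construction -/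

section Step

variable {D₁ : Type u} [Category.{v} D₁] {D₂ : Type u} [Category.{v} D₂]
  {D₃ : Type u} [Category.{v} D₃] {D₄ : Type u} [Category.{v} D₄] {ι κ κ' κ'' : Type}

/-- The comparison of two successive products of lists with the product over a list that is equal
to the concatenation. -/
def flatMapComparison (S : MonoidalCategory D₁) (ℓ : κ → List ι) {K : List κ} {L : List ι}
    (h : L = K.flatMap ℓ) : listBar S ℓ ⋙ listTensor S K ⟶ listTensor S L :=
  flatMapHom S ℓ K ≫ eqToHom (congrArg (listTensor S) h.symm)

theorem flatMapComparison_rfl (S : MonoidalCategory D₁) (ℓ : κ → List ι) (K : List κ) :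
    flatMapComparison S ℓ (K := K) rfl = flatMapHom S ℓ K :=
  Category.comp_id _

theorem IsStrict.isEqToHom_flatMapComparison {S : MonoidalCategory D₁} (hS : IsStrict S)
    (ℓ : κ → List ι) {K : List κ} {L : List ι} (h : L = K.flatMap ℓ) (A : ι → D₁) :
    IsEqToHom ((flatMapComparison S ℓ h).app A) := by
  subst h
  rw [flatMapComparison_rfl]
  exact hS.isEqToHom_flatMapHom ℓ A K

theorem isMonoidalTrans_flatMapComparison {R S : MonoidalCategory D₁} (a : Interchange R S)
    (ℓ : κ → List ι) {K : List κ} {L : List ι} (h : L = K.flatMap ℓ) :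
    IsMonoidalTrans ((LaxStructure.listBar a ℓ).comp (LaxStructure.listTensor a K))
      (LaxStructure.listTensor a L) (flatMapComparison S ℓ h) := by
  subst h
  rw [flatMapComparison_rfl]
  exact isMonoidalTrans_flatMapHom a ℓ K

theorem LaxStructure.listμ_flatMapComparison {S : MonoidalCategory D₁} {S' : MonoidalCategory D₂}
    {F : D₁ ⥤ D₂} (l : LaxStructure S S' F) (ℓ : κ → List ι) {K : List κ} {L : List ι}
    (h : L = K.flatMap ℓ) (A : ι → D₁) :
    (SMI.listTensor S' K).map ((l.barμ ℓ).app A) ≫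
        (l.listμ K).app ((SMI.listBar S ℓ).obj A) ≫ F.map ((flatMapComparison S ℓ h).app A) =
      (flatMapComparison S' ℓ h).app ((powFunctor ι F).obj A) ≫ (l.listμ L).app A := by
  subst h
  rw [flatMapComparison_rfl, flatMapComparison_rfl, l.listμ_flatMap]

/-- The functor given by the tensor products of lists, followed by a power of a functor. -/
abbrev step (S : MonoidalCategory D₁) (F : D₁ ⥤ D₂) (ℓ : κ → List ι) : (ι → D₁) ⥤ (κ → D₂) :=
  listBar S ℓ ⋙ powFunctor κ F

/-- The lax monoidal structure on `step`. -/
@[reducible] def LaxStructure.step {R S : MonoidalCategory D₁} {R' : MonoidalCategory D₂}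
    (a : Interchange R S) {F : D₁ ⥤ D₂} (r : LaxStructure R R' F) (ℓ : κ → List ι) :
    LaxStructure (piMonoidal R ι) (piMonoidal R' κ) (step S F ℓ) :=
  (LaxStructure.listBar a ℓ).comp (r.pi κ)

theorem IsDoubleLax.step {R S T : MonoidalCategory D₁} {R' S' : MonoidalCategory D₂}
    {a : Interchange R S} {a' : Interchange R' S'} {b : Interchange R T} {c : Interchange S T}
    {F : D₁ ⥤ D₂} {r : LaxStructure R R' F} {s : LaxStructure S S' F} (h : a.Compatible b c)
    (d : IsDoubleLax a a' r s) (ℓ : κ → List ι) :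
    IsDoubleLax (a.pi ι) (a'.pi κ) (LaxStructure.step b r ℓ) (LaxStructure.step c s ℓ) :=
  (IsDoubleLax.listBar h ℓ).comp (d.pi κ)

/-- The comparison of a composite of two steps with a single one: the products of lists are moved
through `F`, the functors are compared, and the products of lists are concatenated. -/
def stepComparison {S : MonoidalCategory D₁} {S' : MonoidalCategory D₂} {F : D₁ ⥤ D₂}
    {F' : D₂ ⥤ D₃} {F'' : D₁ ⥤ D₃} (l : LaxStructure S S' F) (ω : F ⋙ F' ⟶ F'') {ℓ : κ → List ι}
    {ℓ' : κ' → List κ} {ℓ'' : κ' → List ι} (h : ∀ j, ℓ'' j = (ℓ' j).flatMap ℓ) :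
    step S F ℓ ⋙ step S' F' ℓ' ⟶ step S F'' ℓ'' :=
  NatTrans.pi' fun j =>
    Functor.whiskerRight (Functor.whiskerLeft (listBar S ℓ) (l.listμ (ℓ' j))) F' ≫
      Functor.whiskerLeft (listBar S ℓ ⋙ listTensor S (ℓ' j)) ω ≫
        Functor.whiskerRight (flatMapComparison S ℓ (h j)) F''

theorem isMonoidalTrans_stepComparison {R S : MonoidalCategory D₁} {R' S' : MonoidalCategory D₂}
    {R'' : MonoidalCategory D₃} {a : Interchange R S} {a' : Interchange R' S'} {F : D₁ ⥤ D₂}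
    {F' : D₂ ⥤ D₃} {F'' : D₁ ⥤ D₃} {r : LaxStructure R R' F} {r' : LaxStructure R' R'' F'}
    {r'' : LaxStructure R R'' F''} {l : LaxStructure S S' F} (d : IsDoubleLax a a' r l)
    {ω : F ⋙ F' ⟶ F''} (hω : IsMonoidalTrans (r.comp r') r'' ω) {ℓ : κ → List ι}
    {ℓ' : κ' → List κ} {ℓ'' : κ' → List ι} (h : ∀ j, ℓ'' j = (ℓ' j).flatMap ℓ) :
    IsMonoidalTrans ((LaxStructure.step a r ℓ).comp (LaxStructure.step a' r' ℓ'))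
      (LaxStructure.step a r'' ℓ'') (stepComparison l ω h) := by
  have coordinate (j) : IsMonoidalTrans
      ((LaxStructure.step a r ℓ).comp ((LaxStructure.listTensor a' (ℓ' j)).comp r'))
      ((LaxStructure.listTensor a (ℓ'' j)).comp r'')
      (Functor.whiskerRight (Functor.whiskerLeft (listBar S ℓ) (l.listμ (ℓ' j))) F' ≫
        Functor.whiskerLeft (listBar S ℓ ⋙ listTensor S (ℓ' j)) ω ≫
          Functor.whiskerRight (flatMapComparison S ℓ (h j)) F'') := by
    have hμ := ((isMonoidalTrans_listμ d (ℓ' j)).whiskerLeft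
      (LaxStructure.listBar a ℓ)).whiskerRight r'
    have hω' := hω.whiskerLeft ((LaxStructure.listBar a ℓ).comp (LaxStructure.listTensor a (ℓ' j)))
    have hflat := (isMonoidalTrans_flatMapComparison a ℓ (h j)).whiskerRight r''
    rw [← LaxStructure.comp_assoc] at hμ hω'
    rw [← LaxStructure.comp_assoc] at hμ ⊢
    exact hμ.comp (hω'.comp hflat)
  exact .of_ε_μ (funext fun j => (coordinate j).ε_app) fun A B =>
    funext fun j => (coordinate j).μ_app A B

theorem map_listTensor_flatMapComparison {S : MonoidalCategory D₁} (hS : IsStrict S)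
    {ℓ : κ → List ι} {ℓ' : κ' → List κ} {ℓ₁₂ : κ' → List ι} {K : List κ'} {K₂₃ : List κ}
    {K₁₂₃ : List ι} (h₁₂ : ∀ j, ℓ₁₂ j = (ℓ' j).flatMap ℓ) (h₂₃ : K₂₃ = K.flatMap ℓ')
    (e₁₂ : K₁₂₃ = K.flatMap ℓ₁₂) (e₂₃ : K₁₂₃ = K₂₃.flatMap ℓ) (A : ι → D₁) :
    (listTensor S K).map
        (fun i => (flatMapComparison S ℓ (h₁₂ i)).app A :
          (listBar S ℓ').obj ((listBar S ℓ).obj A) ⟶ (listBar S ℓ₁₂).obj A) ≫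
        (flatMapComparison S ℓ₁₂ e₁₂).app A =
      (flatMapComparison S ℓ' h₂₃).app ((listBar S ℓ).obj A) ≫
        (flatMapComparison S ℓ e₂₃).app A :=
  (((IsEqToHom.pi fun i => hS.isEqToHom_flatMapComparison _ (h₁₂ i) A).map _).comp
      (hS.isEqToHom_flatMapComparison _ _ A)).ext
    ((hS.isEqToHom_flatMapComparison _ _ _).comp (hS.isEqToHom_flatMapComparison _ _ A))

theorem map_stepComparison_listμ {S : MonoidalCategory D₁} {S' : MonoidalCategory D₂}
    {S'' : MonoidalCategory D₃} {F : D₁ ⥤ D₂} {F' : D₂ ⥤ D₃} {F₁₂ : D₁ ⥤ D₃}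
    {l : LaxStructure S S' F} {l' : LaxStructure S' S'' F'} {l₁₂ : LaxStructure S S'' F₁₂}
    {ω : F ⋙ F' ⟶ F₁₂} (hω : IsMonoidalTrans (l.comp l') l₁₂ ω) {ℓ : κ → List ι}
    {ℓ' : κ' → List κ} {ℓ₁₂ : κ' → List ι} (h : ∀ j, ℓ₁₂ j = (ℓ' j).flatMap ℓ) (A : ι → D₁)
    (K : List κ') :
    (listTensor S'' K).map ((stepComparison l ω h).app A) ≫
        (l₁₂.listμ K).app ((listBar S ℓ₁₂).obj A) =
      (l'.listμ K).app ((listBar S' ℓ').obj ((step S F ℓ).obj A)) ≫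
        F'.map ((listTensor S' K).map ((l.barμ ℓ').app ((listBar S ℓ).obj A))) ≫
          F'.map ((l.listμ K).app ((listBar S ℓ').obj ((listBar S ℓ).obj A))) ≫ ω.app _ ≫
            F₁₂.map ((listTensor S K).map
              (fun i => (flatMapComparison S ℓ (h i)).app A :
                (listBar S ℓ').obj ((listBar S ℓ).obj A) ⟶ (listBar S ℓ₁₂).obj A)) := by
  let B := (listBar S ℓ).obj A
  let B' := (listBar S ℓ').obj B
  let w : (powFunctor κ' F').obj ((powFunctor κ' F).obj B') ⟶ (powFunctor κ' F₁₂).obj B' :=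
    fun i => ω.app (B' i)
  let γ : B' ⟶ (listBar S ℓ₁₂).obj A := fun i => (flatMapComparison S ℓ (h i)).app A
  let m : (listTensor S' K).obj ((powFunctor κ' F).obj B') ⟶ F.obj ((listTensor S K).obj B') :=
    (l.listμ K).app B'
  have hw : (l'.listμ K).app ((powFunctor κ' F).obj B') ≫ F'.map m ≫ ω.app _ =
      (listTensor S'' K).map w ≫ (l₁₂.listμ K).app B' := by
    have hlist := hω.listμ_app B' K
    rw [LaxStructure.listμ_comp] at hlist
    exact (Category.assoc _ _ _).symm.trans hlist
  have hmap : (listTensor S'' K).map ((stepComparison l ω h).app A) =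
      (listTensor S'' K).map ((powFunctor κ' F').map ((l.barμ ℓ').app B)) ≫
        (listTensor S'' K).map w ≫ (listTensor S'' K).map ((powFunctor κ' F₁₂).map γ) :=
    ((listTensor S'' K).map_comp _ (_ ≫ _)).trans
      (congrArg (_ ≫ ·) ((listTensor S'' K).map_comp _ _))
  rw [hmap, Category.assoc, Category.assoc, l₁₂.listμ_natural γ, ← reassoc_of% hw,
    reassoc_of% l'.listμ_natural ((l.barμ ℓ').app B)]
  rfl

theorem map_map_app {F : D₁ ⥤ D₂} {F' : D₂ ⥤ D₃} {F'' : D₁ ⥤ D₃} (ω : F ⋙ F' ⟶ F'') {X Y : D₁}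
    (f : X ⟶ Y) : F'.map (F.map f) ≫ ω.app Y = ω.app X ≫ F''.map f :=
  ω.naturality f

theorem stepComparison_assoc {S : MonoidalCategory D₁} {S' : MonoidalCategory D₂}
    {S'' : MonoidalCategory D₃} (hS : IsStrict S) {F : D₁ ⥤ D₂} {F' : D₂ ⥤ D₃} {F'' : D₃ ⥤ D₄}
    {F₁₂ : D₁ ⥤ D₃} {F₂₃ : D₂ ⥤ D₄} {F₁₂₃ : D₁ ⥤ D₄} {l : LaxStructure S S' F}
    {l' : LaxStructure S' S'' F'} {l₁₂ : LaxStructure S S'' F₁₂} {ω₁₂ : F ⋙ F' ⟶ F₁₂}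
    {ω₂₃ : F' ⋙ F'' ⟶ F₂₃} {θ₁₂ : F₁₂ ⋙ F'' ⟶ F₁₂₃} {θ₂₃ : F ⋙ F₂₃ ⟶ F₁₂₃}
    (hω₁₂ : IsMonoidalTrans (l.comp l') l₁₂ ω₁₂)
    (hω : ∀ A, F''.map (ω₁₂.app A) ≫ θ₁₂.app A = ω₂₃.app (F.obj A) ≫ θ₂₃.app A)
    {ℓ : κ → List ι} {ℓ' : κ' → List κ} {ℓ'' : κ'' → List κ'} {ℓ₁₂ : κ' → List ι}
    {ℓ₂₃ : κ'' → List κ} {ℓ₁₂₃ : κ'' → List ι} (h₁₂ : ∀ j, ℓ₁₂ j = (ℓ' j).flatMap ℓ)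
    (h₂₃ : ∀ j, ℓ₂₃ j = (ℓ'' j).flatMap ℓ') (e₁₂ : ∀ j, ℓ₁₂₃ j = (ℓ'' j).flatMap ℓ₁₂)
    (e₂₃ : ∀ j, ℓ₁₂₃ j = (ℓ₂₃ j).flatMap ℓ) (A : ι → D₁) :
    (step S'' F'' ℓ'').map ((stepComparison l ω₁₂ h₁₂).app A) ≫
        (stepComparison l₁₂ θ₁₂ e₁₂).app A =
      (stepComparison l' ω₂₃ h₂₃).app ((step S F ℓ).obj A) ≫ (stepComparison l θ₂₃ e₂₃).app A := by
  funext j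
  let B := (listBar S ℓ).obj A
  let B' := (listBar S ℓ').obj B
  let γ : B' ⟶ (listBar S ℓ₁₂).obj A := fun i => (flatMapComparison S ℓ (h₁₂ i)).app A
  let m : (listTensor S' (ℓ'' j)).obj ((powFunctor κ' F).obj B') ⟶
    F.obj ((listTensor S (ℓ'' j)).obj B') := (l.listμ (ℓ'' j)).app B'
  let n : (listTensor S' (ℓ₂₃ j)).obj ((powFunctor κ F).obj B) ⟶
    F.obj ((listTensor S (ℓ₂₃ j)).obj B) := (l.listμ (ℓ₂₃ j)).app B
  let m' := (l'.listμ (ℓ'' j)).app ((listBar S' ℓ').obj ((powFunctor κ F).obj B))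
  let m₁₂ := (l₁₂.listμ (ℓ'' j)).app ((listBar S ℓ₁₂).obj A)
  let p := (flatMapComparison S ℓ₁₂ (e₁₂ j)).app A
  let q : (listTensor S (ℓ'' j)).obj B' ⟶ (listTensor S (ℓ₂₃ j)).obj B :=
    (flatMapComparison S ℓ' (h₂₃ j)).app B
  let q' : (listTensor S' (ℓ'' j)).obj ((listBar S' ℓ').obj ((powFunctor κ F).obj B)) ⟶
    (listTensor S' (ℓ₂₃ j)).obj ((powFunctor κ F).obj B) :=
    (flatMapComparison S' ℓ' (h₂₃ j)).app ((powFunctor κ F).obj B)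
  have hμ : (listTensor S'' (ℓ'' j)).map ((stepComparison l ω₁₂ h₁₂).app A) ≫ m₁₂ =
      m' ≫ F'.map ((listTensor S' (ℓ'' j)).map ((l.barμ ℓ').app B)) ≫ F'.map m ≫ ω₁₂.app _ ≫
        F₁₂.map ((listTensor S (ℓ'' j)).map γ) := map_stepComparison_listμ hω₁₂ h₁₂ A (ℓ'' j)
  have hflat : (listTensor S (ℓ'' j)).map γ ≫ p = q ≫ (flatMapComparison S ℓ (e₂₃ j)).app A :=
    map_listTensor_flatMapComparison hS h₁₂ (h₂₃ j) (e₁₂ j) (e₂₃ j) A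
  have hn : (listTensor S' (ℓ'' j)).map ((l.barμ ℓ').app B) ≫ m ≫ F.map q = q' ≫ n :=
    l.listμ_flatMapComparison ℓ' (h₂₃ j) B
  change F''.map ((listTensor S'' (ℓ'' j)).map ((stepComparison l ω₁₂ h₁₂).app A)) ≫
      F''.map m₁₂ ≫ θ₁₂.app _ ≫ F₁₂₃.map p =
    (F''.map m' ≫ ω₂₃.app _ ≫ F₂₃.map q') ≫ F₂₃.map n ≫ θ₂₃.app _ ≫ F₁₂₃.map _
  rw [← F''.map_comp_assoc, hμ, Category.assoc, Category.assoc, ← F₂₃.map_comp_assoc, ← hn]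
  simp only [Functor.map_comp, Category.assoc]
  rw [reassoc_of% map_map_app θ₁₂, ← F₁₂₃.map_comp, hflat, reassoc_of% map_map_app θ₂₃,
    F₁₂₃.map_comp, reassoc_of% hω, reassoc_of% map_map_app ω₂₃, reassoc_of% map_map_app ω₂₃]

end Step

section StepUnit

variable {D₁ : Type u} [Category.{v} D₁] {D₂ : Type u} [Category.{v} D₂]
  {D₃ : Type u} [Category.{v} D₃] {ι κ κ' : Type}

/-- The comparison of the tensor product over a list equal to `[j]` with the `j`-th projection. -/
def singletonComparison (S : MonoidalCategory D₁) {L : List ι} {j : ι} (h : L = [j]) :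
    listTensor S L ⟶ Pi.eval (fun _ => D₁) j :=
  eqToHom (congrArg (listTensor S) h) ≫
    { app := fun A => (S.rightUnitor (A j)).hom
      naturality := fun _ _ f => tensorHom_id_rightUnitor S (f j) }

theorem singletonComparison_rfl_app (S : MonoidalCategory D₁) (j : ι) (A : ι → D₁) :
    (singletonComparison S (j := j) rfl).app A = (S.rightUnitor (A j)).hom :=
  Category.id_comp _

theorem IsStrict.isEqToHom_singletonComparison {S : MonoidalCategory D₁} (hS : IsStrict S)
    {L : List ι} {j : ι} (h : L = [j]) (A : ι → D₁) :
    IsEqToHom ((singletonComparison S h).app A) := by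
  subst h
  rw [singletonComparison_rfl_app]
  exact hS.isEqToHom_rightUnitor _

theorem isMonoidalTrans_singletonComparison {R S : MonoidalCategory D₁} (a : Interchange R S)
    {L : List ι} {j : ι} (h : L = [j]) :
    IsMonoidalTrans (LaxStructure.listTensor a L) (LaxStructure.eval R j)
      (singletonComparison S h) := by
  subst h
  refine .of_ε_μ ?_ fun A B => ?_
  · rw [singletonComparison_rfl_app]
    change (a.Δ ≫ (𝟙 _ ⊗ₘ[S] a.ι)) ≫ (S.rightUnitor R.tensorUnit).hom = 𝟙 _
    rw [Category.assoc, a.Δ_rightUnitor]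
  · simp only [singletonComparison_rfl_app]
    change (a.ζ _ _ _ _ ≫ (𝟙 (A j ⊗[R] B j) ⊗ₘ[S] a.μ)) ≫ (S.rightUnitor (A j ⊗[R] B j)).hom =
      ((S.rightUnitor (A j)).hom ⊗ₘ[R] (S.rightUnitor (B j)).hom) ≫ 𝟙 _
    rw [Category.assoc, a.ζ_rightUnitor]
    exact (Category.comp_id _).symm

/-- The comparison of a step along singletons with the identity. -/
def stepUnit (S : MonoidalCategory D₁) {F : D₁ ⥤ D₁} (υ : F ⟶ 𝟭 D₁) {ℓ : ι → List ι}
    (h : ∀ j, ℓ j = [j]) : step S F ℓ ⟶ 𝟭 (ι → D₁) :=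
  NatTrans.pi' fun j => Functor.whiskerRight (singletonComparison S (h j)) F ≫
    Functor.whiskerLeft (Pi.eval (fun _ => D₁) j) υ

theorem isMonoidalTrans_stepUnit {R S : MonoidalCategory D₁} (a : Interchange R S) {F : D₁ ⥤ D₁}
    {r : LaxStructure R R F} {υ : F ⟶ 𝟭 D₁} (hυ : IsMonoidalTrans r (LaxStructure.id R) υ)
    {ℓ : ι → List ι} (h : ∀ j, ℓ j = [j]) :
    IsMonoidalTrans (LaxStructure.step a r ℓ) (LaxStructure.id (piMonoidal R ι))
      (stepUnit S υ h) := by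
  have coordinate (j) := ((isMonoidalTrans_singletonComparison a (h j)).whiskerRight r).comp
    (hυ.whiskerLeft (LaxStructure.eval R j))
  refine .of_ε_μ (funext fun j => (coordinate j).ε_app.trans ?_) fun A B => funext fun j =>
    ((coordinate j).μ_app A B).trans (congrArg (_ ≫ ·) ?_)
  · exact Category.comp_id _
  · exact Category.comp_id _

theorem IsStrict.isEqToHom_stepUnit {S : MonoidalCategory D₁} (hS : IsStrict S) {F : D₁ ⥤ D₁}
    {υ : F ⟶ 𝟭 D₁} (hυ : ∀ A, IsEqToHom (υ.app A)) {ℓ : ι → List ι} (h : ∀ j, ℓ j = [j])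
    (A : ι → D₁) : IsEqToHom ((stepUnit S υ h).app A) :=
  IsEqToHom.pi fun j => ((hS.isEqToHom_singletonComparison (h j) A).map F).comp (hυ _)

theorem isEqToHom_listμ {S : MonoidalCategory D₁} {S' : MonoidalCategory D₂} {F : D₁ ⥤ D₂}
    {l : LaxStructure S S' F} (hε : IsEqToHom l.ε) (hμ : ∀ A B, IsEqToHom (l.μ A B))
    (A : ι → D₁) (L : List ι) : IsEqToHom ((l.listμ L).app A) := by
  induction L with
  | nil => exact hε
  | cons i L ih =>
    let f : (listTensor S' L).obj ((powFunctor ι F).obj A) ⟶ F.obj ((listTensor S L).obj A) :=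
      (l.listμ L).app A
    have hf : IsEqToHom f := ih
    exact ((IsEqToHom.id _).tensorHom hf).comp (hμ _ _)

theorem IsMonoidalTrans.isEqToHom_listμ {S : MonoidalCategory D₁} {F : D₁ ⥤ D₁}
    {l : LaxStructure S S F} {υ : F ⟶ 𝟭 D₁} (h : IsMonoidalTrans l (LaxStructure.id S) υ)
    (hυ : ∀ A, IsEqToHom (υ.app A)) (A : ι → D₁) (L : List ι) :
    IsEqToHom ((l.listμ L).app A) := by
  refine IsEqToHom.of_comp (g := υ.app _) ?_ (hυ _)
  have hlist := h.listμ_app A L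
  rw [LaxStructure.listμ_id] at hlist
  exact hlist ▸ ((IsEqToHom.pi fun i => hυ (A i)).map (listTensor S L)).comp (IsEqToHom.id _)

theorem IsStrict.isEqToHom_listμ_singleton {S : MonoidalCategory D₁} {S' : MonoidalCategory D₂}
    (hS : IsStrict S) (hS' : IsStrict S') {F : D₁ ⥤ D₂} (l : LaxStructure S S' F) (A : ι → D₁)
    (i : ι) : IsEqToHom ((l.listμ [i]).app A) := by
  refine IsEqToHom.of_comp (g := F.map (S.rightUnitor (A i)).hom) ?_
    ((hS.isEqToHom_rightUnitor _).map F)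
  change IsEqToHom (((𝟙 _ ⊗ₘ[S'] l.ε) ≫ l.μ _ _) ≫ F.map (S.rightUnitor (A i)).hom)
  rw [Category.assoc, l.right_unitality]
  exact hS'.isEqToHom_rightUnitor _

theorem IsStrict.isEqToHom_stepComparison {S : MonoidalCategory D₁} (hS : IsStrict S)
    {S' : MonoidalCategory D₂} {F : D₁ ⥤ D₂} {F' : D₂ ⥤ D₃} {F'' : D₁ ⥤ D₃}
    {l : LaxStructure S S' F} {ω : F ⋙ F' ⟶ F''} (hω : ∀ A, IsEqToHom (ω.app A))
    {ℓ : κ → List ι} {ℓ' : κ' → List κ} {ℓ'' : κ' → List ι}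
    (h : ∀ j, ℓ'' j = (ℓ' j).flatMap ℓ) (A : ι → D₁)
    (hl : ∀ j, IsEqToHom ((l.listμ (ℓ' j)).app ((listBar S ℓ).obj A))) :
    IsEqToHom ((stepComparison l ω h).app A) :=
  IsEqToHom.pi fun j => ((hl j).map F').comp
    ((hω _).comp ((hS.isEqToHom_flatMapComparison ℓ (h j) A).map F''))

end StepUnit

/-! ### Interchanges given by symmetries -/

section TensorHom

variable {C : Type u} [Category.{v} C] (S : MonoidalCategory C)

theorem tensorHom_eq_comp {A A' B B' : C} (f : A ⟶ A') (g : B ⟶ B') :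
    f ⊗ₘ[S] g = (f ⊗ₘ[S] 𝟙 B) ≫ (𝟙 A' ⊗ₘ[S] g) := by
  rw [tensorHom_comp, Category.comp_id, Category.id_comp]

theorem tensorHom_eq_comp' {A A' B B' : C} (f : A ⟶ A') (g : B ⟶ B') :
    f ⊗ₘ[S] g = (𝟙 A ⊗ₘ[S] g) ≫ (f ⊗ₘ[S] 𝟙 B') := by
  rw [tensorHom_comp, Category.comp_id, Category.id_comp]

theorem id_tensorHom_associator (A B : C) {E E' : C} (f : E ⟶ E') :
    (𝟙 (A ⊗[S] B) ⊗ₘ[S] f) ≫ (S.associator A B E').hom =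
      (S.associator A B E).hom ≫ (𝟙 A ⊗ₘ[S] (𝟙 B ⊗ₘ[S] f)) := by simp

end TensorHom

section Braided

open MonoidalCategory

variable {C : Type u} [Category.{v} C]

/-- The interchange of a braided monoidal structure with itself. -/
def Interchange.ofBraided [S : MonoidalCategory C] [BraidedCategory C] : Interchange S S where
  ζ A B A' B' := tensorμ A B A' B'
  μ := (λ_ (𝟙_ C)).hom
  Δ := (λ_ (𝟙_ C)).inv
  ι := 𝟙 (𝟙_ C)
  ζ_natural f g f' g' := tensorμ_natural f g f' g'
  ζ_associativity A B A' B' A'' B'' := by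
    change (tensorμ A B A' B' ⊗ₘ 𝟙 (A'' ⊗ B'')) ≫ tensorμ _ _ _ _ ≫
        ((α_ A A' A'').hom ⊗ₘ (α_ B B' B'').hom) =
      (α_ (A ⊗ B) (A' ⊗ B') (A'' ⊗ B'')).hom ≫ (𝟙 (A ⊗ B) ⊗ₘ tensorμ _ _ _ _) ≫ tensorμ _ _ _ _
    rw [tensorHom_id, id_tensorHom, tensor_associativity]
  ζ_left_unitality A B := by
    change ((λ_ (𝟙_ C)).inv ⊗ₘ 𝟙 (A ⊗ B)) ≫ tensorμ _ _ _ _ ≫ ((λ_ A).hom ⊗ₘ (λ_ B).hom) =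
      (λ_ (A ⊗ B)).hom
    rw [tensorHom_id, tensor_left_unitality]
  ζ_right_unitality A B := by
    change (𝟙 (A ⊗ B) ⊗ₘ (λ_ (𝟙_ C)).inv) ≫ tensorμ _ _ _ _ ≫ ((ρ_ A).hom ⊗ₘ (ρ_ B).hom) =
      (ρ_ (A ⊗ B)).hom
    rw [id_tensorHom, tensor_right_unitality]
  μ_associativity := by
    change ((λ_ (𝟙_ C)).hom ⊗ₘ 𝟙 (𝟙_ C)) ≫ (λ_ (𝟙_ C)).hom =
      (α_ (𝟙_ C) (𝟙_ C) (𝟙_ C)).hom ≫ (𝟙 (𝟙_ C) ⊗ₘ (λ_ (𝟙_ C)).hom) ≫ (λ_ (𝟙_ C)).hom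
    monoidal
  μ_left_unitality := by
    change (𝟙 (𝟙_ C) ⊗ₘ 𝟙 (𝟙_ C)) ≫ (λ_ (𝟙_ C)).hom = (λ_ (𝟙_ C)).hom
    monoidal
  μ_right_unitality := by
    change (𝟙 (𝟙_ C) ⊗ₘ 𝟙 (𝟙_ C)) ≫ (λ_ (𝟙_ C)).hom = (ρ_ (𝟙_ C)).hom
    monoidal
  ζ_associator A B E A' B' E' := by
    change ((α_ A B E).hom ⊗ₘ (α_ A' B' E').hom) ≫ tensorμ _ _ _ _ ≫
        (𝟙 (A ⊗ A') ⊗ₘ tensorμ _ _ _ _) =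
      tensorμ _ _ _ _ ≫ (tensorμ _ _ _ _ ⊗ₘ 𝟙 (E ⊗ E')) ≫ (α_ (A ⊗ A') (B ⊗ B') (E ⊗ E')).hom
    rw [tensorHom_id, id_tensorHom, associator_monoidal]
  Δ_associator := by
    change (λ_ (𝟙_ C)).inv ≫ ((λ_ (𝟙_ C)).inv ⊗ₘ 𝟙 (𝟙_ C)) ≫ (α_ (𝟙_ C) (𝟙_ C) (𝟙_ C)).hom =
      (λ_ (𝟙_ C)).inv ≫ (𝟙 (𝟙_ C) ⊗ₘ (λ_ (𝟙_ C)).inv)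
    monoidal
  ζ_leftUnitor A B := by
    change tensorμ _ _ _ _ ≫ ((λ_ (𝟙_ C)).hom ⊗ₘ 𝟙 (A ⊗ B)) ≫ (λ_ (A ⊗ B)).hom =
      (λ_ A).hom ⊗ₘ (λ_ B).hom
    rw [tensorHom_id, leftUnitor_monoidal]
  Δ_leftUnitor := by
    change (λ_ (𝟙_ C)).inv ≫ (𝟙 (𝟙_ C) ⊗ₘ 𝟙 (𝟙_ C)) ≫ (λ_ (𝟙_ C)).hom = 𝟙 (𝟙_ C)
    monoidal
  ζ_rightUnitor A B := by
    change tensorμ _ _ _ _ ≫ (𝟙 (A ⊗ B) ⊗ₘ (λ_ (𝟙_ C)).hom) ≫ (ρ_ (A ⊗ B)).hom =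
      (ρ_ A).hom ⊗ₘ (ρ_ B).hom
    rw [id_tensorHom, rightUnitor_monoidal]
  Δ_rightUnitor := by
    change (λ_ (𝟙_ C)).inv ≫ (𝟙 (𝟙_ C) ⊗ₘ 𝟙 (𝟙_ C)) ≫ (ρ_ (𝟙_ C)).hom = 𝟙 (𝟙_ C)
    monoidal

/-- The componentwise braiding on a product of a braided category with itself. -/
abbrev prodBraided [MonoidalCategory C] [BraidedCategory C] : BraidedCategory (C × C) where
  braiding X Y := Iso.prod (β_ X.1 Y.1) (β_ X.2 Y.2)

section LaxTensor

variable {T : MonoidalCategory C} [S : MonoidalCategory C] (b : Interchange S T)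

/-- The lax monoidal structure given by an interchange on a tensor product. -/
abbrev Interchange.laxMonoidalTensor : (@tensor C _ T).LaxMonoidal where
  ε := b.Δ
  μ X Y := b.ζ X.1 X.2 Y.1 Y.2
  μ_natural_left {X Y} f X' := by
    change (f.1 ⊗ₘ[T] f.2) ▷ (X'.1 ⊗[T] X'.2) ≫ b.ζ _ _ _ _ =
      b.ζ _ _ _ _ ≫ ((f.1 ▷ X'.1) ⊗ₘ[T] (f.2 ▷ X'.2))
    simpa only [tensorHom_id] using b.tensorHom_id_ζ f.1 f.2 X'.1 X'.2
  μ_natural_right {X Y} X' f := by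
    change (X'.1 ⊗[T] X'.2) ◁ (f.1 ⊗ₘ[T] f.2) ≫ b.ζ _ _ _ _ =
      b.ζ _ _ _ _ ≫ ((X'.1 ◁ f.1) ⊗ₘ[T] (X'.2 ◁ f.2))
    simpa only [id_tensorHom] using b.id_tensorHom_ζ f.1 f.2 X'.1 X'.2
  associativity X Y Z := by
    simpa only [tensorHom_id, id_tensorHom] using! b.ζ_associativity X.1 X.2 Y.1 Y.2 Z.1 Z.2
  left_unitality X := by
    simpa only [tensorHom_id] using! (b.ζ_left_unitality X.1 X.2).symm
  right_unitality X := by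
    simpa only [id_tensorHom] using! (b.ζ_right_unitality X.1 X.2).symm

/-- The monoid given by an interchange on the unit of the second monoidal structure. -/
abbrev Interchange.monObjUnit : MonObj T.tensorUnit where
  one := b.ι
  mul := b.μ
  one_mul := by simpa only [tensorHom_id] using! b.μ_left_unitality
  mul_one := by simpa only [id_tensorHom] using! b.μ_right_unitality
  mul_assoc := by simpa only [tensorHom_id, id_tensorHom] using! b.μ_associativity

end LaxTensor

theorem Interchange.Δ_tensorHom_Δ_ζ {S T : MonoidalCategory C} (b : Interchange S T) :
    (b.Δ ⊗ₘ[S] b.Δ) ≫ b.ζ _ _ _ _ ≫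
        ((S.leftUnitor S.tensorUnit).hom ⊗ₘ[T] (S.leftUnitor S.tensorUnit).hom) =
      (S.leftUnitor S.tensorUnit).hom ≫ b.Δ := by
  rw [tensorHom_eq_comp', Category.assoc, b.ζ_left_unitality, id_tensorHom_leftUnitor]

theorem Interchange.ι_tensorHom_ι_μ {S T : MonoidalCategory C} (b : Interchange S T) :
    (b.ι ⊗ₘ[S] b.ι) ≫ b.μ = (S.leftUnitor S.tensorUnit).hom ≫ b.ι := by
  rw [tensorHom_eq_comp', Category.assoc, b.μ_left_unitality, id_tensorHom_leftUnitor]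

theorem Interchange.Compatible.ofBraided_left {T : MonoidalCategory C} [S : MonoidalCategory C]
    [BraidedCategory C] (b : Interchange S T)
    (hζ : ∀ A B A' B' : C, (β_ (A ⊗[T] B) (A' ⊗[T] B')).hom ≫ b.ζ A' B' A B =
      b.ζ A B A' B' ≫ ((β_ A A').hom ⊗ₘ[T] (β_ B B').hom))
    (hμ : (β_ T.tensorUnit T.tensorUnit).hom ≫ b.μ = b.μ) :
    Compatible (ofBraided (S := S)) b b where
  ζ_ζ A B E G A' B' E' G' := by
    let : BraidedCategory (C × C) := prodBraided
    let := b.laxMonoidalTensor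
    let : (@tensor C _ T).LaxBraided := { braided := fun X Y => (hζ X.1 X.2 Y.1 Y.2).symm }
    exact tensorμ_comp_μ_tensorHom_μ_comp_μ (@tensor C _ T) (A, B) (E, G) (A', B') (E', G')
  Δ_ζ := by
    change (S.leftUnitor S.tensorUnit).inv ≫ (b.Δ ⊗ₘ[S] b.Δ) ≫ b.ζ _ _ _ _ =
      b.Δ ≫ ((S.leftUnitor S.tensorUnit).inv ⊗ₘ[T] (S.leftUnitor S.tensorUnit).inv)
    rw [Iso.inv_comp_eq, ← reassoc_of% b.Δ_tensorHom_Δ_ζ, SMI.tensorHom_comp, Iso.hom_inv_id,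
      tensorHom_id_id, Category.comp_id]
  μ_Δ := b.Δ_tensorHom_Δ_ζ.symm
  ι_Δ := by
    change 𝟙 _ ≫ b.Δ = b.Δ ≫ (𝟙 _ ⊗ₘ[T] 𝟙 _)
    rw [tensorHom_id_id, Category.comp_id, Category.id_comp]
  ζ_μ := by
    let := b.monObjUnit
    have : IsCommMonObj T.tensorUnit := ⟨hμ⟩
    exact MonObj.mul_mul_mul_comm T.tensorUnit
  Δ_μ := by
    change (S.leftUnitor S.tensorUnit).inv ≫ (b.ι ⊗ₘ[S] b.ι) ≫ b.μ = b.ι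
    rw [b.ι_tensorHom_ι_μ, Iso.inv_hom_id_assoc]
  μ_ι := b.ι_tensorHom_ι_μ.symm
  ι_ι := Category.id_comp _

theorem braiding_tensorμ [MonoidalCategory C] [SymmetricCategory C] (A B A' B' : C) :
    (β_ (A ⊗ B) (A' ⊗ B')).hom ≫ tensorμ A' B' A B =
      tensorμ A B A' B' ≫ ((β_ A A').hom ⊗ₘ (β_ B B').hom) := by
  simp [tensorμ, SymmetricCategory.braiding_swap_eq_inv_braiding B' A,
    MonoidalCategory.tensorHom_def]

end Braided

section Symmetric

variable {C : Type u} [Category.{v} C] {S T : MonoidalCategory C}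

/-- The symmetry of a given symmetric monoidal structure. -/
abbrev braiding (S : MonoidalCategory C) [σ : @SymmetricCategory C _ S] (A B : C) :
    A ⊗[S] B ≅ B ⊗[S] A :=
  @BraidedCategory.braiding C _ S σ.toBraidedCategory A B

/-- The interchange of a symmetric monoidal structure with itself. -/
abbrev Interchange.ofSymmetric (T : MonoidalCategory C) [τ : @SymmetricCategory C _ T] :
    Interchange T T :=
  @Interchange.ofBraided C _ T τ.toBraidedCategory

/-- The exchange of the first two factors of a triple product. -/
def exchange (T : MonoidalCategory C) [@SymmetricCategory C _ T] (B E G : C) :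
    B ⊗[T] (E ⊗[T] G) ⟶ E ⊗[T] (B ⊗[T] G) :=
  (T.associator B E G).inv ≫ ((braiding T B E).hom ⊗ₘ[T] 𝟙 G) ≫ (T.associator E B G).hom

theorem Interchange.ofSymmetric_ζ [@SymmetricCategory C _ T] (A B E G : C) :
    (ofSymmetric T).ζ A B E G = (T.associator A B (E ⊗[T] G)).hom ≫
      (𝟙 A ⊗ₘ[T] exchange T B E G) ≫ (T.associator A E (B ⊗[T] G)).inv := by
  change MonoidalCategory.tensorμ A B E G = _ ≫ MonoidalCategoryStruct.tensorHom _ _ ≫ _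
  rw [MonoidalCategory.id_tensorHom]
  simp only [exchange, MonoidalCategory.tensorHom_id, MonoidalCategory.whiskerLeft_comp,
    MonoidalCategory.tensorμ, Category.assoc]

theorem Interchange.Compatible.ofSymmetric_self (T : MonoidalCategory C)
    [@SymmetricCategory C _ T] :
    Compatible (ofSymmetric T) (ofSymmetric T) (ofSymmetric T) :=
  letI := T
  ofBraided_left _ braiding_tensorμ
    ((braiding_leftUnitor _).trans (MonoidalCategory.unitors_equal (C := C)).symm)

namespace Interchange

variable (a : Interchange S T)

theorem associator_inv_ζ (A B E A' B' E' : C) :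
    ((T.associator A B E).inv ⊗ₘ[S] (T.associator A' B' E').inv) ≫ a.ζ _ _ _ _ ≫
        (a.ζ A B A' B' ⊗ₘ[T] 𝟙 _) =
      a.ζ _ _ _ _ ≫ (𝟙 _ ⊗ₘ[T] a.ζ B E B' E') ≫ (T.associator _ _ _).inv := by
  rw [← Category.assoc (a.ζ _ _ _ _), Iso.eq_comp_inv, Category.assoc, Category.assoc,
    ← a.ζ_associator A B E A' B' E']
  simp

theorem associator_ζ (A B E G A' B' E' G' : C) :
    ((T.associator A B (E ⊗[T] G)).hom ⊗ₘ[S] (T.associator A' B' (E' ⊗[T] G')).hom) ≫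
        a.ζ _ _ _ _ ≫ (𝟙 _ ⊗ₘ[T] (a.ζ _ _ _ _ ≫ (𝟙 (B ⊗[S] B') ⊗ₘ[T] a.ζ E G E' G'))) =
      a.ζ _ _ _ _ ≫ (a.ζ A B A' B' ⊗ₘ[T] a.ζ E G E' G') ≫ (T.associator _ _ _).hom := by
  have ζ_associator := a.ζ_associator A B (E ⊗[T] G) A' B' (E' ⊗[T] G')
  rw [id_tensorHom_comp, reassoc_of% ζ_associator,
    tensorHom_eq_comp T (a.ζ A B A' B') (a.ζ E G E' G'), Category.assoc, id_tensorHom_associator]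

theorem associator_inv_ζ_ζ (A B E G A' B' E' G' : C) :
    ((T.associator A B (E ⊗[T] G)).inv ⊗ₘ[S] (T.associator A' B' (E' ⊗[T] G')).inv) ≫
        a.ζ _ _ _ _ ≫ (a.ζ A B A' B' ⊗ₘ[T] a.ζ E G E' G') =
      a.ζ _ _ _ _ ≫ (𝟙 _ ⊗ₘ[T] (a.ζ _ _ _ _ ≫ (𝟙 (B ⊗[S] B') ⊗ₘ[T] a.ζ E G E' G'))) ≫
        (T.associator _ _ _).inv := by
  rw [← Category.assoc (a.ζ _ _ _ _), Iso.eq_comp_inv, Category.assoc, Category.assoc,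
    ← a.associator_ζ A B E G A' B' E' G']
  simp

theorem Δ_Δ_associator :
    a.Δ ≫ (a.Δ ⊗ₘ[T] a.Δ) ≫ (T.associator _ _ _).hom =
      a.Δ ≫ (𝟙 _ ⊗ₘ[T] (a.Δ ≫ (𝟙 _ ⊗ₘ[T] a.Δ))) := by
  rw [id_tensorHom_comp, ← reassoc_of% a.Δ_associator, tensorHom_eq_comp T a.Δ a.Δ,
    Category.assoc, id_tensorHom_associator]

theorem ζ_leftUnitor_μ :
    a.ζ _ _ _ _ ≫ (a.μ ⊗ₘ[T] a.μ) ≫ (T.leftUnitor T.tensorUnit).hom =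
      ((T.leftUnitor T.tensorUnit).hom ⊗ₘ[S] (T.leftUnitor T.tensorUnit).hom) ≫ a.μ := by
  have ζ_leftUnitor := a.ζ_leftUnitor T.tensorUnit T.tensorUnit
  rw [tensorHom_eq_comp T a.μ a.μ, Category.assoc, id_tensorHom_leftUnitor,
    reassoc_of% ζ_leftUnitor]

theorem Δ_leftUnitor_ι :
    a.Δ ≫ (a.ι ⊗ₘ[T] a.ι) ≫ (T.leftUnitor T.tensorUnit).hom = a.ι := by
  rw [tensorHom_eq_comp T a.ι a.ι, Category.assoc, id_tensorHom_leftUnitor,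
    reassoc_of% a.Δ_leftUnitor]

variable [τ : @SymmetricCategory C _ T]

theorem exchange_ζ
    (hζ : ∀ A B A' B' : C, ((braiding T A B).hom ⊗ₘ[S] (braiding T A' B').hom) ≫ a.ζ B A B' A' =
      a.ζ A B A' B' ≫ (braiding T (A ⊗[S] A') (B ⊗[S] B')).hom) (B E G B' E' G' : C) :
    (exchange T B E G ⊗ₘ[S] exchange T B' E' G') ≫ a.ζ _ _ _ _ ≫ (𝟙 _ ⊗ₘ[T] a.ζ B G B' G') =
      a.ζ _ _ _ _ ≫ (𝟙 _ ⊗ₘ[T] a.ζ E G E' G') ≫ exchange T _ _ _ := by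
  have ζ_associator := a.ζ_associator E B G E' B' G'
  have associator_inv_ζ := a.associator_inv_ζ B E G B' E' G'
  rw [exchange, exchange, exchange, ← tensorHom_comp, ← tensorHom_comp, Category.assoc,
    Category.assoc, ζ_associator, reassoc_of% a.ζ_natural, tensorHom_comp_assoc, hζ,
    tensorHom_id_id, Category.comp_id, ← reassoc_of% associator_inv_ζ, tensorHom_comp_assoc,
    Category.id_comp]

theorem Δ_exchange (hΔ : a.Δ ≫ (braiding T S.tensorUnit S.tensorUnit).hom = a.Δ) :
    a.Δ ≫ (𝟙 _ ⊗ₘ[T] a.Δ) ≫ exchange T _ _ _ = a.Δ ≫ (𝟙 _ ⊗ₘ[T] a.Δ) := by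
  have Δ_associator_inv :
      a.Δ ≫ (𝟙 _ ⊗ₘ[T] a.Δ) ≫ (T.associator _ _ _).inv = a.Δ ≫ (a.Δ ⊗ₘ[T] 𝟙 _) := by
    rw [← Category.assoc, Iso.comp_inv_eq, Category.assoc, a.Δ_associator]
  rw [exchange, reassoc_of% Δ_associator_inv, tensorHom_comp_assoc, hΔ, Category.comp_id,
    a.Δ_associator]

theorem Compatible.ofSymmetric_right
    (hζ : ∀ A B A' B' : C, ((braiding T A B).hom ⊗ₘ[S] (braiding T A' B').hom) ≫ a.ζ B A B' A' =
      a.ζ A B A' B' ≫ (braiding T (A ⊗[S] A') (B ⊗[S] B')).hom)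
    (hΔ : a.Δ ≫ (braiding T S.tensorUnit S.tensorUnit).hom = a.Δ) :
    Compatible a a (ofSymmetric T) where
  ζ_ζ A B E G A' B' E' G' := by
    have associator_ζ := a.associator_ζ A B E G A' B' E' G'
    rw [ofSymmetric_ζ, ofSymmetric_ζ, ofSymmetric_ζ, ← tensorHom_comp, ← tensorHom_comp,
      Category.assoc, Category.assoc, a.associator_inv_ζ_ζ, reassoc_of% a.ζ_natural,
      tensorHom_comp_assoc, a.exchange_ζ hζ, tensorHom_id_id, Category.comp_id,
      ← reassoc_of% associator_ζ, tensorHom_comp_assoc, Category.id_comp, Category.assoc]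
  Δ_ζ := by
    rw [ofSymmetric_ζ, reassoc_of% a.Δ_Δ_associator, tensorHom_comp_assoc, Category.comp_id,
      Category.assoc, a.Δ_exchange hΔ, ← reassoc_of% a.Δ_Δ_associator, Iso.hom_inv_id,
      Category.comp_id]
  μ_Δ := by
    change a.μ ≫ (T.leftUnitor T.tensorUnit).inv =
      ((T.leftUnitor T.tensorUnit).inv ⊗ₘ[S] (T.leftUnitor T.tensorUnit).inv) ≫ _ ≫ _
    rw [Iso.comp_inv_eq, Category.assoc, Category.assoc, a.ζ_leftUnitor_μ]
    simp
  ι_Δ := by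
    change a.ι ≫ (T.leftUnitor T.tensorUnit).inv = _
    rw [Iso.comp_inv_eq, Category.assoc, a.Δ_leftUnitor_ι]
  ζ_μ := a.ζ_leftUnitor_μ
  Δ_μ := a.Δ_leftUnitor_ι
  μ_ι := by
    change a.μ ≫ 𝟙 _ = (𝟙 _ ⊗ₘ[S] 𝟙 _) ≫ a.μ
    rw [tensorHom_id_id, Category.id_comp, Category.comp_id]
  ι_ι := Category.comp_id _

end Interchange

end Symmetric

section Intermuting

open BiSymmetric SMICategory

section Braiding

variable {C : Type u} [Category.{v} C] (S : MonoidalCategory C) [σ : @SymmetricCategory C _ S]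

theorem tensorHom_braiding {A A' B B' : C} (f : A ⟶ A') (g : B ⟶ B') :
    (f ⊗ₘ[S] g) ≫ (braiding S A' B').hom = (braiding S A B).hom ≫ (g ⊗ₘ[S] f) :=
  BraidedCategory.braiding_naturality f g

theorem braiding_symmetry (A B : C) : (braiding S A B).hom ≫ (braiding S B A).hom = 𝟙 _ :=
  SymmetricCategory.symmetry A B

theorem braiding_hom_leftUnitor (A : C) :
    (braiding S A S.tensorUnit).hom ≫ (S.leftUnitor A).hom = (S.rightUnitor A).hom :=
  braiding_leftUnitor A

theorem braiding_hom_rightUnitor (A : C) :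
    (braiding S S.tensorUnit A).hom ≫ (S.rightUnitor A).hom = (S.leftUnitor A).hom :=
  braiding_rightUnitor A

end Braiding

variable {C : Type u} [Category.{v} C] [SMICategory C]

instance : @SymmetricCategory C _ veeMon := veeSymm

instance : @SymmetricCategory C _ wedgeMon := wedgeSymm

theorem braiding_vee_ck (A B A' B' : C) :
    (braiding veeMon (A ∧ₒ B) (A' ∧ₒ B')).hom ≫ ck A' B' A B =
      ck A B A' B' ≫ ((braiding veeMon A A').hom ⊗ₘ[wedgeMon] (braiding veeMon B B').hom) :=
  eq4 A A' B B'

theorem braiding_wedge_ck (A B A' B' : C) :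
    ((braiding wedgeMon A B).hom ⊗ₘ[veeMon] (braiding wedgeMon A' B').hom) ≫ ck B A B' A' =
      ck A B A' B' ≫ (braiding wedgeMon (A ∨ₒ A') (B ∨ₒ B')).hom :=
  eq3 A B A' B'

theorem braiding_vee_top : (braiding veeMon (top : C) top).hom = 𝟙 _ :=
  (eq12 (C := C)).trans (Iso.hom_inv_id _)

theorem braiding_wedge_bot : (braiding wedgeMon (bot : C) bot).hom = 𝟙 _ :=
  (eq13 (C := C)).trans (Iso.inv_hom_id _)

theorem ck_associativity (A A' A'' B B' B'' : C) :
    (ck A B A' B' ⊗ₘ[veeMon] 𝟙 (A'' ∧ₒ B'')) ≫ ck (A ∨ₒ A') (B ∨ₒ B') A'' B'' ≫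
        ((veeMon.associator A A' A'').hom ⊗ₘ[wedgeMon] (veeMon.associator B B' B'').hom) =
      (veeMon.associator (A ∧ₒ B) (A' ∧ₒ B') (A'' ∧ₒ B'')).hom ≫
        (𝟙 (A ∧ₒ B) ⊗ₘ[veeMon] ck A' B' A'' B'') ≫ ck A B (A' ∨ₒ A'') (B' ∨ₒ B'') := by
  have associator_inv_hom :
      ((veeMon.associator A A' A'').inv ⊗ₘ[wedgeMon] (veeMon.associator B B' B'').inv) ≫
        ((veeMon.associator A A' A'').hom ⊗ₘ[wedgeMon] (veeMon.associator B B' B'').hom) = 𝟙 _ := by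
    simp
  rw [← Iso.inv_comp_eq]
  refine ((reassoc_of% eq2 A A' A'' B B' B'') _).trans ?_
  exact congrArg (_ ≫ _ ≫ ·) associator_inv_hom |>.trans (by rw [Category.comp_id])

theorem ck_associator (A B E A' B' E' : C) :
    ((wedgeMon.associator A B E).hom ⊗ₘ[veeMon] (wedgeMon.associator A' B' E').hom) ≫
        ck A (B ∧ₒ E) A' (B' ∧ₒ E') ≫ (𝟙 (A ∨ₒ A') ⊗ₘ[wedgeMon] ck B E B' E') =
      ck (A ∧ₒ B) E (A' ∧ₒ B') E' ≫ (ck A B A' B' ⊗ₘ[wedgeMon] 𝟙 (E ∨ₒ E')) ≫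
        (wedgeMon.associator (A ∨ₒ A') (B ∨ₒ B') (E ∨ₒ E')).hom := by
  have associator_hom_inv :
      ((wedgeMon.associator A B E).hom ⊗ₘ[veeMon] (wedgeMon.associator A' B' E').hom) ≫
      ((wedgeB A B E).hom ∨ₕ (wedgeB A' B' E').hom) = 𝟙 _ := by
    change (_ ⊗ₘ[veeMon] _) ≫
      ((wedgeMon.associator A B E).inv ⊗ₘ[veeMon] (wedgeMon.associator A' B' E').inv) = _
    simp
  rw [← Category.assoc, ← Category.assoc (ck _ _ _ _), ← Iso.comp_inv_eq, Category.assoc,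
    Category.assoc]
  refine (congrArg (_ ≫ ·) (eq1 A B E A' B' E')).symm.trans ?_
  rw [reassoc_of% associator_hom_inv]

theorem ck_right_unitality (A B : C) : (𝟙 (A ∧ₒ B) ⊗ₘ[veeMon] wBot.hom) ≫ ck A B bot bot ≫
    ((veeMon.rightUnitor A).hom ⊗ₘ[wedgeMon] (veeMon.rightUnitor B).hom) =
      (veeMon.rightUnitor (A ∧ₒ B)).hom := by
  rw [eq5]
  simp only [Category.assoc, tensorHom_comp_assoc, tensorHom_comp, Iso.hom_inv_id,
    Iso.inv_hom_id, tensorHom_id_id, Category.comp_id, Category.id_comp]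

theorem ck_left_unitality (A B : C) : (wBot.hom ⊗ₘ[veeMon] 𝟙 (A ∧ₒ B)) ≫ ck bot bot A B ≫
    ((veeMon.leftUnitor A).hom ⊗ₘ[wedgeMon] (veeMon.leftUnitor B).hom) =
      (veeMon.leftUnitor (A ∧ₒ B)).hom := by
  have wBot_braiding : (wBot.hom ⊗ₘ[veeMon] 𝟙 (A ∧ₒ B)) ≫ (braiding veeMon _ _).hom =
      (braiding veeMon _ _).hom ≫ (𝟙 _ ⊗ₘ[veeMon] wBot.hom) := tensorHom_braiding veeMon _ _
  rw [← braiding_hom_rightUnitor veeMon (A ∧ₒ B), ← ck_right_unitality A B,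
    ← reassoc_of% wBot_braiding, reassoc_of% braiding_vee_ck (bot : C) bot A B, tensorHom_comp,
    braiding_hom_rightUnitor, braiding_hom_rightUnitor]

theorem ck_rightUnitor (A B : C) : ck A top B top ≫ (𝟙 (A ∨ₒ B) ⊗ₘ[wedgeMon] wTop.hom) ≫
    (wedgeMon.rightUnitor (A ∨ₒ B)).hom =
      (wedgeMon.rightUnitor A).hom ⊗ₘ[veeMon] (wedgeMon.rightUnitor B).hom := by
  rw [eq6]
  simp only [Category.assoc, tensorHom_comp_assoc, Iso.inv_hom_id, tensorHom_id_id,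
    Category.comp_id, Category.id_comp]

theorem ck_leftUnitor (A B : C) : ck top A top B ≫ (wTop.hom ⊗ₘ[wedgeMon] 𝟙 (A ∨ₒ B)) ≫
    (wedgeMon.leftUnitor (A ∨ₒ B)).hom =
      (wedgeMon.leftUnitor A).hom ⊗ₘ[veeMon] (wedgeMon.leftUnitor B).hom := by
  have wTop_braiding : (𝟙 (A ∨ₒ B) ⊗ₘ[wedgeMon] wTop.hom) ≫ (braiding wedgeMon _ _).hom =
      (braiding wedgeMon _ _).hom ≫ (wTop.hom ⊗ₘ[wedgeMon] 𝟙 _) := tensorHom_braiding wedgeMon _ _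
  have braiding_ck := braiding_wedge_ck A top B top
  calc ck top A top B ≫ (wTop.hom ⊗ₘ[wedgeMon] 𝟙 (A ∨ₒ B)) ≫ (wedgeMon.leftUnitor (A ∨ₒ B)).hom
    _ = ((braiding wedgeMon top A).hom ⊗ₘ[veeMon] (braiding wedgeMon top B).hom) ≫ ck A top B top ≫
        (𝟙 (A ∨ₒ B) ⊗ₘ[wedgeMon] wTop.hom) ≫ (wedgeMon.rightUnitor (A ∨ₒ B)).hom := by
      rw [← braiding_hom_leftUnitor wedgeMon, reassoc_of% wTop_braiding, ← reassoc_of% braiding_ck,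
        tensorHom_comp_assoc, braiding_symmetry, braiding_symmetry, tensorHom_id_id,
        Category.id_comp]
    _ = _ := by
      rw [ck_rightUnitor, tensorHom_comp, braiding_hom_rightUnitor, braiding_hom_rightUnitor]

theorem wTop_associativity : (wTop.hom ⊗ₘ[veeMon] 𝟙 (top : C)) ≫ wTop.hom =
    (veeMon.associator top top top).hom ≫ (𝟙 (top : C) ⊗ₘ[veeMon] wTop.hom) ≫ wTop.hom := by
  rw [← Iso.inv_comp_eq]
  refine (congrArg (· ≫ (wTop.hom ⊗ₘ[veeMon] 𝟙 (top : C)) ≫ wTop.hom) (eq7 (C := C))).trans ?_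
  change ((_ ⊗ₘ[veeMon] _) ≫ (_ ⊗ₘ[veeMon] _)) ≫ (_ ⊗ₘ[veeMon] _) ≫ _ = (_ ⊗ₘ[veeMon] _) ≫ _
  rw [Category.assoc, tensorHom_comp_assoc, tensorHom_comp_assoc, Category.id_comp,
    Category.comp_id, Iso.inv_hom_id, Category.comp_id]

theorem wBot_associator :
    wBot.hom ≫ (wBot.hom ⊗ₘ[wedgeMon] 𝟙 (bot : C)) ≫ (wedgeMon.associator bot bot bot).hom =
      wBot.hom ≫ (𝟙 (bot : C) ⊗ₘ[wedgeMon] wBot.hom) := by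
  rw [← Category.assoc, ← Iso.eq_comp_inv, Category.assoc]
  refine .trans ?_
    (congrArg (wBot.hom ≫ (𝟙 (bot : C) ⊗ₘ[wedgeMon] wBot.hom) ≫ ·) (eq8 (C := C))).symm
  change _ = _ ≫ (_ ⊗ₘ[wedgeMon] _) ≫ (_ ⊗ₘ[wedgeMon] _) ≫ (_ ⊗ₘ[wedgeMon] _)
  rw [tensorHom_comp_assoc, Iso.hom_inv_id, Category.comp_id, tensorHom_id_id, Category.id_comp]

theorem kappa_right_unitality :
    (𝟙 (top : C) ⊗ₘ[veeMon] kappa) ≫ wTop.hom = (veeMon.rightUnitor (top : C)).hom := by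
  rw [show 𝟙 (top : C) ⊗ₘ[veeMon] kappa = _ from eq9]
  simp

theorem kappa_left_unitality :
    (kappa ⊗ₘ[veeMon] 𝟙 (top : C)) ≫ wTop.hom = (veeMon.leftUnitor (top : C)).hom := by
  have kappa_braiding := tensorHom_braiding veeMon (kappa : (bot : C) ⟶ top) (𝟙 (top : C))
  rw [braiding_vee_top, Category.comp_id] at kappa_braiding
  rw [kappa_braiding, Category.assoc, kappa_right_unitality, braiding_hom_rightUnitor]

theorem kappa_rightUnitor :
    wBot.hom ≫ (𝟙 (bot : C) ⊗ₘ[wedgeMon] kappa) ≫ (wedgeMon.rightUnitor (bot : C)).hom = 𝟙 _ := by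
  rw [show 𝟙 (bot : C) ⊗ₘ[wedgeMon] kappa = _ from eq10]
  simp

theorem kappa_leftUnitor :
    wBot.hom ≫ (kappa ⊗ₘ[wedgeMon] 𝟙 (bot : C)) ≫ (wedgeMon.leftUnitor (bot : C)).hom = 𝟙 _ := by
  have kappa_braiding := tensorHom_braiding wedgeMon (𝟙 (bot : C)) (kappa : (bot : C) ⟶ top)
  rw [braiding_wedge_bot, Category.id_comp] at kappa_braiding
  rw [← kappa_braiding, Category.assoc, braiding_hom_leftUnitor, kappa_rightUnitor]

/-- Intermutation as an interchange of `∧` over `∨`. -/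
def intermutation : Interchange (veeMon (C := C)) wedgeMon where
  ζ A B A' B' := ck A B A' B'
  μ := wTop.hom
  Δ := wBot.hom
  ι := kappa
  ζ_natural f g f' g' := ck_natural f g f' g'
  ζ_associativity A B A' B' A'' B'' := ck_associativity A A' A'' B B' B''
  ζ_left_unitality := ck_left_unitality
  ζ_right_unitality := ck_right_unitality
  μ_associativity := wTop_associativity
  μ_left_unitality := kappa_left_unitality
  μ_right_unitality := kappa_right_unitality
  ζ_associator := ck_associator
  Δ_associator := wBot_associator
  ζ_leftUnitor := ck_leftUnitor
  Δ_leftUnitor := kappa_leftUnitor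
  ζ_rightUnitor := ck_rightUnitor
  Δ_rightUnitor := kappa_rightUnitor

/-- The two monoidal structures of an SMI category, in the order in which the reduced bar
construction uses them: `false` stands for `∨` and `true` for `∧`. -/
@[reducible] def monoidal (C : Type u) [Category.{v} C] [SMICategory C] :
    Bool → MonoidalCategory C
  | false => veeMon
  | true => wedgeMon

/-- The interchange of each of the two monoidal structures over an earlier or the same one. -/
def interchange (C : Type u) [Category.{v} C] [SMICategory C] :
    ∀ {b b' : Bool}, b ≤ b' → Interchange (monoidal C b) (monoidal C b')
  | false, false, _ => .ofSymmetric veeMon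
  | false, true, _ => intermutation
  | true, true, _ => .ofSymmetric wedgeMon
  | true, false, h => absurd h (by decide)

theorem interchange_compatible (C : Type u) [Category.{v} C] [SMICategory C] :
    ∀ {b b' b'' : Bool} (h : b ≤ b') (h' : b' ≤ b''),
      Interchange.Compatible (interchange C h) (interchange C (h.trans h')) (interchange C h')
  | false, false, false, _, _ => .ofSymmetric_self veeMon
  | false, false, true, _, _ =>
    letI := veeMon (C := C)
    .ofBraided_left intermutation braiding_vee_ck
      ((congrArg (· ≫ _) braiding_vee_top).trans (Category.id_comp _))
  | false, true, true, _, _ =>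
    .ofSymmetric_right intermutation braiding_wedge_ck
      ((congrArg (_ ≫ ·) braiding_wedge_bot).trans (Category.comp_id _))
  | true, true, true, _, _ => .ofSymmetric_self wedgeMon
  | true, false, _, h, _ => absurd h (by decide)
  | _, true, false, _, h => absurd h (by decide)

theorem isStrict_monoidal (C : Type u) [Category.{v} C] [StrictSMICategory C] :
    ∀ b : Bool, IsStrict (monoidal C b)
  | false => StrictSMICategory.vee_strict
  | true => StrictSMICategory.wedge_strict

end Intermuting

/-! ### Fibres of composites -/

section Fibres

variable {k l j : SimplexCategoryᵒᵖ}

theorem lt_dual_iff (f : k ⟶ l) (x : Fin (l.unop.len + 1)) (y : ℕ) :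
    (x : ℕ) < dual f y ↔ (f.unop.toOrderHom x : ℕ) < y := by
  have hmono {a b : Fin (l.unop.len + 1)} (h : a ≤ b) :
      (f.unop.toOrderHom a : ℕ) ≤ f.unop.toOrderHom b := f.unop.toOrderHom.monotone h
  constructor
  · intro hdual
    by_contra hx
    have hsub : (Finset.univ.filter fun z => (f.unop.toOrderHom z : ℕ) < y) ⊆ Finset.Iio x := by
      intro z hz
      by_contra hzx
      exact hx ((hmono (not_lt.mp fun h => hzx (Finset.mem_Iio.mpr h))).trans_lt
        (Finset.mem_filter.mp hz).2)
    exact absurd hdual (not_lt.mpr ((Finset.card_le_card hsub).trans_eq (Fin.card_Iio x)))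
  · intro hx
    have hsub : Finset.Iic x ⊆ Finset.univ.filter fun z => (f.unop.toOrderHom z : ℕ) < y :=
      fun z hz => Finset.mem_filter.mpr
        ⟨Finset.mem_univ _, (hmono (Finset.mem_Iic.mp hz)).trans_lt hx⟩
    exact (Fin.card_Iic x).symm.trans_le (Finset.card_le_card hsub)

theorem dual_monotone (f : k ⟶ l) : Monotone (dual f) := fun _ _ h =>
  Finset.card_le_card (Finset.monotone_filter_right _ fun _ _ hz => lt_of_lt_of_le hz h)

theorem dual_comp (f : k ⟶ l) (g : l ⟶ j) (y : ℕ) : dual (f ≫ g) y = dual g (dual f y) :=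
  congrArg Finset.card (Finset.filter_congr fun _ _ => (lt_dual_iff f _ y).symm)

theorem dual_zero (f : k ⟶ l) : dual f 0 = 0 := by simp [dual]

theorem dual_of_lt (f : k ⟶ l) {y : ℕ} (h : k.unop.len < y) : dual f y = l.unop.len + 1 := by
  rw [dual, Finset.filter_true_of_mem fun x _ =>
    lt_of_lt_of_le (f.unop.toOrderHom x).isLt h, Finset.card_univ, Fintype.card_fin]

theorem dual_id_apply {y : ℕ} (h : y ≤ k.unop.len) : dual (𝟙 k) y = y := by
  refine le_antisymm ?_ ?_
  · by_contra hy
    exact absurd ((lt_dual_iff (𝟙 k) ⟨y, Nat.lt_succ_of_le h⟩ y).mp (not_le.mp hy)) (lt_irrefl y)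
  · rcases y with _ | y
    · exact Nat.zero_le _
    · exact (lt_dual_iff (𝟙 k) ⟨y, by omega⟩ (y + 1)).mpr (Nat.lt_succ_self y)

theorem mem_fibre (f : k ⟶ l) (b : Fin l.unop.len) (a : Fin k.unop.len) :
    a ∈ fibre f b ↔ dual f (a + 1) = b + 1 := by
  simp [fibre]

theorem pairwise_lt_fibre (f : k ⟶ l) (b : Fin l.unop.len) : (fibre f b).Pairwise (· < ·) :=
  (List.pairwise_lt_finRange _).filter _

theorem fibre_comp (f : k ⟶ l) (g : l ⟶ j) (c : Fin j.unop.len) :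
    fibre (f ≫ g) c = (fibre g c).flatMap (fibre f) := by
  refine (pairwise_lt_fibre _ _).eq_of_mem_iff ?_ fun a => ?_
  · refine List.pairwise_flatMap.mpr ⟨fun b _ => pairwise_lt_fibre f b, ?_⟩
    refine (pairwise_lt_fibre g c).imp fun {b b'} hb x hx y hy => ?_
    rw [mem_fibre] at hx hy
    by_contra hxy
    have := dual_monotone f (Nat.succ_le_succ (not_lt.mp hxy))
    rw [Nat.succ_eq_add_one, Nat.succ_eq_add_one, hx, hy] at this
    exact absurd (Fin.lt_def.mp hb) (by omega)
  · rw [mem_fibre, dual_comp, List.mem_flatMap]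
    simp only [mem_fibre]
    constructor
    · intro h
      have h0 : dual f (a + 1) ≠ 0 := fun h' => by rw [h', dual_zero] at h; omega
      have h1 : ¬ l.unop.len < dual f (a + 1) := fun h' => by
        rw [dual_of_lt g h'] at h
        exact absurd c.isLt (by omega)
      refine ⟨⟨dual f (a + 1) - 1, by omega⟩, ?_, ?_⟩
      · rw [Nat.sub_add_cancel (Nat.pos_of_ne_zero h0), h]
      · exact (Nat.sub_add_cancel (Nat.pos_of_ne_zero h0)).symm
    · rintro ⟨b, hb, hab⟩
      rw [hab, hb]

theorem fibre_id (b : Fin k.unop.len) : fibre (𝟙 k) b = [b] := by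
  refine (pairwise_lt_fibre _ _).eq_of_mem_iff (List.pairwise_singleton _ _) fun a => ?_
  rw [mem_fibre, dual_id_apply a.isLt, List.mem_singleton, Fin.ext_iff]
  omega

end Fibres

/-! ### Currying -/

section Curry

variable {C : Type u} [Category.{v} C] {N : ℕ} {k l : Fin (N + 1) → SimplexCategoryᵒᵖ}

/-- The tail of a tuple of objects. -/
abbrev tailObj (k : Fin (N + 1) → SimplexCategoryᵒᵖ) : Fin N → SimplexCategoryᵒᵖ :=
  fun i => k i.succ

/-- The tail of a tuple of arrows. -/
abbrev tailHom (f : k ⟶ l) : tailObj k ⟶ tailObj l := fun i => f i.succ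

variable (C) in
/-- The power `C ^ (k₁ k₂ ⋯ k_N)` in its curried form `(C ^ (k₂ ⋯ k_N)) ^ k₁`. -/
abbrev CurriedPower (k : Fin (N + 1) → SimplexCategoryᵒᵖ) : Type u :=
  Fin (k 0).unop.len → MultiIndex (tailObj k) → C

/-- The componentwise monoidal structure of a curried power. -/
abbrev curriedMonoidal (S : MonoidalCategory C) (k : Fin (N + 1) → SimplexCategoryᵒᵖ) :
    MonoidalCategory (CurriedPower C k) :=
  piMonoidal (piMonoidal S (MultiIndex (tailObj k))) (Fin (k 0).unop.len)

/-- A functor between curried powers, regarded as a functor between powers. -/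
abbrev uncurried (F : CurriedPower C k ⥤ CurriedPower C l) :
    (MultiIndex k → C) ⥤ (MultiIndex l → C) :=
  curryPower C k ⋙ F ⋙ uncurryPower C l

/-- A natural transformation between functors of curried powers, regarded as one between functors of
powers. -/
def uncurriedTrans {F F' : CurriedPower C k ⥤ CurriedPower C l} (τ : F ⟶ F') :
    uncurried F ⟶ uncurried F' :=
  Functor.whiskerLeft (curryPower C k) (Functor.whiskerRight τ (uncurryPower C l))

variable {R S R' S' : MonoidalCategory C} {F F' : CurriedPower C k ⥤ CurriedPower C l}

/-- The lax monoidal structure on `uncurried`. -/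
@[reducible] def LaxStructure.uncurried
    (r : LaxStructure (curriedMonoidal S k) (curriedMonoidal S' l) F) :
    LaxStructure (piMonoidal S (MultiIndex k)) (piMonoidal S' (MultiIndex l)) (SMI.uncurried F) :=
  .ofTensorHom ((uncurryPower C l).map r.ε)
    (fun A B => (uncurryPower C l).map (r.μ ((curryPower C k).obj A) ((curryPower C k).obj B)))
    (fun f g => congrArg (uncurryPower C l).map
      (r.μ_natural ((curryPower C k).map f) ((curryPower C k).map g)))
    (fun A B X => congrArg (uncurryPower C l).map (r.associativity ((curryPower C k).obj A)
      ((curryPower C k).obj B) ((curryPower C k).obj X)))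
    (fun A => congrArg (uncurryPower C l).map (r.left_unitality ((curryPower C k).obj A)))
    (fun A => congrArg (uncurryPower C l).map (r.right_unitality ((curryPower C k).obj A)))

theorem IsDoubleLax.uncurried {a : Interchange R S} {a' : Interchange R' S'}
    {r : LaxStructure (curriedMonoidal R k) (curriedMonoidal R' l) F}
    {s : LaxStructure (curriedMonoidal S k) (curriedMonoidal S' l) F}
    (h : IsDoubleLax ((a.pi (MultiIndex (tailObj k))).pi _)
      ((a'.pi (MultiIndex (tailObj l))).pi _) r s) :
    IsDoubleLax (a.pi (MultiIndex k)) (a'.pi (MultiIndex l)) r.uncurried s.uncurried where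
  μ_μ A B A' B' := congrArg (uncurryPower C l).map (h.μ_μ ((curryPower C k).obj A)
    ((curryPower C k).obj B) ((curryPower C k).obj A') ((curryPower C k).obj B'))
  ε_μ := congrArg (uncurryPower C l).map h.ε_μ
  μ_ε := congrArg (uncurryPower C l).map h.μ_ε
  ε_ε := congrArg (uncurryPower C l).map h.ε_ε

theorem IsMonoidalTrans.uncurriedTrans
    {r : LaxStructure (curriedMonoidal S k) (curriedMonoidal S' l) F}
    {r' : LaxStructure (curriedMonoidal S k) (curriedMonoidal S' l) F'} {τ : F ⟶ F'}
    (h : IsMonoidalTrans r r' τ) :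
    IsMonoidalTrans r.uncurried r'.uncurried (SMI.uncurriedTrans τ) :=
  .of_ε_μ (congrArg (uncurryPower C l).map h.ε_app) fun A B => congrArg (uncurryPower C l).map
    (h.μ_app ((curryPower C k).obj A) ((curryPower C k).obj B))

/-- The projections onto the coordinates `r α`, compared with the identity when `r α = α`. -/
def reindexUnit {K : Type} {r : K → K} (h : ∀ α, r α = α) :
    Functor.pi' (fun α => Pi.eval (fun _ => C) (r α)) ⟶ 𝟭 (K → C) where
  app A α := eqToHom (congrArg A (h α))
  naturality A B f := funext fun α => by
    have naturality_of_eq {β} (hβ : β = α) :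
        f β ≫ eqToHom (congrArg B hβ) = eqToHom (congrArg A hβ) ≫ f α := by
      subst hβ
      simp
    exact naturality_of_eq (h α)

theorem isEqToHom_reindexUnit {K : Type} {r : K → K} (h : ∀ α, r α = α) (A : K → C) (α : K) :
    IsEqToHom ((reindexUnit h).app A α) :=
  ⟨congrArg A (h α), rfl⟩

theorem isMonoidalTrans_reindexUnit {K : Type} {r : K → K} (h : ∀ α, r α = α) :
    IsMonoidalTrans (LaxStructure.pi' fun α => LaxStructure.eval S (r α))
      (LaxStructure.id (piMonoidal S K)) (reindexUnit h) := by
  obtain rfl : r = id := funext h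
  exact .of_ε_μ (funext fun _ => Category.id_comp (𝟙 _)) fun A B => funext fun α =>
    (Category.id_comp (𝟙 _)).trans
      ((Category.comp_id _).trans (tensorHom_id_id S (A α) (B α))).symm

end Curry

/-! ### The iterated reduced bar construction -/

section Iteration

variable {C : Type u} [Category.{v} C] [StrictSMICategory C]

variable (C) in
/-- The reduced bar construction iterated along `∨` for the coordinates `i` with `κ i = false` and
along `∧` for those with `κ i = true`. -/
abbrev mixedBar {N : ℕ} (κ : Fin N → Bool) {k l : Fin N → SimplexCategoryᵒᵖ} (f : k ⟶ l) :
    (MultiIndex k → C) ⥤ (MultiIndex l → C) :=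
  iteratedBar C (fun i => monoidal C (κ i)) f

/-- The lax monoidal structure on `mixedBar` for a monoidal structure that every tensor product of
the iteration interchanges with. -/
@[reducible] def LaxStructure.mixedBar (b : Bool) : ∀ {N : ℕ} {κ : Fin N → Bool} (_ : ∀ i, b ≤ κ i)
    {k l : Fin N → SimplexCategoryᵒᵖ} (f : k ⟶ l),
    LaxStructure (piMonoidal (monoidal C b) (MultiIndex k))
      (piMonoidal (monoidal C b) (MultiIndex l)) (mixedBar C κ f)
  | 0, _, _, k, l, _ => LaxStructure.pi' fun _ : MultiIndex l =>
    LaxStructure.eval (monoidal C b) (fun i : Fin 0 => i.elim0 : MultiIndex k)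
  | _ + 1, _, h, _, _, f => LaxStructure.uncurried (LaxStructure.step
    ((interchange C (h 0)).pi _) (LaxStructure.mixedBar b (fun i => h i.succ) (tailHom f))
      (fibre (f 0)))

theorem IsDoubleLax.mixedBar {b b' : Bool} (hb : b ≤ b') : ∀ {N : ℕ} {κ : Fin N → Bool}
    (h : ∀ i, b ≤ κ i) (h' : ∀ i, b' ≤ κ i) {k l : Fin N → SimplexCategoryᵒᵖ} (f : k ⟶ l),
    IsDoubleLax ((interchange C hb).pi (MultiIndex k)) ((interchange C hb).pi (MultiIndex l))
      (LaxStructure.mixedBar b h f) (LaxStructure.mixedBar b' h' f)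
  | 0, _, _, _, k, l, _ => IsDoubleLax.pi' fun _ : MultiIndex l =>
    IsDoubleLax.eval (interchange C hb) (fun i : Fin 0 => i.elim0 : MultiIndex k)
  | _ + 1, _, h, h', _, _, f => IsDoubleLax.uncurried (IsDoubleLax.step
    ((interchange_compatible C hb (h' 0)).pi _)
    (IsDoubleLax.mixedBar hb (fun i => h i.succ) (fun i => h' i.succ) (tailHom f)) (fibre (f 0)))

theorem fibre_eq_flatMap {k l j : SimplexCategoryᵒᵖ} {f : k ⟶ l} {g : l ⟶ j} {m : k ⟶ j}
    (h : f ≫ g = m) (c : Fin j.unop.len) : fibre m c = (fibre g c).flatMap (fibre f) := by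
  rw [← h, fibre_comp]

theorem monotone_tail {N : ℕ} {κ : Fin (N + 1) → Bool} (hκ : Monotone κ) :
    Monotone fun i : Fin N => κ i.succ :=
  fun _ _ h => hκ (Fin.succ_le_succ_iff.mpr h)

/-- The comparison of a composite of two functors `mixedBar` with the functor of the composite. -/
def barComparison : ∀ {N : ℕ} {κ : Fin N → Bool} (_ : Monotone κ)
    {k l j : Fin N → SimplexCategoryᵒᵖ} {f : k ⟶ l} {g : l ⟶ j} {m : k ⟶ j} (_ : f ≫ g = m),
    mixedBar C κ f ⋙ mixedBar C κ g ⟶ mixedBar C κ m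
  | 0, _, _, _, _, _, _, _, _, _ => 𝟙 _
  | _ + 1, κ, hκ, k, _, _, f, g, m, h => uncurriedTrans (stepComparison
    (S := piMonoidal (monoidal C (κ 0)) (MultiIndex (tailObj k)))
    (LaxStructure.mixedBar (κ 0) (fun i => hκ (Fin.zero_le i.succ)) (tailHom f))
    (barComparison (monotone_tail hκ) (f := tailHom f) (g := tailHom g) (m := tailHom m)
      (funext fun i => congrFun h i.succ))
    (fibre_eq_flatMap (congrFun h 0)))

theorem isMonoidalTrans_barComparison (b : Bool) : ∀ {N : ℕ} {κ : Fin N → Bool} (hκ : Monotone κ)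
    (hb : ∀ i, b ≤ κ i) {k l j : Fin N → SimplexCategoryᵒᵖ} {f : k ⟶ l} {g : l ⟶ j} {m : k ⟶ j}
    (h : f ≫ g = m),
    IsMonoidalTrans ((LaxStructure.mixedBar b hb f).comp (LaxStructure.mixedBar b hb g))
      (LaxStructure.mixedBar b hb m) (barComparison (C := C) hκ h)
  | 0, _, _, _, _, _, _, _, _, _, _ =>
    .of_ε_μ (funext fun _ => (Category.comp_id _).trans (Category.id_comp (𝟙 _)))
      fun A B => funext fun _ => by
        change (𝟙 _ ≫ 𝟙 _) ≫ 𝟙 _ = (𝟙 _ ⊗ₘ[monoidal C b] 𝟙 _) ≫ 𝟙 _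
        simp
  | _ + 1, κ, hκ, hb, _, _, _, f, _, _, _ =>
    IsMonoidalTrans.uncurriedTrans (isMonoidalTrans_stepComparison
      (IsDoubleLax.mixedBar (hb 0) _ (fun i => hκ (Fin.zero_le i.succ)) (tailHom f))
      (isMonoidalTrans_barComparison b _ _ _) _)

theorem barComparison_assoc : ∀ {N : ℕ} {κ : Fin N → Bool} (hκ : Monotone κ)
    {k l j i : Fin N → SimplexCategoryᵒᵖ} {f : k ⟶ l} {g : l ⟶ j} {h : j ⟶ i} {fg : k ⟶ j}
    {gh : l ⟶ i} {m : k ⟶ i} (h₁₂ : f ≫ g = fg) (h₂₃ : g ≫ h = gh) (e₁₂ : fg ≫ h = m)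
    (e₂₃ : f ≫ gh = m) (A : MultiIndex k → C),
    (mixedBar C κ h).map ((barComparison hκ h₁₂).app A) ≫ (barComparison hκ e₁₂).app A =
      (barComparison hκ h₂₃).app ((mixedBar C κ f).obj A) ≫ (barComparison hκ e₂₃).app A
  | 0, _, _, _, _, _, _, _, _, _, _, _, _, _, _, _, _, _ => rfl
  | _ + 1, κ, _, k, _, _, i, _, _, _, _, _, _, _, _, _, _, A =>
    congrArg (uncurryPower C i).map (stepComparison_assoc ((isStrict_monoidal C (κ 0)).pi _)
      (isMonoidalTrans_barComparison (κ 0) _ _ _) (barComparison_assoc _ _ _ _ _) _ _ _ _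
      ((curryPower C k).obj A))

theorem fibre_eq_singleton {k : SimplexCategoryᵒᵖ} {f : k ⟶ k} (h : f = 𝟙 k)
    (b : Fin k.unop.len) : fibre f b = [b] := by
  rw [h, fibre_id]

/-- The comparison of the functor of an identity with the identity functor. -/
def barUnit : ∀ {N : ℕ} (κ : Fin N → Bool) {k : Fin N → SimplexCategoryᵒᵖ} {f : k ⟶ k}
    (_ : f = 𝟙 k), mixedBar C κ f ⟶ 𝟭 (MultiIndex k → C)
  | 0, _, _, _, _ => reindexUnit fun _ => funext fun i : Fin 0 => i.elim0
  | _ + 1, κ, k, f, h =>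
    uncurriedTrans (stepUnit (piMonoidal (monoidal C (κ 0)) (MultiIndex (tailObj k)))
      (barUnit (fun i => κ i.succ) (f := tailHom f) (funext fun i => congrFun h i.succ))
      (fibre_eq_singleton (congrFun h 0))) ≫ reindexUnit Fin.cons_self_tail

theorem isEqToHom_barUnit : ∀ {N : ℕ} (κ : Fin N → Bool) {k : Fin N → SimplexCategoryᵒᵖ}
    {f : k ⟶ k} (h : f = 𝟙 k) (A : MultiIndex k → C), IsEqToHom ((barUnit κ h).app A)
  | 0, _, _, _, _, A => IsEqToHom.pi fun α => isEqToHom_reindexUnit _ A α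
  | _ + 1, κ, k, _, _, A => IsEqToHom.pi fun α =>
    (((((isStrict_monoidal C (κ 0)).pi _).isEqToHom_stepUnit (isEqToHom_barUnit _ _) _
      ((curryPower C k).obj A)).apply (α 0)).apply fun i => α i.succ).comp
        (isEqToHom_reindexUnit _ A α)

theorem isMonoidalTrans_barUnit (b : Bool) : ∀ {N : ℕ} {κ : Fin N → Bool} (hb : ∀ i, b ≤ κ i)
    {k : Fin N → SimplexCategoryᵒᵖ} {f : k ⟶ k} (h : f = 𝟙 k),
    IsMonoidalTrans (LaxStructure.mixedBar (C := C) b hb f)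
      (LaxStructure.id (piMonoidal (monoidal C b) (MultiIndex k))) (barUnit κ h)
  | 0, _, _, _, _, _ => isMonoidalTrans_reindexUnit _
  | _ + 1, _, hb, _, _, h =>
    (isMonoidalTrans_stepUnit ((interchange C (hb 0)).pi _)
      (isMonoidalTrans_barUnit b (fun i => hb i.succ) (funext fun i => congrFun h i.succ))
      (fibre_eq_singleton (congrFun h 0))).uncurriedTrans.comp
        (isMonoidalTrans_reindexUnit Fin.cons_self_tail)

/-! ### Comparisons that are identities -/

theorem isEqToHom_barComparison_succ {N : ℕ} {κ : Fin (N + 1) → Bool} (hκ : Monotone κ)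
    {k l j : Fin (N + 1) → SimplexCategoryᵒᵖ} {f : k ⟶ l} {g : l ⟶ j} {m : k ⟶ j} (h : f ≫ g = m)
    (hω : ∀ B : MultiIndex (tailObj k) → C, IsEqToHom ((barComparison (monotone_tail hκ)
      (f := tailHom f) (g := tailHom g) (m := tailHom m)
      (funext fun i => congrFun h i.succ)).app B))
    (hμ : ∀ (B : Fin (l 0).unop.len → MultiIndex (tailObj k) → C) (b : Fin (j 0).unop.len),
      IsEqToHom (((LaxStructure.mixedBar (κ 0) (fun i => hκ (Fin.zero_le i.succ))
        (tailHom f)).listμ (fibre (g 0) b)).app B)) (A : MultiIndex k → C) :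
    IsEqToHom ((barComparison hκ h).app A) :=
  IsEqToHom.pi fun α => ((((isStrict_monoidal C (κ 0)).pi _).isEqToHom_stepComparison hω _
    ((curryPower C k).obj A) fun b => hμ _ b).apply (α 0)).apply fun i => α i.succ

theorem isEqToHom_barComparison_zero {κ : Fin 0 → Bool} (hκ : Monotone κ)
    {k l j : Fin 0 → SimplexCategoryᵒᵖ} {f : k ⟶ l} {g : l ⟶ j} {m : k ⟶ j} (h : f ≫ g = m)
    (A : MultiIndex k → C) : IsEqToHom ((barComparison hκ h).app A) :=
  IsEqToHom.pi fun _ => IsEqToHom.id _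

theorem isEqToHom_barComparison_id_left : ∀ {N : ℕ} {κ : Fin N → Bool} (hκ : Monotone κ)
    {k j : Fin N → SimplexCategoryᵒᵖ} {f : k ⟶ k} {g m : k ⟶ j} (_ : f = 𝟙 k) (h : f ≫ g = m)
    (A : MultiIndex k → C), IsEqToHom ((barComparison hκ h).app A)
  | 0, _, hκ, _, _, _, _, _, _, h => isEqToHom_barComparison_zero hκ h
  | _ + 1, κ, hκ, _, _, _, _, _, hf, h =>
    have hf' := funext fun i => congrFun hf (Fin.succ i)
    isEqToHom_barComparison_succ hκ h (isEqToHom_barComparison_id_left _ hf' _) fun B _ =>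
      (isMonoidalTrans_barUnit (κ 0) _ hf').isEqToHom_listμ (isEqToHom_barUnit _ hf') B _

theorem isEqToHom_barComparison_id_right : ∀ {N : ℕ} {κ : Fin N → Bool} (hκ : Monotone κ)
    {k j : Fin N → SimplexCategoryᵒᵖ} {g : j ⟶ j} {f m : k ⟶ j} (_ : g = 𝟙 j) (h : f ≫ g = m)
    (A : MultiIndex k → C), IsEqToHom ((barComparison hκ h).app A)
  | 0, _, hκ, _, _, _, _, _, _, h => isEqToHom_barComparison_zero hκ h
  | _ + 1, κ, hκ, _, _, _, _, _, hg, h =>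
    isEqToHom_barComparison_succ hκ h
      (isEqToHom_barComparison_id_right _ (funext fun i => congrFun hg i.succ) _) fun B b => by
        rw [fibre_eq_singleton (congrFun hg 0)]
        exact ((isStrict_monoidal C (κ 0)).pi _).isEqToHom_listμ_singleton
          ((isStrict_monoidal C (κ 0)).pi _) _ B b

theorem isEqToHom_listμ_mixedBar_zero (b : Bool) {κ : Fin 0 → Bool} (h : ∀ i, b ≤ κ i)
    {k l : Fin 0 → SimplexCategoryᵒᵖ} (f : k ⟶ l) {ι : Type} (A : ι → MultiIndex k → C)
    (L : List ι) : IsEqToHom (((LaxStructure.mixedBar b h f).listμ L).app A) :=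
  isEqToHom_listμ (IsEqToHom.pi fun _ => IsEqToHom.id (monoidal C b).tensorUnit)
    (fun A B => IsEqToHom.pi fun _ => IsEqToHom.id (A _ ⊗[monoidal C b] B _)) A L

theorem isEqToHom_barComparison_of_le_one : ∀ {N : ℕ} (_ : N ≤ 1) {κ : Fin N → Bool}
    (hκ : Monotone κ) {k l j : Fin N → SimplexCategoryᵒᵖ} {f : k ⟶ l} {g : l ⟶ j} {m : k ⟶ j}
    (h : f ≫ g = m) (A : MultiIndex k → C), IsEqToHom ((barComparison hκ h).app A)
  | 0, _, _, hκ, _, _, _, _, _, _, h => isEqToHom_barComparison_zero hκ h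
  | 1, _, _, hκ, _, _, _, _, _, _, h =>
    isEqToHom_barComparison_succ hκ h (isEqToHom_barComparison_zero _ _)
      fun B _ => isEqToHom_listμ_mixedBar_zero _ _ _ B _

end Iteration

/-! ### The lax functor -/

section LaxFunctors

theorem exists_natTrans_eq_eqToHom {D : Type u} [Category.{v} D] {E : Type u} [Category.{v} E]
    {F G : D ⥤ E} {η : F ⟶ G} (h : ∀ A, IsEqToHom (η.app A)) : ∃ e : F = G, η = eqToHom e := by
  have e : F = G := by
    refine CategoryTheory.Functor.ext (fun A => (h A).1) fun A B f => ?_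
    obtain ⟨eA, hA⟩ := h A
    obtain ⟨eB, hB⟩ := h B
    have naturality := η.naturality f
    rw [hA, hB] at naturality
    rw [← reassoc_of% naturality, eqToHom_trans, eqToHom_refl, Category.comp_id]
  subst e
  exact ⟨rfl, NatTrans.ext (funext fun A => (h A).ext (IsEqToHom.id _))⟩

variable (C : Type u) [Category.{v} C]

/-- The objects and the arrows of an iterated reduced bar construction. -/
def barPrelax {N : ℕ} (T : Fin N → MonoidalCategory C) :
    PrelaxFunctor (LocallyDiscrete (Fin N → SimplexCategoryᵒᵖ)) Cat.{v, u} where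
  obj k := Cat.of (MultiIndex k.as → C)
  map f := (iteratedBar C T f.as).toCatHom
  map₂ η := eqToHom (by rw [LocallyDiscrete.eq_of_hom η])
  map₂_id _ := rfl
  map₂_comp _ _ := (eqToHom_trans _ _).symm

theorem barPrelax_map₂_self {N : ℕ} (T : Fin N → MonoidalCategory C)
    {k l : LocallyDiscrete (Fin N → SimplexCategoryᵒᵖ)} {f : k ⟶ l} (η : f ⟶ f) :
    (barPrelax C T).map₂ η = 𝟙 _ := rfl

theorem isEqToHom_barPrelax_map₂_app {N : ℕ} (T : Fin N → MonoidalCategory C)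
    {k l : LocallyDiscrete (Fin N → SimplexCategoryᵒᵖ)} {f g : k ⟶ l} (η : f ⟶ g)
    (A : MultiIndex k.as → C) : IsEqToHom (((barPrelax C T).map₂ η).toNatTrans.app A) := by
  obtain rfl := LocallyDiscrete.eq_of_hom η
  exact IsEqToHom.id _

theorem isEqToHom_eqToHom_toNatTrans_app {D E : Cat.{v, u}} {F G : D ⟶ E} (h : F = G) (A : D) :
    IsEqToHom ((eqToHom h).toNatTrans.app A) := by
  subst h
  exact IsEqToHom.id _

variable {C} [StrictSMICategory C] {N : ℕ} {κ : Fin N → Bool}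

theorem mixedBar_id (κ : Fin N → Bool) (k : Fin N → SimplexCategoryᵒᵖ) :
    mixedBar C κ (𝟙 k) = 𝟭 (MultiIndex k → C) :=
  (exists_natTrans_eq_eqToHom (isEqToHom_barUnit κ rfl)).1

theorem isEqToHom_eqToHom_mixedBar_id_app (κ : Fin N → Bool) (k : Fin N → SimplexCategoryᵒᵖ)
    (h : 𝟙 (Cat.of (MultiIndex k → C)) = (mixedBar C κ (𝟙 k)).toCatHom) (A : MultiIndex k → C) :
    IsEqToHom (D := MultiIndex k → C) ((eqToHom h).toNatTrans.app A) :=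
  isEqToHom_eqToHom_toNatTrans_app (D := Cat.of (MultiIndex k → C)) h A

theorem barComparison_app_comp_eqToHom (hκ : Monotone κ) {k l j : Fin N → SimplexCategoryᵒᵖ}
    {f : k ⟶ l} {g : l ⟶ j} {m m' : k ⟶ j} (h : f ≫ g = m) (h' : f ≫ g = m')
    (A : MultiIndex k → C) (e : (mixedBar C κ m).obj A = (mixedBar C κ m').obj A) :
    (barComparison hκ h).app A ≫ eqToHom e = (barComparison hκ h').app A := by
  subst h h'
  exact Category.comp_id _

variable (C) in
/-- The iterated reduced bar construction as a lax functor. -/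
def barLaxFunctor (hκ : Monotone κ) :
    LaxFunctor (LocallyDiscrete (Fin N → SimplexCategoryᵒᵖ)) Cat.{v, u} where
  toPrelaxFunctor := barPrelax C fun i => monoidal C (κ i)
  mapId k := eqToHom (Cat.ext (mixedBar_id κ k.as).symm)
  mapComp f g := (barComparison hκ (f := f.as) (g := g.as) rfl).toCatHom₂
  mapComp_naturality_left η g := by
    obtain rfl := LocallyDiscrete.eq_of_hom η
    rw [barPrelax_map₂_self, barPrelax_map₂_self, Bicategory.id_whiskerRight]
    exact (Category.comp_id _).trans (Category.id_comp _).symm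
  mapComp_naturality_right f g g' η := by
    obtain rfl := LocallyDiscrete.eq_of_hom η
    rw [barPrelax_map₂_self, barPrelax_map₂_self, Bicategory.whiskerLeft_id]
    exact (Category.comp_id _).trans (Category.id_comp _).symm
  map₂_associator f g h := by
    refine Cat.Hom₂.ext (NatTrans.ext (funext fun A => ?_))
    obtain ⟨e, he⟩ := isEqToHom_barPrelax_map₂_app C (fun i => monoidal C (κ i))
      (Bicategory.associator f g h).hom A
    change (mixedBar C κ h.as).map ((barComparison hκ rfl).app A) ≫
        (barComparison hκ rfl).app A ≫ ((barPrelax C fun i => monoidal C (κ i)).map₂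
          (Bicategory.associator f g h).hom).toNatTrans.app A =
      𝟙 _ ≫ (barComparison hκ rfl).app ((mixedBar C κ f.as).obj A) ≫
        (barComparison hκ rfl).app A
    rw [he]
    refine (congrArg (_ ≫ ·)
      (barComparison_app_comp_eqToHom hκ rfl (Category.assoc _ _ _) A e)).trans ?_
    exact (barComparison_assoc hκ rfl rfl _ rfl A).trans (Category.id_comp _).symm
  map₂_leftUnitor {k l} f := by
    refine Cat.Hom₂.ext (NatTrans.ext (funext fun A => ?_))
    refine (isEqToHom_barPrelax_map₂_app C _ _ A).ext
      ((IsEqToHom.id _).comp (IsEqToHom.comp ?_ ?_))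
    · exact (isEqToHom_eqToHom_mixedBar_id_app κ k.as _ A).map (mixedBar C κ f.as)
    · exact isEqToHom_barComparison_id_left hκ rfl rfl A
  map₂_rightUnitor {k l} f := by
    refine Cat.Hom₂.ext (NatTrans.ext (funext fun A => ?_))
    refine (isEqToHom_barPrelax_map₂_app C _ _ A).ext
      ((IsEqToHom.id _).comp (IsEqToHom.comp ?_ ?_))
    · exact isEqToHom_eqToHom_mixedBar_id_app κ l.as _ ((mixedBar C κ f.as).obj A)
    · exact isEqToHom_barComparison_id_right hκ rfl rfl A

theorem barLaxFunctor_mapComp_eq_eqToHom (hN : N ≤ 1) (hκ : Monotone κ)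
    {k l j : LocallyDiscrete (Fin N → SimplexCategoryᵒᵖ)} (f : k ⟶ l) (g : l ⟶ j) :
    ∃ h, (barLaxFunctor C hκ).mapComp f g = eqToHom h := by
  obtain ⟨e, he⟩ := exists_natTrans_eq_eqToHom
    (isEqToHom_barComparison_of_le_one (C := C) hN hκ (rfl : f.as ≫ g.as = _))
  refine ⟨Cat.ext e, Cat.Hom₂.ext ?_⟩
  rw [Cat.Hom₂.eqToHom_toNatTrans]
  exact he

end LaxFunctors

/-! ### Classes of families of arrows -/

section ArrowClasses

universe w

variable {I : Type w}

/-- A class of families of arrows, in a family of categories, that is closed under composition. -/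
structure ArrowClass (D : I → Type u) [∀ i, Category.{v} (D i)] where
  /-- the families of objects in the class -/
  obj : (∀ i, D i) → Prop
  /-- the families of arrows in the class -/
  hom : ∀ {X Y : ∀ i, D i}, (∀ i, X i ⟶ Y i) → Prop
  id_mem : ∀ {X : ∀ i, D i}, obj X → hom fun i => 𝟙 (X i)
  comp_mem : ∀ {X Y Z : ∀ i, D i} {f : ∀ i, X i ⟶ Y i} {g : ∀ i, Y i ⟶ Z i}, hom f → hom g →
    hom fun i => f i ≫ g i

variable {D : I → Type u} [∀ i, Category.{v} (D i)] {E : I → Type u} [∀ i, Category.{v} (E i)]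
  {G : I → Type u} [∀ i, Category.{v} (G i)]

/-- The families of arrows in a power whose coordinates are in a given class. -/
def ArrowClass.pi (K : Type) (P : ArrowClass D) : ArrowClass fun i => K → D i where
  obj X := ∀ a, P.obj fun i => X i a
  hom f := ∀ a, P.hom fun i => f i a
  id_mem h a := P.id_mem (h a)
  comp_mem hf hg a := P.comp_mem (hf a) (hg a)

/-- The class is closed under the operations of a family of monoidal structures. -/
structure ContainsMonoidal (P : ArrowClass D) (S : ∀ i, MonoidalCategory (D i)) : Prop where
  tensorUnit : P.obj fun i => (S i).tensorUnit
  tensorObj : ∀ {A B : ∀ i, D i}, P.obj A → P.obj B → P.obj fun i => A i ⊗[S i] B i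
  tensorHom : ∀ {A A' B B' : ∀ i, D i} {f : ∀ i, A i ⟶ A' i} {g : ∀ i, B i ⟶ B' i},
    P.hom f → P.hom g → P.hom fun i => f i ⊗ₘ[S i] g i
  associator : ∀ {A B X : ∀ i, D i}, P.obj A → P.obj B → P.obj X →
    P.hom fun i => ((S i).associator (A i) (B i) (X i)).hom
  leftUnitor : ∀ {A : ∀ i, D i}, P.obj A → P.hom fun i => ((S i).leftUnitor (A i)).hom

/-- The class contains the arrows of a family of interchanges. -/
structure ContainsInterchange (P : ArrowClass D) {S T : ∀ i, MonoidalCategory (D i)}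
    (a : ∀ i, Interchange (S i) (T i)) : Prop where
  ζ : ∀ {A B A' B' : ∀ i, D i}, P.obj A → P.obj B → P.obj A' → P.obj B' →
    P.hom fun i => (a i).ζ (A i) (B i) (A' i) (B' i)
  μ : P.hom fun i => (a i).μ
  Δ : P.hom fun i => (a i).Δ
  ι : P.hom fun i => (a i).ι

/-- The family of functors maps the first class to the second one. -/
structure MapsClass (P : ArrowClass D) (Q : ArrowClass E) (F : ∀ i, D i ⥤ E i) : Prop where
  obj : ∀ {A : ∀ i, D i}, P.obj A → Q.obj fun i => (F i).obj (A i)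
  map : ∀ {A B : ∀ i, D i} {f : ∀ i, A i ⟶ B i}, P.hom f → Q.hom fun i => (F i).map (f i)

/-- The second class contains the arrows of a family of lax monoidal structures, taken at objects
of the first one. -/
structure ContainsLax (P : ArrowClass D) (Q : ArrowClass E) {S : ∀ i, MonoidalCategory (D i)}
    {S' : ∀ i, MonoidalCategory (E i)} {F : ∀ i, D i ⥤ E i}
    (l : ∀ i, LaxStructure (S i) (S' i) (F i)) : Prop where
  ε : Q.hom fun i => (l i).ε
  μ : ∀ {A B : ∀ i, D i}, P.obj A → P.obj B → Q.hom fun i => (l i).μ (A i) (B i)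

variable {P : ArrowClass D} {Q : ArrowClass E} {R : ArrowClass G}
  {S T : ∀ i, MonoidalCategory (D i)} {S' : ∀ i, MonoidalCategory (E i)}
  {S'' : ∀ i, MonoidalCategory (G i)} {F : ∀ i, D i ⥤ E i} {F' : ∀ i, E i ⥤ G i}
  {F'' : ∀ i, D i ⥤ G i} {ι κ κ' : Type}

theorem ContainsMonoidal.pi (K : Type) (h : ContainsMonoidal P S) :
    ContainsMonoidal (P.pi K) fun i => piMonoidal (S i) K where
  tensorUnit _ := h.tensorUnit
  tensorObj hA hB a := h.tensorObj (hA a) (hB a)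
  tensorHom hf hg a := h.tensorHom (hf a) (hg a)
  associator hA hB hX a := h.associator (hA a) (hB a) (hX a)
  leftUnitor hA a := h.leftUnitor (hA a)

theorem ContainsInterchange.pi (K : Type) {a : ∀ i, Interchange (S i) (T i)}
    (h : ContainsInterchange P a) : ContainsInterchange (P.pi K) fun i => (a i).pi K where
  ζ hA hB hA' hB' k := h.ζ (hA k) (hB k) (hA' k) (hB' k)
  μ _ := h.μ
  Δ _ := h.Δ
  ι _ := h.ι

theorem MapsClass.comp (h : MapsClass P Q F) (h' : MapsClass Q R F') :
    MapsClass P R fun i => F i ⋙ F' i where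
  obj hA := h'.obj (h.obj hA)
  map hf := h'.map (h.map hf)

theorem MapsClass.pi (K : Type) (h : MapsClass P Q F) :
    MapsClass (P.pi K) (Q.pi K) fun i => powFunctor K (F i) where
  obj hA a := h.obj (hA a)
  map hf a := h.map (hf a)

theorem ContainsLax.pi (K : Type) {l : ∀ i, LaxStructure (S i) (S' i) (F i)}
    (h : ContainsLax P Q l) : ContainsLax (P.pi K) (Q.pi K) fun i => (l i).pi K where
  ε _ := h.ε
  μ hA hB a := h.μ (hA a) (hB a)

theorem ContainsLax.comp {l : ∀ i, LaxStructure (S i) (S' i) (F i)}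
    {m : ∀ i, LaxStructure (S' i) (S'' i) (F' i)} (hF : MapsClass P Q F) (hF' : MapsClass Q R F')
    (h : ContainsLax P Q l) (h' : ContainsLax Q R m) :
    ContainsLax P R fun i => (l i).comp (m i) where
  ε := R.comp_mem h'.ε (hF'.map h.ε)
  μ hA hB := R.comp_mem (h'.μ (hF.obj hA) (hF.obj hB)) (hF'.map (h.μ hA hB))

theorem mapsClass_listTensor (h : ContainsMonoidal P S) :
    ∀ L : List ι, MapsClass (P.pi ι) P fun i => listTensor (S i) L
  | [] => ⟨fun _ => h.tensorUnit, fun _ => P.id_mem h.tensorUnit⟩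
  | a :: L => ⟨fun hA => h.tensorObj (hA a) ((mapsClass_listTensor h L).obj hA),
      fun hf => h.tensorHom (hf a) ((mapsClass_listTensor h L).map hf)⟩

theorem mapsClass_listBar (h : ContainsMonoidal P S) (ℓ : κ → List ι) :
    MapsClass (P.pi ι) (P.pi κ) fun i => listBar (S i) ℓ where
  obj hA a := (mapsClass_listTensor h (ℓ a)).obj hA
  map hf a := (mapsClass_listTensor h (ℓ a)).map hf

section Lax

variable {a : ∀ i, Interchange (S i) (T i)} (hS : ContainsMonoidal P S)
  (hT : ContainsMonoidal P T) (h : ContainsInterchange P a)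

include hS hT h

theorem containsLax_listTensor :
    ∀ L : List ι, ContainsLax (P.pi ι) P fun i => LaxStructure.listTensor (a i) L
  | [] => ⟨h.ι, fun _ _ => h.μ⟩
  | c :: L =>
    ⟨P.comp_mem h.Δ (hT.tensorHom (P.id_mem hS.tensorUnit) (containsLax_listTensor L).ε),
      fun hA hB => P.comp_mem
        (h.ζ (hA c) ((mapsClass_listTensor hT L).obj hA) (hB c)
          ((mapsClass_listTensor hT L).obj hB))
        (hT.tensorHom (P.id_mem (hS.tensorObj (hA c) (hB c)))
          ((containsLax_listTensor L).μ hA hB))⟩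

theorem containsLax_step {l : ∀ i, LaxStructure (S i) (S' i) (F i)} (hF : MapsClass P Q F)
    (hl : ContainsLax P Q l) (ℓ : κ → List ι) :
    ContainsLax (P.pi ι) (Q.pi κ) fun i => LaxStructure.step (a i) (l i) ℓ :=
  ContainsLax.comp (l := fun i => LaxStructure.listBar (a i) ℓ) (mapsClass_listBar hT ℓ)
    (hF.pi κ)
    ⟨fun c => (containsLax_listTensor hS hT h (ℓ c)).ε,
      fun hA hB c => (containsLax_listTensor hS hT h (ℓ c)).μ hA hB⟩
    (hl.pi κ)

end Lax

theorem appendHom_mem (h : ContainsMonoidal P S) {A : ∀ i, ι → D i} (hA : (P.pi ι).obj A) :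
    ∀ L L' : List ι, P.hom fun i => (appendHom (S i) L L').app (A i)
  | [], L' => h.leftUnitor ((mapsClass_listTensor h L').obj hA)
  | a :: L, L' => P.comp_mem
      (h.associator (hA a) ((mapsClass_listTensor h L).obj hA)
        ((mapsClass_listTensor h L').obj hA))
      (h.tensorHom (P.id_mem (hA a)) (appendHom_mem h hA L L'))

theorem flatMapHom_mem (h : ContainsMonoidal P S) (ℓ : κ → List ι) {A : ∀ i, ι → D i}
    (hA : (P.pi ι).obj A) : ∀ K : List κ, P.hom fun i => (flatMapHom (S i) ℓ K).app (A i)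
  | [] => P.id_mem h.tensorUnit
  | a :: K => P.comp_mem
      (h.tensorHom (P.id_mem ((mapsClass_listTensor h (ℓ a)).obj hA)) (flatMapHom_mem h ℓ hA K))
      (appendHom_mem h hA (ℓ a) (K.flatMap ℓ))

theorem flatMapComparison_mem (h : ContainsMonoidal P S) (ℓ : κ → List ι) {K : List κ}
    {L : List ι} (e : L = K.flatMap ℓ) {A : ∀ i, ι → D i} (hA : (P.pi ι).obj A) :
    P.hom fun i => (flatMapComparison (S i) ℓ e).app (A i) := by
  subst e
  simp only [flatMapComparison_rfl]
  exact flatMapHom_mem h ℓ hA K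

theorem listμ_mem {l : ∀ i, LaxStructure (S i) (S' i) (F i)} (hS : ContainsMonoidal P S)
    (hS' : ContainsMonoidal Q S') (hF : MapsClass P Q F) (hl : ContainsLax P Q l)
    {A : ∀ i, ι → D i} (hA : (P.pi ι).obj A) :
    ∀ L : List ι, Q.hom fun i => ((l i).listμ L).app (A i)
  | [] => hl.ε
  | a :: L => Q.comp_mem
      (hS'.tensorHom (Q.id_mem (hF.obj (hA a))) (listμ_mem hS hS' hF hl hA L))
      (hl.μ (hA a) ((mapsClass_listTensor hS L).obj hA))

theorem stepComparison_mem {l : ∀ i, LaxStructure (S i) (S' i) (F i)}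
    {ω : ∀ i, F i ⋙ F' i ⟶ F'' i} (hS : ContainsMonoidal P S) (hS' : ContainsMonoidal Q S')
    (hF : MapsClass P Q F) (hF' : MapsClass Q R F') (hF'' : MapsClass P R F'')
    (hl : ContainsLax P Q l)
    (hω : ∀ {A : ∀ i, D i}, P.obj A → R.hom fun i => (ω i).app (A i)) {ℓ : κ → List ι}
    {ℓ' : κ' → List κ} {ℓ'' : κ' → List ι} (h : ∀ c, ℓ'' c = (ℓ' c).flatMap ℓ)
    {A : ∀ i, ι → D i} (hA : (P.pi ι).obj A) :
    (R.pi κ').hom fun i => (stepComparison (l i) (ω i) h).app (A i) := fun c =>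
  have hB := (mapsClass_listBar hS ℓ).obj hA
  R.comp_mem (hF'.map (listμ_mem hS hS' hF hl hB (ℓ' c)))
    (R.comp_mem (hω ((mapsClass_listTensor hS (ℓ' c)).obj hB))
      (hF''.map (flatMapComparison_mem hS ℓ (h c) hA)))

end ArrowClasses

/-! ### Formulae with equal values -/

section Coherence

variable {P : Type}

/-- A strict SMI category with values of the letters. -/
structure Interpretation (P : Type) : Type (max (u + 1) (v + 1)) where
  carrier : Type u
  [category : Category.{v} carrier]
  [strictSMICategory : StrictSMICategory carrier]
  val : P → carrier

attribute [instance] Interpretation.category Interpretation.strictSMICategory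

/-- The formulae `X` and `Y` are joined, in both directions, by arrow terms whose values in strict
SMI categories are identities. -/
structure StrictlyIso (X Y : Formula P) : Prop where
  exists_hom : ∃ t : ArrowTerm X Y, ∀ i : Interpretation.{v, u} P, IsEqToHom (t.eval i.val)
  exists_inv : ∃ t : ArrowTerm Y X, ∀ i : Interpretation.{v, u} P, IsEqToHom (t.eval i.val)

namespace StrictlyIso

theorem refl (X : Formula P) : StrictlyIso.{v, u} X X :=
  ⟨⟨.id X, fun _ => .id _⟩, ⟨.id X, fun _ => .id _⟩⟩

theorem symm {X Y : Formula P} (h : StrictlyIso.{v, u} X Y) : StrictlyIso.{v, u} Y X :=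
  ⟨h.exists_inv, h.exists_hom⟩

theorem trans {X Y Z : Formula P} (h : StrictlyIso.{v, u} X Y) (h' : StrictlyIso.{v, u} Y Z) :
    StrictlyIso.{v, u} X Z := by
  obtain ⟨⟨s, hs⟩, ⟨s', hs'⟩⟩ := h
  obtain ⟨⟨t, ht⟩, ⟨t', ht'⟩⟩ := h'
  exact ⟨⟨.comp s t, fun i => (hs i).comp (ht i)⟩, ⟨.comp t' s', fun i => (ht' i).comp (hs' i)⟩⟩

theorem vee {X X' Y Y' : Formula P} (h : StrictlyIso.{v, u} X X')
    (h' : StrictlyIso.{v, u} Y Y') : StrictlyIso.{v, u} (X.vee Y) (X'.vee Y') := by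
  obtain ⟨⟨s, hs⟩, ⟨s', hs'⟩⟩ := h
  obtain ⟨⟨t, ht⟩, ⟨t', ht'⟩⟩ := h'
  exact ⟨⟨.vee s t, fun i => (hs i).tensorHom (ht i)⟩,
    ⟨.vee s' t', fun i => (hs' i).tensorHom (ht' i)⟩⟩

theorem wedge {X X' Y Y' : Formula P} (h : StrictlyIso.{v, u} X X')
    (h' : StrictlyIso.{v, u} Y Y') : StrictlyIso.{v, u} (X.wedge Y) (X'.wedge Y') := by
  obtain ⟨⟨s, hs⟩, ⟨s', hs'⟩⟩ := h
  obtain ⟨⟨t, ht⟩, ⟨t', ht'⟩⟩ := h'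
  exact ⟨⟨.wedge s t, fun i => (hs i).tensorHom (ht i)⟩,
    ⟨.wedge s' t', fun i => (hs' i).tensorHom (ht' i)⟩⟩

theorem vee_assoc (X Y Z : Formula P) :
    StrictlyIso.{v, u} ((X.vee Y).vee Z) (X.vee (Y.vee Z)) :=
  ⟨⟨.veeBInv X Y Z, fun _ => StrictSMICategory.vee_strict.isEqToHom_associator _ _ _⟩,
    ⟨.veeB X Y Z, fun _ => (StrictSMICategory.vee_strict.isEqToHom_associator _ _ _).inv⟩⟩

theorem bot_vee (X : Formula P) : StrictlyIso.{v, u} (Formula.bot.vee X) X :=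
  ⟨⟨.veeSigma X, fun _ => StrictSMICategory.vee_strict.isEqToHom_leftUnitor _⟩,
    ⟨.veeSigmaInv X, fun _ => (StrictSMICategory.vee_strict.isEqToHom_leftUnitor _).inv⟩⟩

theorem vee_bot (X : Formula P) : StrictlyIso.{v, u} (X.vee .bot) X :=
  ⟨⟨.veeDelta X, fun _ => StrictSMICategory.vee_strict.isEqToHom_rightUnitor _⟩,
    ⟨.veeDeltaInv X, fun _ => (StrictSMICategory.vee_strict.isEqToHom_rightUnitor _).inv⟩⟩

theorem wedge_assoc (X Y Z : Formula P) :
    StrictlyIso.{v, u} ((X.wedge Y).wedge Z) (X.wedge (Y.wedge Z)) :=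
  ⟨⟨.wedgeBInv X Y Z, fun _ => StrictSMICategory.wedge_strict.isEqToHom_associator _ _ _⟩,
    ⟨.wedgeB X Y Z, fun _ => (StrictSMICategory.wedge_strict.isEqToHom_associator _ _ _).inv⟩⟩

theorem top_wedge (X : Formula P) : StrictlyIso.{v, u} (Formula.top.wedge X) X :=
  ⟨⟨.wedgeSigma X, fun _ => StrictSMICategory.wedge_strict.isEqToHom_leftUnitor _⟩,
    ⟨.wedgeSigmaInv X, fun _ => (StrictSMICategory.wedge_strict.isEqToHom_leftUnitor _).inv⟩⟩

theorem wedge_top (X : Formula P) : StrictlyIso.{v, u} (X.wedge .top) X :=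
  ⟨⟨.wedgeDelta X, fun _ => StrictSMICategory.wedge_strict.isEqToHom_rightUnitor _⟩,
    ⟨.wedgeDeltaInv X, fun _ => (StrictSMICategory.wedge_strict.isEqToHom_rightUnitor _).inv⟩⟩

end StrictlyIso

variable (P) in
/-- `StrictlyIso` as a setoid. -/
def strictlyIsoSetoid : Setoid (Formula P) where
  r := StrictlyIso.{v, u}
  iseqv := ⟨.refl, .symm, .trans⟩

variable (P) in
/-- The formulae up to `StrictlyIso`. They are the objects of an indiscrete strict SMI category,
in which only strictly isomorphic formulae have the same value. -/
def FormulaClass : Type u := ULift.{u} (Quotient (strictlyIsoSetoid.{v, u} P))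

namespace FormulaClass

/-- The class of a formula. -/
def mk (X : Formula P) : FormulaClass.{v, u} P := ⟨Quotient.mk _ X⟩

theorem mk_eq {X Y : Formula P} : mk.{v, u} X = mk Y ↔ StrictlyIso.{v, u} X Y :=
  ULift.up_injective.eq_iff.trans Quotient.eq

theorem mk_surjective : Function.Surjective (mk.{v, u} (P := P)) := by
  rintro ⟨⟨X⟩⟩
  exact ⟨X, rfl⟩

instance : Category.{v} (FormulaClass.{v, u} P) where
  Hom _ _ := PUnit
  id _ := ⟨⟩
  comp _ _ := ⟨⟩

/-- The isomorphism between two objects. -/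
def iso (X Y : FormulaClass.{v, u} P) : X ≅ Y := ⟨⟨⟩, ⟨⟩, rfl, rfl⟩

section Product

variable (op : Formula P → Formula P → Formula P)
  (hop : ∀ {X X' Y Y' : Formula P}, StrictlyIso.{v, u} X X' → StrictlyIso.{v, u} Y Y' →
    StrictlyIso.{v, u} (op X Y) (op X' Y'))
  (e : Formula P)

/-- The monoidal structure induced by a product and a unit of formulae. -/
@[reducible] def monoidal : MonoidalCategory.{v} (FormulaClass.{v, u} P) where
  tensorObj X Y := ⟨Quotient.map₂ op (fun _ _ h _ _ h' => hop h h') X.down Y.down⟩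
  tensorUnit := mk e
  tensorHom _ _ := ⟨⟩
  whiskerLeft _ _ _ _ := ⟨⟩
  whiskerRight _ _ := ⟨⟩
  associator _ _ _ := iso _ _
  leftUnitor _ := iso _ _
  rightUnitor _ := iso _ _

/-- The symmetry of `monoidal`. -/
@[reducible] def symmetric :
    @SymmetricCategory.{v} (FormulaClass.{v, u} P) _ (monoidal op hop e) :=
  letI := monoidal op hop e
  { braiding := fun _ _ => iso _ _ }

variable {op e} in
theorem isStrict_monoidal
    (assoc : ∀ X Y Z, StrictlyIso.{v, u} (op (op X Y) Z) (op X (op Y Z)))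
    (left_unit : ∀ X, StrictlyIso.{v, u} (op e X) X)
    (right_unit : ∀ X, StrictlyIso.{v, u} (op X e) X) :
    IsStrict (monoidal op hop e) := by
  refine ⟨mk_surjective.forall₃.2 fun X Y Z => mk_eq.2 (assoc X Y Z),
    mk_surjective.forall.2 fun X => mk_eq.2 (left_unit X),
    mk_surjective.forall.2 fun X => mk_eq.2 (right_unit X), fun _ _ _ => rfl, fun _ => rfl,
    fun _ => rfl⟩

end Product

instance : StrictSMICategory.{v} (FormulaClass.{v, u} P) where
  veeMon := monoidal .vee .vee .bot
  veeSymm := symmetric .vee .vee .bot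
  wedgeMon := monoidal .wedge .wedge .top
  wedgeSymm := symmetric .wedge .wedge .top
  ck _ _ _ _ := ⟨⟩
  wBot := iso _ _
  wTop := iso _ _
  kappa := ⟨⟩
  ck_natural _ _ _ _ := rfl
  eq1 _ _ _ _ _ _ := rfl
  eq2 _ _ _ _ _ _ := rfl
  eq3 _ _ _ _ := rfl
  eq4 _ _ _ _ := rfl
  eq5 _ _ := rfl
  eq6 _ _ := rfl
  eq7 := rfl
  eq8 := rfl
  eq9 := rfl
  eq10 := rfl
  eq11 := rfl
  eq12 := rfl
  eq13 := rfl
  vee_strict := isStrict_monoidal .vee .vee_assoc .bot_vee .vee_bot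
  wedge_strict := isStrict_monoidal .wedge .wedge_assoc .top_wedge .wedge_top

theorem eval_mk_letter (X : Formula P) :
    X.eval (fun p => mk.{v, u} (.letter p)) = mk X := by
  induction X with
  | letter p => rfl
  | bot => rfl
  | top => rfl
  | vee X Y hX hY => exact congrArg₂ (· ∨ₒ ·) hX hY
  | wedge X Y hX hY => exact congrArg₂ (· ∧ₒ ·) hX hY

end FormulaClass

theorem StrictlyIso.of_eval_eq {X Y : Formula P}
    (h : ∀ i : Interpretation.{v, u} P, X.eval i.val = Y.eval i.val) :
    StrictlyIso.{v, u} X Y := by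
  have h_classes := h ⟨FormulaClass.{v, u} P, fun p => .mk (.letter p)⟩
  rw [FormulaClass.eval_mk_letter, FormulaClass.eval_mk_letter] at h_classes
  exact FormulaClass.mk_eq.1 h_classes

end Coherence

/-! ### Canonical families of arrows -/

section Canonical

variable {P : Type}

/-- The families of arrows, in all strict SMI categories with values of the letters, that are the
values of an arrow term. -/
inductive CanonicalHom : ∀ {X Y : ∀ i : Interpretation.{v, u} P, i.carrier},
    (∀ i, X i ⟶ Y i) → Prop
  | eval {a b : Formula P} (t : ArrowTerm a b) : CanonicalHom fun i => t.eval i.val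

theorem CanonicalHom.comp {X Y Y' Z : ∀ i : Interpretation.{v, u} P, i.carrier}
    {f : ∀ i, X i ⟶ Y i} {g : ∀ i, Y' i ⟶ Z i} (hf : CanonicalHom f) (hg : CanonicalHom g)
    (h : ∀ i, Y i = Y' i) : CanonicalHom fun i => f i ≫ eqToHom (h i) ≫ g i := by
  obtain ⟨s⟩ := hf
  obtain ⟨t⟩ := hg
  obtain ⟨e, he⟩ := (StrictlyIso.of_eval_eq h).exists_hom
  have eval_e (i : Interpretation.{v, u} P) : eqToHom (h i) = e.eval i.val :=
    (he i).2.symm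
  simp only [eval_e]
  exact .eval (.comp s (.comp e t))

/-- The arrow `f` is the value of the arrow term `a`, up to the equality of their sources and of
their targets. -/
def CanonicalArrow.Represents (a : CanonicalArrow P) {C : Type u} [Category.{v} C]
    [StrictSMICategory C] (A : P → C) {X Y : C} (f : X ⟶ Y) : Prop :=
  ∃ (hs : X = a.source.eval A) (ht : a.target.eval A = Y),
    f = eqToHom hs ≫ a.term.eval A ≫ eqToHom ht

theorem CanonicalHom.exists_represents {X Y : ∀ i : Interpretation.{v, u} P, i.carrier}
    {f : ∀ i, X i ⟶ Y i} (h : CanonicalHom f) :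
    ∃ a : CanonicalArrow P, ∀ i, a.Represents i.val (f i) := by
  obtain ⟨t⟩ := h
  exact ⟨⟨_, _, t⟩, fun i => ⟨rfl, rfl, by simp⟩⟩

variable (P) in
/-- The canonical families of arrows, and the families of objects that are the values of a
formula. -/
def canonical : ArrowClass fun i : Interpretation.{v, u} P => i.carrier where
  obj X := ∃ a : Formula P, (fun i => a.eval i.val) = X
  hom f := CanonicalHom f
  id_mem := by
    rintro _ ⟨a, rfl⟩
    exact .eval (.id a)
  comp_mem hf hg := by simpa using hf.comp hg fun _ => rfl

theorem containsMonoidal_veeMon :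
    ContainsMonoidal (canonical.{v, u} P) fun i => BiSymmetric.veeMon (C := i.carrier) where
  tensorUnit := ⟨.bot, rfl⟩
  tensorObj := by
    rintro _ _ ⟨a, rfl⟩ ⟨b, rfl⟩
    exact ⟨.vee a b, rfl⟩
  tensorHom := by
    rintro _ _ _ _ _ _ ⟨s⟩ ⟨t⟩
    exact .eval (.vee s t)
  associator := by
    rintro _ _ _ ⟨a, rfl⟩ ⟨b, rfl⟩ ⟨c, rfl⟩
    exact .eval (.veeBInv a b c)
  leftUnitor := by
    rintro _ ⟨a, rfl⟩
    exact .eval (.veeSigma a)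

theorem containsMonoidal_wedgeMon :
    ContainsMonoidal (canonical.{v, u} P) fun i => BiSymmetric.wedgeMon (C := i.carrier) where
  tensorUnit := ⟨.top, rfl⟩
  tensorObj := by
    rintro _ _ ⟨a, rfl⟩ ⟨b, rfl⟩
    exact ⟨.wedge a b, rfl⟩
  tensorHom := by
    rintro _ _ _ _ _ _ ⟨s⟩ ⟨t⟩
    exact .eval (.wedge s t)
  associator := by
    rintro _ _ _ ⟨a, rfl⟩ ⟨b, rfl⟩ ⟨c, rfl⟩
    exact .eval (.wedgeBInv a b c)
  leftUnitor := by
    rintro _ ⟨a, rfl⟩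
    exact .eval (.wedgeSigma a)

theorem containsMonoidal_monoidal :
    ∀ b : Bool, ContainsMonoidal (canonical.{v, u} P) fun i => monoidal i.carrier b
  | false => containsMonoidal_veeMon
  | true => containsMonoidal_wedgeMon

theorem containsInterchange_ofSymmetric_veeMon :
    ContainsInterchange (canonical.{v, u} P)
      fun i => Interchange.ofSymmetric (BiSymmetric.veeMon (C := i.carrier)) where
  ζ := by
    rintro _ _ _ _ ⟨a, rfl⟩ ⟨b, rfl⟩ ⟨a', rfl⟩ ⟨b', rfl⟩
    simp only [Interchange.ofSymmetric_ζ]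
    exact .eval (.comp (.veeBInv a b (a'.vee b')) (.comp (.vee (.id a)
      (.comp (.veeB b a' b') (.comp (.vee (.veeC b a') (.id b')) (.veeBInv a' b b'))))
      (.veeB a a' (b.vee b'))))
  μ := .eval (.veeSigma .bot)
  Δ := .eval (.veeSigmaInv .bot)
  ι := .eval (.id .bot)

theorem containsInterchange_ofSymmetric_wedgeMon :
    ContainsInterchange (canonical.{v, u} P)
      fun i => Interchange.ofSymmetric (BiSymmetric.wedgeMon (C := i.carrier)) where
  ζ := by
    rintro _ _ _ _ ⟨a, rfl⟩ ⟨b, rfl⟩ ⟨a', rfl⟩ ⟨b', rfl⟩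
    simp only [Interchange.ofSymmetric_ζ]
    exact .eval (.comp (.wedgeBInv a b (a'.wedge b')) (.comp (.wedge (.id a)
      (.comp (.wedgeB b a' b') (.comp (.wedge (.wedgeC b a') (.id b')) (.wedgeBInv a' b b'))))
      (.wedgeB a a' (b.wedge b'))))
  μ := .eval (.wedgeSigma .top)
  Δ := .eval (.wedgeSigmaInv .top)
  ι := .eval (.id .top)

theorem containsInterchange_intermutation :
    ContainsInterchange (canonical.{v, u} P) fun i => intermutation (C := i.carrier) where
  ζ := by
    rintro _ _ _ _ ⟨a, rfl⟩ ⟨b, rfl⟩ ⟨a', rfl⟩ ⟨b', rfl⟩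
    exact .eval (.ck a b a' b')
  μ := .eval .wTop
  Δ := .eval .wBot
  ι := .eval .kappa

theorem containsInterchange_interchange : ∀ {b b' : Bool} (h : b ≤ b'),
    ContainsInterchange (canonical.{v, u} P) fun i => interchange i.carrier h
  | false, false, _ => containsInterchange_ofSymmetric_veeMon
  | false, true, _ => containsInterchange_intermutation
  | true, true, _ => containsInterchange_ofSymmetric_wedgeMon
  | true, false, h => absurd h (by decide)

/-! ### The comparisons are canonical -/

theorem mapsClass_curryPower {N : ℕ} (k : Fin (N + 1) → SimplexCategoryᵒᵖ) :
    MapsClass ((canonical.{v, u} P).pi (MultiIndex k))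
      (((canonical P).pi (MultiIndex (tailObj k))).pi (Fin (k 0).unop.len))
      fun i => curryPower i.carrier k where
  obj hA a β := hA (Fin.cons (α := fun i => Fin (k i).unop.len) a β)
  map hf a β := hf (Fin.cons (α := fun i => Fin (k i).unop.len) a β)

theorem mapsClass_uncurryPower {N : ℕ} (k : Fin (N + 1) → SimplexCategoryᵒᵖ) :
    MapsClass (((canonical.{v, u} P).pi (MultiIndex (tailObj k))).pi (Fin (k 0).unop.len))
      ((canonical P).pi (MultiIndex k)) fun i => uncurryPower i.carrier k where
  obj hA α := hA (α 0) fun i => α i.succ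
  map hf α := hf (α 0) fun i => α i.succ

theorem mapsClass_mixedBar : ∀ {N : ℕ} (κ : Fin N → Bool) {k l : Fin N → SimplexCategoryᵒᵖ}
    (f : k ⟶ l), MapsClass ((canonical.{v, u} P).pi (MultiIndex k))
      ((canonical P).pi (MultiIndex l)) fun i => mixedBar i.carrier κ f
  | 0, _, _, _, _ => ⟨fun hA _ => hA fun i => i.elim0, fun hf _ => hf fun i => i.elim0⟩
  | _ + 1, κ, k, l, f => (mapsClass_curryPower k).comp
      (((mapsClass_listBar ((containsMonoidal_monoidal (κ 0)).pi _) (fibre (f 0))).comp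
        ((mapsClass_mixedBar (fun i => κ i.succ) (tailHom f)).pi (Fin (l 0).unop.len))).comp
          (mapsClass_uncurryPower l))

theorem containsLax_mixedBar (b : Bool) : ∀ {N : ℕ} {κ : Fin N → Bool} (h : ∀ i, b ≤ κ i)
    {k l : Fin N → SimplexCategoryᵒᵖ} (f : k ⟶ l),
    ContainsLax ((canonical.{v, u} P).pi (MultiIndex k)) ((canonical P).pi (MultiIndex l))
      fun i => LaxStructure.mixedBar (C := i.carrier) b h f
  | 0, _, _, _, _, _ =>
    ⟨fun _ => (canonical P).id_mem (containsMonoidal_monoidal b).tensorUnit, fun hA hB _ =>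
      (canonical P).id_mem ((containsMonoidal_monoidal b).tensorObj (hA _) (hB _))⟩
  | _ + 1, κ, h, k, l, f =>
    have hstep := containsLax_step ((containsMonoidal_monoidal b).pi _)
      ((containsMonoidal_monoidal (κ 0)).pi _) ((containsInterchange_interchange (h 0)).pi _)
      (mapsClass_mixedBar (fun i => κ i.succ) (tailHom f))
      (containsLax_mixedBar b (fun i => h i.succ) (tailHom f)) (fibre (f 0))
    ⟨(mapsClass_uncurryPower l).map hstep.ε, fun hA hB => (mapsClass_uncurryPower l).map
      (hstep.μ ((mapsClass_curryPower k).obj hA) ((mapsClass_curryPower k).obj hB))⟩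

theorem barComparison_mem : ∀ {N : ℕ} {κ : Fin N → Bool} (hκ : Monotone κ)
    {k l j : Fin N → SimplexCategoryᵒᵖ} {f : k ⟶ l} {g : l ⟶ j} {m : k ⟶ j} (h : f ≫ g = m)
    {A : ∀ i : Interpretation.{v, u} P, MultiIndex k → i.carrier},
    ((canonical P).pi (MultiIndex k)).obj A →
      ((canonical P).pi (MultiIndex j)).hom fun i => (barComparison hκ h).app (A i)
  | 0, _, _, _, _, _, _, _, _, _, _, hA => fun _ => (canonical P).id_mem (hA _)
  | _ + 1, κ, hκ, k, _, j, f, g, m, h, _, hA =>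
    have hmon := (containsMonoidal_monoidal (P := P) (κ 0)).pi
    (mapsClass_uncurryPower j).map (stepComparison_mem (hmon _) (hmon _)
      (mapsClass_mixedBar (fun i => κ i.succ) (tailHom f))
      (mapsClass_mixedBar (fun i => κ i.succ) (tailHom g))
      (mapsClass_mixedBar (fun i => κ i.succ) (tailHom m))
      (containsLax_mixedBar (κ 0) (fun i => hκ (Fin.zero_le i.succ)) (tailHom f))
      (barComparison_mem (monotone_tail hκ) (funext fun i => congrFun h i.succ))
      (fibre_eq_flatMap (congrFun h 0)) ((mapsClass_curryPower k).obj hA))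

theorem exists_represents_barComparison {N : ℕ} {κ : Fin N → Bool} (hκ : Monotone κ)
    {k l j : Fin N → SimplexCategoryᵒᵖ} (f : k ⟶ l) (g : l ⟶ j) (α : MultiIndex j) :
    ∃ a : CanonicalArrow (MultiIndex k), ∀ (C : Type u) [Category.{v} C] [StrictSMICategory C]
      (A : MultiIndex k → C),
      a.Represents A ((barComparison (f := f) (g := g) hκ rfl).app A α) := by
  obtain ⟨a, ha⟩ := (barComparison_mem.{v, u} hκ (rfl : f ≫ g = f ≫ g) (A := fun i => i.val)
    (fun β => ⟨.letter β, rfl⟩) α).exists_represents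
  exact ⟨a, fun C _ _ A => ha ⟨C, A⟩⟩

end Canonical

section ReducedBar

theorem tensors_eq (C : Type u) [Category.{v} C] [StrictSMICategory C] (n m : ℕ) :
    tensors C n m = fun i : Fin (n + m) => monoidal C (decide (n ≤ (i : ℕ))) := by
  funext i
  by_cases h : (i : ℕ) < n
  · rw [decide_eq_false (not_le.mpr h)]
    exact if_pos h
  · rw [decide_eq_true (not_lt.mp h)]
    exact if_neg h

theorem monotone_decide_le (n m : ℕ) :
    Monotone fun i : Fin (n + m) => decide (n ≤ (i : ℕ)) := fun _ _ hij h =>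
  decide_eq_true ((of_decide_eq_true h).trans (Fin.le_def.mp hij))

theorem exists_laxFunctor {N : ℕ} {κ : Fin N → Bool} (hκ : Monotone κ) (C : Type u)
    [Category.{v} C] [StrictSMICategory C] {T : Fin N → MonoidalCategory C}
    (hT : T = fun i => monoidal C (κ i))
    {τ : ∀ {k l j : Fin N → SimplexCategoryᵒᵖ}, (k ⟶ l) → (l ⟶ j) → MultiIndex j →
      CanonicalArrow (MultiIndex k)}
    (hτ : ∀ {k l j : Fin N → SimplexCategoryᵒᵖ} (f : k ⟶ l) (g : l ⟶ j) (A : MultiIndex k → C)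
      (α : MultiIndex j),
      (τ f g α).Represents A ((barComparison (f := f) (g := g) hκ rfl).app A α)) :
    ∃ (W : LaxFunctor (LocallyDiscrete (Fin N → SimplexCategoryᵒᵖ)) Cat.{v, u})
      (hW : W.toPrelaxFunctor = barPrelax C T),
      (∀ k : LocallyDiscrete (Fin N → SimplexCategoryᵒᵖ),
        ∃ h : 𝟙 ((barPrelax C T).obj k) = (barPrelax C T).map (𝟙 k), laxId W hW k = eqToHom h) ∧
      (∀ {k l j : Fin N → SimplexCategoryᵒᵖ} (f : k ⟶ l) (g : l ⟶ j) (A : MultiIndex k → C)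
        (α : MultiIndex j),
        let X := (iteratedBar C T g).obj ((iteratedBar C T f).obj A) α
        let Y := (iteratedBar C T (f ≫ g)).obj A α
        let ω : X ⟶ Y := (laxComp W hW f.toLoc g.toLoc).toNatTrans.app A α
        (τ f g α).Represents A ω) ∧
      (N ≤ 1 → ∀ {k l j : LocallyDiscrete (Fin N → SimplexCategoryᵒᵖ)} (f : k ⟶ l) (g : l ⟶ j),
        ∃ h : (barPrelax C T).map f ≫ (barPrelax C T).map g = (barPrelax C T).map (f ≫ g),
          laxComp W hW f g = eqToHom h) := by
  subst hT
  exact ⟨barLaxFunctor C hκ, rfl, fun k => ⟨Cat.ext (mixedBar_id κ k.as).symm, rfl⟩,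
    fun f g A α => hτ f g A α, fun hN _ _ _ f g => barLaxFunctor_mapComp_eq_eqToHom hN hκ f g⟩

end ReducedBar

end SMI

theorem mainTheorem4 (n m : ℕ) :
    -- canonical arrow terms, chosen once for all strict SMI categories
    ∃ τ : ∀ {k l j : Fin (n + m) → SimplexCategoryᵒᵖ}, (k ⟶ l) → (l ⟶ j) →
        SMI.MultiIndex j → SMI.CanonicalArrow (SMI.MultiIndex k),
      ∀ (C : Type u) [Category.{v} C] [SMI.StrictSMICategory C],
        -- the construction underlies a lax functor `W`
        ∃ (W : LaxFunctor (LocallyDiscrete (Fin (n + m) → SimplexCategoryᵒᵖ)) Cat.{v, u})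
          (hW : W.toPrelaxFunctor = SMI.reducedBar C n m),
          -- identities are preserved strictly
          (∀ k : LocallyDiscrete (Fin (n + m) → SimplexCategoryᵒᵖ),
            ∃ h : 𝟙 ((SMI.reducedBar C n m).obj k) = (SMI.reducedBar C n m).map (𝟙 k),
              SMI.laxId W hW k = eqToHom h) ∧
          -- each coordinate of the comparison `g^* ∘ f^* ⟶ (g ∘ f)^*` interprets its arrow term
          (∀ {k l j : Fin (n + m) → SimplexCategoryᵒᵖ} (f : k ⟶ l) (g : l ⟶ j)
            (A : SMI.MultiIndex k → C) (α : SMI.MultiIndex j),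
            ∃ (hs : (SMI.pull C n m g).obj ((SMI.pull C n m f).obj A) α =
                (τ f g α).source.eval A)
              (ht : (τ f g α).target.eval A = (SMI.pull C n m (f ≫ g)).obj A α),
              (SMI.laxComp W hW f.toLoc g.toLoc).toNatTrans.app A α =
                eqToHom hs ≫ (τ f g α).term.eval A ≫ eqToHom ht) ∧
          -- for `n + m ≤ 1` it is an ordinary functor
          (n + m ≤ 1 → ∀ {k l j : LocallyDiscrete (Fin (n + m) → SimplexCategoryᵒᵖ)}
            (f : k ⟶ l) (g : l ⟶ j),
            ∃ h : (SMI.reducedBar C n m).map f ≫ (SMI.reducedBar C n m).map g =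
                (SMI.reducedBar C n m).map (f ≫ g),
              SMI.laxComp W hW f g = eqToHom h) := by
  have hκ := SMI.monotone_decide_le n m
  choose τ hτ using fun (k l j : Fin (n + m) → SimplexCategoryᵒᵖ) (f : k ⟶ l) (g : l ⟶ j)
    (α : SMI.MultiIndex j) => SMI.exists_represents_barComparison.{v, u} hκ f g α
  exact ⟨fun {k l j} f g α => τ k l j f g α, fun C _ _ =>
    SMI.exists_laxFunctor hκ C (SMI.tensors_eq C n m) fun f g A α => hτ _ _ _ f g α C A⟩
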